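/- Lemma 4.2. Setting. Let Ω ⊂ ℝ³ be a bounded open set with Lipschitz boundary Σ, and Ω₁ an open set with $\bar\Omega_1\subset\Omega$ whose boundary Γ is $C^2$; put $\Omega_2=\Omega\setminus\bar\Omega_1$. Let $\mu=\mu_1\chi_{\Omega_1}+\mu_2\chi_{\Omega_2}$, $\varepsilon=\varepsilon_1\chi_{\Omega_1}+\varepsilon_2\chi_{\Omega_2}$ with constants $\mu_i,\varepsilon_i>0$, let $\alpha_0>0$, $\delta_0\in(0,1/2)$, $\sigma,\rho>0$, and $\mathsf T(t)=t+\sqrt{t^2-1}$. Mesh. $\mathcal M$ is a finite set of pairwise disjoint open axis-parallel right hexahedra, each meeting Ω, whose closures cover Ω (hanging nodes are allowed); $h_K$ is the diameter of $K$. $\mathcal M^\Gamma$ and $\mathcal M^\Sigma$ are the sets of elements $K$ with $K\cap\Gamma\ne\emptyset$ and $K\cap\Sigma\ne\emptyset$. We assume: (a) $\mathcal M^\Gamma\cap\mathcal M^\Sigma=\emptyset$. (b) For $K\in\mathcal M^\Gamma$ (resp. $\mathcal M^\Sigma$) the surface Γ (resp. Σ) intersects $K$ properly: it meets each closed edge of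 $K$ at most once and the edges of each face at most twice, and then on different open edges; if both ends of an edge lie in $\Omega_i$, so does the edge. (c) Each $K\in\mathcal M^\Gamma$ is large with respect to $\Omega_1$ and $\Omega_2$, and each $K\in\mathcal M^\Sigma$ is large with respect to $\Omega_2$, where large with respect to $\Omega_i$ means $|e\cap\Omega_i|\ge\delta_0|e|$ for every edge $e$ of $K$ meeting $\Omega_i$. (d) $h_K\le\sigma\,\ell$ for every side length $\ell$ of every $K$, and $h_K\le\rho h_{K'}$ whenever $K\ne K'$ share a face of positive area. (e) For each $K\in\mathcal M^\Gamma$ a decomposition $\bar K=\bar K_1^h\cup\bar K_2^h$ into two polyhedra with disjoint interiors is fixed. Here $K_i^h$ is a union of nondegenerate tetrahedra with a common vertex $A_K^i$ that is a vertex of $K$ in $\Omega_i$; their other vertices are vertices of $K$ in $\Omega_i$ or points of Γ on edges of $K$. Also $\partial K_1^h\cap\partial K_2^h$ is a nonempty union of triangles with vertices on Γ and on edges of $K$. $\Gamma_K^h$ is a plane, among the planes of these triangles, that minimizes $\mathrm{dist}_H(\Gamma_K,\cdot)$, where $\Gamma_K=K\cap\Gamma$ and $\mathrm{dist}_H(S,P)=\sup_{x\in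 S}\mathrm{dist}(x,P)$; it contains neither $A_K^1$ nor $A_K^2$. The interface deviation is $\eta_K=\max_{i=1,2}\mathrm{dist}_H(\Gamma_K,\Gamma_K^h)/\mathrm{dist}(A_K^i,\Gamma_K^h)$. For each $K\in\mathcal M^\Sigma$ a polyhedron $K^h\subset K$ is fixed in the same way, a union of nondegenerate tetrahedra with a common vertex $A'_K$ that is a vertex of $K$ in $\Omega_2$, the other vertices being vertices of $K$ in $\Omega_2$ or points of Σ on edges of $K$; $\overline{\partial K^h\setminus\partial K}$ is a nonempty union of triangles with vertices on Σ and on edges of $K$. $\Sigma_K^h\not\ni A'_K$ is a plane among the planes of these triangles minimizing $\mathrm{dist}_H(K\cap\Sigma,\cdot)$, and the boundary deviation is $\eta_K=\mathrm{dist}_H(K\cap\Sigma,\Sigma_K^h)/\mathrm{dist}(A'_K,\Sigma_K^h)$. (f) $\eta_K\le\frac12$ for all $K\in\mathcal M^\Gamma\cup\mathcal M^\Sigma$. Faces. $\mathcal F^{\rm int}$ is the set of interior faces $F=\partial K\cap\partial K'$; $\mathcal F^\Gamma=\{\Gamma_K\}$; $\mathcal F^\Sigma=\{\Sigma_K\}$,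 where $\Sigma_K$ is the part of Σ adjacent to $K$ from the inside ($K\cap\Sigma$ and, if there are any, the parts of faces of $K$ lying on Σ at which $K$ is inside). $\mathcal F=\mathcal F^{\rm int}\cup\mathcal F^\Gamma$ and $\overline{\mathcal F}=\mathcal F\cup\mathcal F^\Sigma$. Each $F\in\mathcal F^{\rm int}$ has a fixed, arbitrary unit normal $n$; $n$ is the unit outer normal to $\Omega_1$ on Γ and to Ω on Σ. With $v_\pm$ the trace from the side $\pm n$, $[\![v]\!]=v_--v_+$ on $\mathcal F$ and $[\![v]\!]=v_-$ on $\mathcal F^\Sigma$. Integrals over interior faces are over $F\cap\Omega$. Put $h_F=(h_K+h_{K'})/2$ on $\mathcal F^{\rm int}$ and $h_F=h_K$ on $\Gamma_K,\Sigma_K$; $\Theta_K=\mathsf T\big(\frac{1+3\eta_K}{1-\eta_K}\big)^{6p}$ for $K\in\mathcal M^\Gamma\cup\mathcal M^\Sigma$ and $\Theta_K=1$ otherwise; $\Theta_F=\max\{\Theta_K:F\cap\bar K\ne\emptyset\}$; $\alpha|_F=\alpha_0\Theta_F$ and $\tau|_F=h_Fp^{-2}$. Space and forms. For $p\ge1$,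 $\boldsymbol X_p(\mathcal M)$ is the space of complex vector fields on Ω that on each nonempty $K\cap\Omega_i$ coincide with a vector of polynomials of degree at most $p$ in each variable. $(\cdot,\cdot)_{\mathcal M}$ is the sum over $K$ of the $L^2(K\cap\Omega)$ inner products, with norm $\|\cdot\|_{\mathcal M}$, $\langle\cdot,\cdot\rangle$ is the sum over faces of the $L^2(F)$ inner products, with corresponding norms, and $\nabla_h\times$ is the curl taken on each $K\cap\Omega_i$. The lifting $\mathsf L(v)\in\boldsymbol X_p(\mathcal M)$ is defined by $(\mathsf L(v),t)_{\mathcal M}=\langle[\![n\times v]\!],t_-\rangle_{\overline{\mathcal F}}$ for all $t\in\boldsymbol X_p(\mathcal M)$, and $$a(u,v)=(\mu^{-1}(\nabla_h\times u-\mathsf L(u)),\nabla_h\times v-\mathsf L(v))_{\mathcal M}+\langle\alpha\tau^{-1}[\![n\times u]\!],[\![n\times v]\!]\rangle_{\overline{\mathcal F}}+\langle\alpha\tau^{-1}[\![\varepsilon u\cdot n]\!],[\![\varepsilon v\cdot n]\!]\rangle_{\mathcal F},$$ $$|v|^2_{\boldsymbol X_p(\mathcal M)}=\|\nabla_h\times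 v\|^2_{\mathcal M}+\|\alpha^{1/2}\tau^{-1/2}[\![n\times v]\!]\|^2_{\overline{\mathcal F}}+\|\alpha^{1/2}\tau^{-1/2}[\![\varepsilon v\cdot n]\!]\|^2_{\mathcal F}.$$ Statement. There is a constant $c_{\rm coer}>0$, depending only on $\Omega,\Omega_1,\mu_i,\varepsilon_i,\alpha_0,\delta_0,\sigma,\rho$ (hence independent of $p$, of the mesh $\mathcal M$ and its sizes $h_K$, and of the deviations $\eta_K$), such that for all such meshes $\mathcal M$, all $p\ge1$ and all $v\in\boldsymbol X_p(\mathcal M)$ the lifting $\mathsf L(v)$ exists and is unique, and $$|a(v,v)|\ge c_{\rm coer}\,|v|^2_{\boldsymbol X_p(\mathcal M)}.$$ -/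

import Mathlib

open MeasureTheory Filter Topology
open scoped Matrix ENNReal

noncomputable section

namespace UnfittedMaxwell

/-- Points of physical space. -/
abbrev E3 := EuclideanSpace ℝ (Fin 3)

/-- Values of complex vector fields; `u ⬝ᵥ star v` is the Hermitian product of `ℂ³`. -/
abbrev C3 := Fin 3 → ℂ

/-- Surface measure in `ℝ³` (the two-dimensional Hausdorff measure, normalised as area). -/
def area : Measure E3 := μHE[2]

/-! ### Domains with graph boundaries, unit normals -/

/-- In a neighbourhood of each boundary point and after a linear isometry, `D` is the set below
the graph of a function with the regularity `P`. -/
def HasGraphBoundary (P : (EuclideanSpace ℝ (Fin 2) → ℝ) → Prop) (D : Set E3) : Prop :=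
  ∀ x ∈ frontier D, ∃ r > 0, ∃ L : E3 ≃ₗᵢ[ℝ] E3, ∃ Ψ : EuclideanSpace ℝ (Fin 2) → ℝ,
    P Ψ ∧ ∀ y ∈ Metric.ball x r, (y ∈ D ↔ (L y) 2 < Ψ !₂[(L y) 0, (L y) 1])

def HasC2Boundary (D : Set E3) : Prop := HasGraphBoundary (fun Ψ => ContDiff ℝ 2 Ψ) D

def HasLipschitzBoundary (D : Set E3) : Prop :=
  HasGraphBoundary (fun Ψ => ∃ C, LipschitzWith C Ψ) D

/-- `n` is the unit outer normal to `D` at `x`: near `x`, every open cone around `-n` that avoids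
the tangent plane lies in `D`, and every such cone around `n` lies outside `D`. -/
def IsOuterNormal (D : Set E3) (x n : E3) : Prop :=
  ‖n‖ = 1 ∧ ∀ κ > 0, ∀ᶠ y in 𝓝 x,
    (inner ℝ (y - x) n < -(κ * ‖y - x‖) → y ∈ D) ∧ (κ * ‖y - x‖ < inner ℝ (y - x) n → y ∉ D)

open Classical in
/-- The unit outer normal to `D` at `x` (zero where there is none). -/
def outerNormal (D : Set E3) (x : E3) : E3 :=
  if h : ∃ n, IsOuterNormal D x n then h.choose else 0

/-- A bounded open set `Ω` with Lipschitz boundary and a subdomain `Ω₁` with `C²` boundary whose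
closure lies in `Ω`. -/
structure Geometry where
  Ω : Set E3
  Ω₁ : Set E3
  isOpen_Ω : IsOpen Ω
  bounded_Ω : Bornology.IsBounded Ω
  lipschitz_Ω : HasLipschitzBoundary Ω
  isOpen_Ω₁ : IsOpen Ω₁
  closure_Ω₁ : closure Ω₁ ⊆ Ω
  c2_Ω₁ : HasC2Boundary Ω₁

namespace Geometry

variable (G : Geometry)

/-- The interface. -/
def Γ : Set E3 := frontier G.Ω₁

/-- The outer boundary. -/
def bd : Set E3 := frontier G.Ω

/-- The two subdomains `Ω₁` (index `0`) and `Ω₂ = Ω \ closure Ω₁` (index `1`). -/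
def sub (i : Fin 2) : Set E3 := if i = 0 then G.Ω₁ else G.Ω \ closure G.Ω₁

open Classical in
/-- The piecewise constant function `c₁ χ_{Ω₁} + c₂ χ_{Ω₂}`. -/
def coef (c : Fin 2 → ℝ) (x : E3) : ℝ := ∑ i, if x ∈ G.sub i then c i else 0

end Geometry

/-! ### Right hexahedra -/

/-- An axis-parallel right hexahedron. -/
structure Box where
  lo : E3
  hi : E3
  lt : ∀ i, lo i < hi i

namespace Box

variable (K : Box)

/-- Elements are open. -/
def carrier : Set E3 := {x | ∀ i, K.lo i < x i ∧ x i < K.hi i}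

/-- The diameter `h_K`. -/
def h : ℝ := dist K.lo K.hi

def vertex (c : Fin 3 → Bool) : E3 := WithLp.toLp 2 fun i => if c i then K.hi i else K.lo i

def vertices : Set E3 := Set.range K.vertex

/-- The closed edge in direction `j` through the vertex `c`. -/
def edge (j : Fin 3) (c : Fin 3 → Bool) : Set E3 :=
  segment ℝ (K.vertex (Function.update c j false)) (K.vertex (Function.update c j true))

/-- The open edge in direction `j` through the vertex `c`. -/
def openEdge (j : Fin 3) (c : Fin 3 → Bool) : Set E3 :=
  openSegment ℝ (K.vertex (Function.update c j false)) (K.vertex (Function.update c j true))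

/-- The intersection points of a surface `S` with the edges of `K`. -/
def edgePoints (S : Set E3) : Set E3 := S ∩ ⋃ j, ⋃ c, K.edge j c

/-- The fraction `|e ∩ D| / |e|` of the length of the edge `e` that lies in `D`. -/
def edgeFraction (D : Set E3) (j : Fin 3) (c : Fin 3 → Bool) : ℝ≥0∞ :=
  volume {s : ℝ | s ∈ Set.Icc (0 : ℝ) 1 ∧
    AffineMap.lineMap (K.vertex (Function.update c j false))
      (K.vertex (Function.update c j true)) s ∈ D}

/-- `|e ∩ D| ≥ δ₀ |e|` for each edge `e` that meets `D`. -/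
def IsLarge (δ₀ : ℝ) (D : Set E3) : Prop :=
  ∀ j c, (K.edge j c ∩ D).Nonempty → ENNReal.ofReal δ₀ ≤ K.edgeFraction D j c

/-- The union of the four edges of the face on which the `i`-th coordinate is extremal
(maximal if `b` is true, minimal otherwise). -/
def faceEdges (i : Fin 3) (b : Bool) : Set E3 :=
  ⋃ j, ⋃ c, ⋃ (_ : j ≠ i ∧ c i = b), K.edge j c

/-- The surface `S` intersects each edge at most once, the edges in each face at most twice and
then on different open sides, and edges with both ends in a subdomain stay in it. -/
def IsProper (G : Geometry) (S : Set E3) : Prop :=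
  (∀ j c, (S ∩ K.edge j c).Subsingleton) ∧
  (∀ i b, (S ∩ K.faceEdges i b).encard ≤ 2 ∧
    ∀ x ∈ S ∩ K.faceEdges i b, ∀ y ∈ S ∩ K.faceEdges i b, x ≠ y →
      ∃ j c j' c', (j ≠ i ∧ c i = b) ∧ (j' ≠ i ∧ c' i = b) ∧
        K.openEdge j c ≠ K.openEdge j' c' ∧ x ∈ K.openEdge j c ∧ y ∈ K.openEdge j' c') ∧
  (∀ (a : Fin 2) j c, K.vertex (Function.update c j false) ∈ G.sub a →
    K.vertex (Function.update c j true) ∈ G.sub a → K.edge j c ⊆ G.sub a)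

end Box

/-! ### Polyhedral approximation of cut elements, interface and boundary deviation -/

/-- A union of `m ≥ 1` tetrahedra with a common vertex `apex`, which is a vertex of `K` inside `D`;
all vertices are vertices of `K` inside `D` or intersection points of `S` and the edges of `K`. -/
structure PolyPart (K : Box) (D S : Set E3) where
  m : ℕ
  pos : 1 ≤ m
  apex : E3
  base : Fin m → Fin 3 → E3
  apex_mem : apex ∈ K.vertices ∩ D
  base_mem : ∀ j l, base j l ∈ (K.vertices ∩ D) ∪ K.edgePoints S
  nondeg : ∀ j, AffineIndependent ℝ (Fin.cons apex (base j) : Fin 4 → E3)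

/-- The closed polyhedron. -/
def PolyPart.region {K : Box} {D S : Set E3} (P : PolyPart K D S) : Set E3 :=
  ⋃ j, convexHull ℝ (insert P.apex (Set.range (P.base j)))

/-- Triangles `f_j` with vertices in `V`, one of which (`sel`) is selected. -/
structure Triangles (V : Set E3) where
  J : ℕ
  tri : Fin J → Fin 3 → E3
  mem : ∀ j l, tri j l ∈ V
  nondeg : ∀ j, AffineIndependent ℝ (tri j)
  sel : Fin J

namespace Triangles

variable {V : Set E3} (t : Triangles V)

/-- The plane `F_j` of the triangle `f_j`. -/
def plane (j : Fin t.J) : Set E3 := affineSpan ℝ (Set.range (t.tri j))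

/-- The union of the closed triangles. -/
def union : Set E3 := ⋃ j, convexHull ℝ (Set.range (t.tri j))

end Triangles

/-- The one-sided Hausdorff distance: how far `S` deviates from `P`. -/
def distH (S P : Set E3) : ℝ := ⨆ x : S, Metric.infDist (x : E3) P

/-- A decomposition of an interface element into polyhedra `K₁ʰ`, `K₂ʰ`, the triangles forming
`∂K₁ʰ ∩ ∂K₂ʰ`, and the plane `Γ_Kʰ` among their planes that is closest to `Γ_K = K ∩ Γ`. -/
structure InterfaceCut (G : Geometry) (K : Box) where
  part : (i : Fin 2) → PolyPart K (G.sub i) G.Γ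
  cover : closure K.carrier = (part 0).region ∪ (part 1).region
  disj : Disjoint (interior (part 0).region) (interior (part 1).region)
  tris : Triangles (K.edgePoints G.Γ)
  tris_union : frontier (part 0).region ∩ frontier (part 1).region = tris.union
  sel_min : ∀ j, distH (K.carrier ∩ G.Γ) (tris.plane tris.sel) ≤
    distH (K.carrier ∩ G.Γ) (tris.plane j)
  apex_off : ∀ i, (part i).apex ∉ tris.plane tris.sel

/-- The interface deviation. -/
def InterfaceCut.η {G : Geometry} {K : Box} (c : InterfaceCut G K) : ℝ :=
  ⨆ i : Fin 2, distH (K.carrier ∩ G.Γ) (c.tris.plane c.tris.sel) /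
    Metric.infDist (c.part i).apex (c.tris.plane c.tris.sel)

/-- A polyhedron `Kʰ` in a boundary element, the triangles forming `∂Kʰ \ ∂K`, and the plane
`Σ_Kʰ` among their planes that is closest to `Σ_K = K ∩ Σ`. -/
structure BoundaryCut (G : Geometry) (K : Box) where
  part : PolyPart K (G.sub 1) G.bd
  tris : Triangles (K.edgePoints G.bd)
  tris_union : closure (frontier part.region \ frontier K.carrier) = tris.union
  sel_min : ∀ j, distH (K.carrier ∩ G.bd) (tris.plane tris.sel) ≤
    distH (K.carrier ∩ G.bd) (tris.plane j)
  apex_off : part.apex ∉ tris.plane tris.sel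

/-- The boundary deviation. -/
def BoundaryCut.η {G : Geometry} {K : Box} (c : BoundaryCut G K) : ℝ :=
  distH (K.carrier ∩ G.bd) (c.tris.plane c.tris.sel) /
    Metric.infDist c.part.apex (c.tris.plane c.tris.sel)

/-- `𝖳(t) = t + √(t² - 1)`. -/
def T (t : ℝ) : ℝ := t + √(t ^ 2 - 1)

/-! ### Meshes -/

/-- A finite mesh of right hexahedra that covers `Ω`, possibly with hanging nodes, with a fixed
polyhedral decomposition of each cut element and a fixed orientation of each interior face:
`ori K K'` says that the normal of the common face points from `K` to `K'`. -/
structure Mesh (G : Geometry) where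
  n : ℕ
  elem : Fin n → Box
  disj : Pairwise fun K K' => Disjoint (elem K).carrier (elem K').carrier
  meets : ∀ K, ((elem K).carrier ∩ G.Ω).Nonempty
  cover : G.Ω ⊆ ⋃ K, closure (elem K).carrier
  ori : Fin n → Fin n → Prop
  ori_irrefl : ∀ K, ¬ ori K K
  ori_iff : ∀ K K', K ≠ K' → (ori K K' ↔ ¬ ori K' K)
  cutΓ : ∀ K, ((elem K).carrier ∩ G.Γ).Nonempty → InterfaceCut G (elem K)
  cutBd : ∀ K, ((elem K).carrier ∩ G.bd).Nonempty → BoundaryCut G (elem K)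

/-- Interior faces (indexed by pairs of elements) and pieces `Γ_K` of the interface. -/
abbrev InnerFace (n : ℕ) := (Fin n × Fin n) ⊕ Fin n

/-- All faces: inner ones and pieces `Σ_K` of the boundary. -/
abbrev Face (n : ℕ) := InnerFace n ⊕ Fin n

namespace Mesh

variable {G : Geometry} (M : Mesh G)

/-- `K ∈ 𝓜^Γ` -/
def MeetsΓ (K : Fin M.n) : Prop := ((M.elem K).carrier ∩ G.Γ).Nonempty

/-- `K ∈ 𝓜^Σ` -/
def MeetsBd (K : Fin M.n) : Prop := ((M.elem K).carrier ∩ G.bd).Nonempty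

open Classical in
/-- The deviation `η_K` of a cut element (zero for the others). -/
def η (K : Fin M.n) : ℝ :=
  if hΓ : M.MeetsΓ K then (M.cutΓ K hΓ).η
  else if hB : M.MeetsBd K then (M.cutBd K hB).η else 0

/-- The standing assumptions on the mesh: no element meets both the interface and the boundary,
both surfaces intersect elements properly, cut elements are large with parameter `δ₀`, deviations
are at most `1/2`, elements are shape regular, neighbours are of comparable size. -/
structure Admissible (δ₀ σ ρ : ℝ) : Prop where
  not_both : ∀ K, ¬ (M.MeetsΓ K ∧ M.MeetsBd K)
  proper_Γ : ∀ K, M.MeetsΓ K → (M.elem K).IsProper G G.Γ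
  proper_bd : ∀ K, M.MeetsBd K → (M.elem K).IsProper G G.bd
  large_Γ : ∀ K, M.MeetsΓ K → ∀ i, (M.elem K).IsLarge δ₀ (G.sub i)
  large_bd : ∀ K, M.MeetsBd K → (M.elem K).IsLarge δ₀ (G.sub 1)
  deviation : ∀ K, M.MeetsΓ K ∨ M.MeetsBd K → M.η K ≤ 1 / 2
  shape_regular : ∀ K i, (M.elem K).h ≤ σ * ((M.elem K).hi i - (M.elem K).lo i)
  comparable : ∀ K K', K ≠ K' →
    0 < area (closure (M.elem K).carrier ∩ closure (M.elem K').carrier) →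
    (M.elem K).h ≤ ρ * (M.elem K').h

/-! ### Faces, normals, weights -/

/-- `Σ_K`: the boundary points at which `K` is the adjacent element on the inside. Up to a set of
area zero this is `K ∩ Σ` together with those parts of faces of `K` that lie on `Σ`. -/
def bdPiece (K : Fin M.n) : Set E3 :=
  {x ∈ G.bd | ∀ᶠ t in 𝓝[>] (0 : ℝ), x - t • outerNormal G.Ω x ∈ (M.elem K).carrier}

open Classical in
/-- The faces as sets. The pair `(K, K')` stands for the common face of `K` and `K'`, with normal
pointing from `K` to `K'`; pairs without a common two-dimensional face have area zero. -/
def faceSet : Face M.n → Set E3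
  | .inl (.inl (K, K')) =>
      if M.ori K K' then closure (M.elem K).carrier ∩ closure (M.elem K').carrier else ∅
  | .inl (.inr K) => (M.elem K).carrier ∩ G.Γ
  | .inr K => M.bdPiece K

/-- The part of the face on which functions on `Ω` have jumps: interior faces are restricted
to `Ω`. -/
def faceDom : Face M.n → Set E3
  | .inl (.inl f) => M.faceSet (.inl (.inl f)) ∩ G.Ω
  | f => M.faceSet f

/-- The unit normal `n` on a face; for the common face of two boxes it is `±` a unit coordinate
vector. -/
def normal : Face M.n → E3 → E3
  | .inl (.inl (K, K')), _ => WithLp.toLp 2 fun i =>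
      if (M.elem K).hi i = (M.elem K').lo i then 1
      else if (M.elem K).lo i = (M.elem K').hi i then -1 else 0
  | .inl (.inr _), x => outerNormal G.Ω₁ x
  | .inr _, x => outerNormal G.Ω x

/-- `h_F` -/
def faceH : Face M.n → ℝ
  | .inl (.inl (K, K')) => ((M.elem K).h + (M.elem K').h) / 2
  | .inl (.inr K) => (M.elem K).h
  | .inr K => (M.elem K).h

open Classical in
/-- `Θ_K` -/
def ΘK (p : ℕ) (K : Fin M.n) : ℝ :=
  if M.MeetsΓ K ∨ M.MeetsBd K then T ((1 + 3 * M.η K) / (1 - M.η K)) ^ (6 * p) else 1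

/-- `Θ_F`, the maximum of `Θ_K` over the elements whose closure meets `F`. -/
def ΘF (p : ℕ) (f : Face M.n) : ℝ :=
  ⨆ K : {K : Fin M.n // (M.faceSet f ∩ closure (M.elem K).carrier).Nonempty}, M.ΘK p K.1

/-- The penalty weight `α τ⁻¹` with `α = α₀ Θ_F` and `τ = h_F p⁻²`. -/
def weight (α₀ : ℝ) (p : ℕ) (f : Face M.n) : ℝ :=
  α₀ * M.ΘF p f * (M.faceH f * ((p : ℝ) ^ 2)⁻¹)⁻¹

/-! ### The finite element space -/

/-- `𝑿_p(𝓜)`: vector fields that agree on each `K ∩ Ω_i` with a vector of polynomials of degree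
at most `p` in each variable. Their values on the null set of faces, `Γ` and `Σ` play no role and
are fixed to be zero, as are the values outside `Ω`. -/
def Xp (p : ℕ) : Set (E3 → C3) :=
  {v | (∀ K i, ∃ q : Fin 3 → MvPolynomial (Fin 3) ℂ,
          (∀ l j, (q l).degreeOf j ≤ p) ∧
          ∀ x ∈ (M.elem K).carrier ∩ G.sub i, ∀ l,
            v x l = MvPolynomial.eval (fun j => ((x j : ℝ) : ℂ)) (q l)) ∧
       ∀ x, (∀ K i, x ∉ (M.elem K).carrier ∩ G.sub i) → v x = 0}

end Mesh

/-! ### Traces, jumps, curl -/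

/-- The one-sided trace of `v` at `x` from the direction `d`. -/
def traceFrom {V : Type*} [TopologicalSpace V] [Nonempty V] (v : E3 → V) (x d : E3) : V :=
  limUnder (𝓝[>] (0 : ℝ)) fun t => v (x + t • d)

/-- A real vector as a complex one. -/
def toC3 (n : E3) : C3 := fun i => ((n i : ℝ) : ℂ)

/-- `∂_j v_l` -/
def pd (v : E3 → C3) (j l : Fin 3) (x : E3) : ℂ :=
  fderiv ℝ v x (EuclideanSpace.single j (1 : ℝ)) l

/-- The pointwise curl; for piecewise polynomial fields this is `∇_h ×` almost everywhere. -/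
def curl (v : E3 → C3) (x : E3) : C3 :=
  ![pd v 1 2 x - pd v 2 1 x, pd v 2 0 x - pd v 0 2 x, pd v 0 1 x - pd v 1 0 x]

/-- `|z|²` for `z ∈ ℂ³` -/
def sqNorm (z : C3) : ℝ := ∑ l, ‖z l‖ ^ 2

namespace Mesh

variable {G : Geometry} (M : Mesh G)

/-- `v₋`, the trace from the side opposite to the normal. -/
def traceMinus (f : Face M.n) (v : E3 → C3) (x : E3) : C3 := traceFrom v x (-(M.normal f x))

/-- `v₊`, the trace from the side of the normal. -/
def tracePlus (f : Face M.n) (v : E3 → C3) (x : E3) : C3 := traceFrom v x (M.normal f x)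

/-- `⟦v⟧ = v₋ - v₊` on inner faces and `⟦v⟧ = v₋` on the boundary. -/
def jump : Face M.n → (E3 → C3) → E3 → C3
  | .inl f, v, x => M.traceMinus (.inl f) v x - M.tracePlus (.inl f) v x
  | .inr f, v, x => M.traceMinus (.inr f) v x

/-- `⟦n × v⟧` -/
def jumpT (f : Face M.n) (v : E3 → C3) (x : E3) : C3 := toC3 (M.normal f x) ⨯₃ M.jump f v x

/-- `⟦ε v · n⟧` -/
def jumpN (ε : Fin 2 → ℝ) (f : InnerFace M.n) (v : E3 → C3) (x : E3) : ℂ :=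
  M.jump (.inl f) (fun y => ((G.coef ε y : ℝ) : ℂ) • v y) x ⬝ᵥ toC3 (M.normal (.inl f) x)

/-- `(u, v)_𝓜` for functions on `Ω` -/
def ip (u v : E3 → C3) : ℂ := ∑ K, ∫ x in (M.elem K).carrier ∩ G.Ω, u x ⬝ᵥ star (v x)

/-- `w = 𝖫(v)`: `w ∈ 𝑿_p(𝓜)` and `(w, t)_𝓜 = ⟨⟦n × v⟧, t⁻⟩` over all faces, for all
`t ∈ 𝑿_p(𝓜)`. -/
def IsLifting (p : ℕ) (v w : E3 → C3) : Prop :=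
  w ∈ M.Xp p ∧ ∀ t ∈ M.Xp p,
    M.ip w t = ∑ f : Face M.n,
      ∫ x in M.faceDom f, M.jumpT f v x ⬝ᵥ star (M.traceMinus f t x) ∂area

open Classical in
/-- The lifting operator `𝖫`. -/
def lifting (p : ℕ) (v : E3 → C3) : E3 → C3 :=
  if h : ∃ w, M.IsLifting p v w then h.choose else 0

/-- The sesquilinear form `a(u, v)`. -/
def a (μ ε : Fin 2 → ℝ) (α₀ : ℝ) (p : ℕ) (u v : E3 → C3) : ℂ :=
  M.ip (fun x => (((G.coef μ x)⁻¹ : ℝ) : ℂ) • (curl u x - M.lifting p u x))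
      (fun x => curl v x - M.lifting p v x)
  + (∑ f : Face M.n, ((M.weight α₀ p f : ℝ) : ℂ) *
      (∫ x in M.faceDom f, M.jumpT f u x ⬝ᵥ star (M.jumpT f v x) ∂area))
  + (∑ f : InnerFace M.n, ((M.weight α₀ p (.inl f) : ℝ) : ℂ) *
      (∫ x in M.faceDom (.inl f), M.jumpN ε f u x * star (M.jumpN ε f v x) ∂area))

/-- The square of the DG seminorm `|v|_{𝑿_p(𝓜)}`. -/
def seminormSq (ε : Fin 2 → ℝ) (α₀ : ℝ) (p : ℕ) (v : E3 → C3) : ℝ :=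
  (∑ K, ∫ x in (M.elem K).carrier ∩ G.Ω, sqNorm (curl v x))
  + (∑ f : Face M.n, M.weight α₀ p f *
      (∫ x in M.faceDom f, sqNorm (M.jumpT f v x) ∂area))
  + (∑ f : InnerFace M.n, M.weight α₀ p (.inl f) *
      (∫ x in M.faceDom (.inl f), ‖M.jumpN ε f v x‖ ^ 2 ∂area))

end Mesh

end UnfittedMaxwell

end

/-! Coercivity is elementary once the lifting is bounded by the tangential jumps. On the diagonal the
form is a sum of squares (`a_self`), so only `‖∇ₕ × v‖` has to be recovered from
`‖∇ₕ × v - L(v)‖`, and `‖∇ₕ × v‖² ≤ 2 ‖∇ₕ × v - L(v)‖² + 2 ‖L(v)‖²`. Testing the definition of the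
lifting with the lifting itself, Young's inequality bounds `‖L(v)‖²` by the weighted tangential
jumps (`normSq_lifting_le`), provided that the weighted traces of a field in the finite element
space are bounded by its `L²` norm, uniformly in the mesh, the degree and the way the elements are
cut. This inverse trace inequality (`exists_inverse_trace`) is the substance of the proof. The
lifting itself exists by Riesz representation on the finite-dimensional space `Xₚ`
(`existsUnique_isLifting`).

Let an element `K` be cut, let `A` be its apex in the subdomain `Ωᵢ`, and let `η ≤ 1/2` be the
deviation of the surface from the selected plane, relative to the distance of `A` from the plane.
The part of `K` in the open half space that contains `A` and ends at the deviation before the plane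
does not meet the surface, hence lies in `Ωᵢ`. The homothety about `A` with the ratio
`θ = (1 - η) / (1 + η)` maps the part of `K` that ends at the deviation beyond the plane, a convex
set, into the closure of the former part. A polynomial of degree `n` grows from `[0, θR]` to
`[0, R]` by a factor of order `𝖳(2/θ - 1)ⁿ` in the `L²` sense (`integral_sq_le_T_pow`, by
expansion in Legendre polynomials), and `2/θ - 1 = (1 + 3η) / (1 - η)`. In polar coordinates about
`A` (`lintegral_sq_le_homothety`) this bounds the integrals of squares of polynomials over a convex
set `Q ⊇ K ∩ Ωᵢ`, called a core, by `C Θ_K` times those over `K ∩ Ωᵢ` (`Box.exists_core`,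
`Admissible.exists_hasCore`); the exponent `6p` arises because polynomials of degree `p` in each of
three variables have degree `3p` on lines. Since the subdomain is large, `Q` contains points at a
distance comparable to `h_K` from `A` on the three edges at `A`.

On a core all inequalities are free of the surface. Traces on the faces of `K` are bounded by
integrals over cones with their apex in `Q` (`lintegral_plane_trace`, `face_trace`), and
directional derivatives by Markov's inequality for radial derivatives about two points
(`lintegral_markov`). For the trace on the surface one follows the vertical line of a graph chart
from a point of the surface into the domain, until it leaves `K` through a face or for a fixed
length (`sq_le_on_graph`, `graph_trace`); by compactness finitely many charts suffice, which depend
only on the surface (`exists_trace_const`).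

The traces in the definitions are limits along normals and the faces are arbitrary subsets of plane
faces and surfaces, so some measure theory is needed to identify them with traces of polynomials:
outer normals are Borel functions (`measurable_outerNormal`), and almost every point of a plane
face is the origin of rays, in the directions of both normals, that start in a single subdomain,
because where the interface touches the plane, its normal is almost everywhere the normal of the
plane (`area_tangential`, `ae_inner`). -/

open scoped NNReal

noncomputable section

namespace UnfittedMaxwell

/-! ### Legendre polynomials -/

open Polynomial in
/-- The Legendre polynomials, by their three term recurrence. -/
def legendre : ℕ → ℝ[X]
  | 0 => 1
  | 1 => X
  | k + 2 => C ((k + 2 : ℝ)⁻¹) * (C (2 * k + 3 : ℝ) * (X * legendre (k + 1)) -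
      C (k + 1 : ℝ) * legendre k)

section Legendre

open Polynomial

lemma legendre_rec (k : ℕ) : C (k + 2 : ℝ) * legendre (k + 2) =
    C (2 * k + 3 : ℝ) * (X * legendre (k + 1)) - C (k + 1 : ℝ) * legendre k := by
  rw [legendre, ← mul_assoc, ← C_mul, mul_inv_cancel₀ (by positivity), C_1, one_mul]

lemma legendre_natDegree_le : ∀ k, (legendre k).natDegree ≤ k
  | 0 => by simp [legendre]
  | 1 => by simp [legendre]
  | k + 2 => by
    have h1 := legendre_natDegree_le (k + 1)
    have h0 := legendre_natDegree_le k
    rw [legendre]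
    refine (natDegree_C_mul_le _ _).trans ((natDegree_sub_le _ _).trans (max_le ?_ ?_))
    · refine (natDegree_C_mul_le _ _).trans (natDegree_mul_le.trans ?_)
      rw [natDegree_X]; omega
    · exact (natDegree_C_mul_le _ _).trans (by omega)

lemma legendre_coeff_ne_zero : ∀ k, (legendre k).coeff k ≠ 0
  | 0 => by simp [legendre]
  | 1 => by simp [legendre]
  | k + 2 => by
    have h1 := legendre_coeff_ne_zero (k + 1)
    have h0 : (legendre k).coeff (k + 2) = 0 :=
      coeff_eq_zero_of_natDegree_lt (by have := legendre_natDegree_le k; omega)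
    rw [legendre]
    simp only [coeff_C_mul, coeff_sub, coeff_X_mul, h0, mul_zero, sub_zero]
    have : (2 * k + 3 : ℝ) ≠ 0 := by positivity
    have : (k + 2 : ℝ) ≠ 0 := by positivity
    positivity

lemma legendre_eval_one : ∀ k, (legendre k).eval 1 = 1
  | 0 => by simp [legendre]
  | 1 => by simp [legendre]
  | k + 2 => by
    have h1 := legendre_eval_one (k + 1)
    have h0 := legendre_eval_one k
    rw [legendre]
    simp only [eval_mul, eval_C, eval_sub, eval_X, h1, h0]
    have : (k + 2 : ℝ) ≠ 0 := by positivity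
    field_simp; ring

lemma legendre_comp_neg : ∀ k, (legendre k).comp (-X) = C ((-1) ^ k) * legendre k
  | 0 => by simp [legendre]
  | 1 => by simp [legendre]
  | k + 2 => by
    have h1 := legendre_comp_neg (k + 1)
    have h0 := legendre_comp_neg k
    rw [legendre]
    simp only [mul_comp, C_comp, sub_comp, X_comp, h1, h0]
    simp only [pow_succ, C_mul, C_neg, C_1]
    ring

lemma legendre_eval_neg_one (k : ℕ) : (legendre k).eval (-1) = (-1) ^ k := by
  have := congrArg (eval 1) (legendre_comp_neg k)
  simpa [eval_comp, legendre_eval_one] using this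

lemma legendre_derivative_eval_one :
    ∀ k, (derivative (legendre k)).eval 1 = k * (k + 1) / 2
  | 0 => by simp [legendre]
  | 1 => by simp [legendre]
  | k + 2 => by
    have h1 := legendre_derivative_eval_one (k + 1)
    have h0 := legendre_derivative_eval_one k
    rw [legendre]
    simp only [derivative_mul, derivative_C, derivative_sub, derivative_X, eval_mul, eval_C,
      eval_sub, eval_add, eval_X, h1, h0, legendre_eval_one, zero_mul, zero_add, one_mul]
    have : (k + 2 : ℝ) ≠ 0 := by positivity
    push_cast
    field_simp; ring

lemma legendre_derivative_eval_neg_one (k : ℕ) :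
    (derivative (legendre k)).eval (-1) = -((-1) ^ k * (k * (k + 1) / 2)) := by
  have := congrArg (fun p => eval 1 (derivative p)) (legendre_comp_neg k)
  simp only [derivative_comp, eval_mul, derivative_neg, derivative_X, eval_neg, eval_one,
    eval_comp, eval_X, derivative_C, derivative_mul, zero_mul, zero_add, eval_C,
    legendre_derivative_eval_one] at this
  linarith

/-- Polynomials of degree at most `N` are combinations of the first `N + 1` Legendre
polynomials. -/
lemma exists_legendre_expansion (N : ℕ) (q : ℝ[X]) (hq : q.natDegree ≤ N) :
    ∃ a : ℕ → ℝ, q = ∑ k ∈ Finset.range (N + 1), C (a k) * legendre k := by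
  induction N generalizing q with
  | zero =>
    refine ⟨fun _ => q.coeff 0, ?_⟩
    rw [eq_C_of_natDegree_le_zero hq]
    simp [legendre]
  | succ N ih =>
    set c := q.coeff (N + 1) / (legendre (N + 1)).coeff (N + 1) with hc
    have hdeg : (q - C c * legendre (N + 1)).natDegree ≤ N := by
      rw [natDegree_le_iff_coeff_eq_zero]
      intro m hm
      rcases (Nat.succ_le_of_lt hm).eq_or_lt with h | h
      · rw [← h, coeff_sub, coeff_C_mul, hc, div_mul_cancel₀ _ (legendre_coeff_ne_zero _), sub_self]
      · rw [coeff_sub, coeff_C_mul, coeff_eq_zero_of_natDegree_lt (lt_of_le_of_lt hq h),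
          coeff_eq_zero_of_natDegree_lt (lt_of_le_of_lt (legendre_natDegree_le _) h)]
        simp
    obtain ⟨a, ha⟩ := ih _ hdeg
    refine ⟨fun k => if k = N + 1 then c else a k, ?_⟩
    rw [Finset.sum_range_succ]
    simp only [if_true]
    rw [← sub_eq_iff_eq_add, ha]
    refine Finset.sum_congr rfl fun k hk => ?_
    rw [if_neg (by have := Finset.mem_range.1 hk; omega)]

/-- Integration of polynomials over `[-1, 1]`. -/
def polyInt : ℝ[X] →ₗ[ℝ] ℝ where
  toFun p := ∫ x in (-1 : ℝ)..1, p.eval x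
  map_add' p q := by
    simp only [eval_add]
    exact intervalIntegral.integral_add (p.continuous.intervalIntegrable _ _)
      (q.continuous.intervalIntegrable _ _)
  map_smul' c p := by simp

lemma polyInt_apply (p : ℝ[X]) : polyInt p = ∫ x in (-1 : ℝ)..1, p.eval x := rfl

lemma polyInt_C_mul (c : ℝ) (p : ℝ[X]) : polyInt (C c * p) = c * polyInt p := by
  rw [← smul_eq_C_mul, map_smul, smul_eq_mul]

lemma polyInt_comp_neg (p : ℝ[X]) : polyInt (p.comp (-X)) = polyInt p := by
  simp only [polyInt_apply, eval_comp, eval_neg, eval_X]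
  rw [intervalIntegral.integral_comp_neg (fun x => p.eval x)]
  simp

lemma polyInt_derivative (p : ℝ[X]) : polyInt (derivative p) = p.eval 1 - p.eval (-1) := by
  rw [polyInt_apply]
  exact intervalIntegral.integral_eq_sub_of_hasDerivAt (fun x _ => p.hasDerivAt x)
    ((derivative p).continuous.intervalIntegrable _ _)

lemma polyInt_mul_legendre_eq_zero {k : ℕ} (h : ∀ j < k, polyInt (legendre j * legendre k) = 0)
    {q : ℝ[X]} (hq : q.natDegree < k) : polyInt (q * legendre k) = 0 := by
  obtain ⟨a, ha⟩ := exists_legendre_expansion (k - 1) q (by omega)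
  rw [ha, Finset.sum_mul, map_sum]
  refine Finset.sum_eq_zero fun j hj => ?_
  rw [mul_assoc, polyInt_C_mul, h j (by have := Finset.mem_range.1 hj; omega), mul_zero]

/-- The Euler operator minus the degree annihilates the leading term. -/
lemma natDegree_X_mul_derivative_sub_lt {k : ℕ} (hk : 0 < k) {q : ℝ[X]} (hq : q.natDegree ≤ k) :
    (X * derivative q - C (k : ℝ) * q).natDegree < k := by
  have : (X * derivative q - C (k : ℝ) * q).natDegree ≤ k - 1 := by
    rw [natDegree_le_iff_coeff_eq_zero]
    intro m hm
    obtain ⟨m, rfl⟩ : ∃ m', m = m' + 1 := ⟨m - 1, by omega⟩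
    rw [coeff_sub, coeff_X_mul, coeff_C_mul, coeff_derivative]
    rcases (show m + 1 = k ∨ k < m + 1 by omega) with h | h
    · rw [← h]; push_cast; ring
    · rw [coeff_eq_zero_of_natDegree_lt (lt_of_le_of_lt hq h)]; ring
  omega

/-- The norm follows by integrating the derivative of `X P_k ^ 2`, in which `X P_k' - k P_k` is
orthogonal to `P_k`. -/
lemma polyInt_legendre_sq_of_orthogonal {k : ℕ}
    (h : ∀ j < k, polyInt (legendre j * legendre k) = 0) :
    polyInt (legendre k * legendre k) = 2 / (2 * k + 1) := by
  have h1 := polyInt_derivative (X * (legendre k * legendre k))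
  have h2 : derivative (X * (legendre k * legendre k)) = legendre k * legendre k +
      C 2 * ((X * derivative (legendre k) - C (k : ℝ) * legendre k) * legendre k) +
        C (2 * k : ℝ) * (legendre k * legendre k) := by
    simp only [derivative_mul, derivative_X, C_mul]
    have : (C 2 : ℝ[X]) = 2 := rfl
    rw [this]; ring
  have h3 : polyInt ((X * derivative (legendre k) - C (k : ℝ) * legendre k) * legendre k) = 0 := by
    rcases Nat.eq_zero_or_pos k with rfl | hk
    · simp [legendre]
    · exact polyInt_mul_legendre_eq_zero h
        (natDegree_X_mul_derivative_sub_lt hk (legendre_natDegree_le k))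
  rw [h2, map_add, map_add, polyInt_C_mul, polyInt_C_mul, h3] at h1
  simp only [eval_mul, eval_X, legendre_eval_one, legendre_eval_neg_one] at h1
  have h4 : ((-1 : ℝ) ^ k * (-1) ^ k) = 1 := by rw [← mul_pow]; simp
  rw [h4] at h1
  rw [eq_div_iff (by positivity)]
  linarith

lemma natDegree_X_mul_legendre_sub (k : ℕ) :
    (C (2 * k + 1 : ℝ) * (X * legendre k) - C (k + 1 : ℝ) * legendre (k + 1)).natDegree ≤ k := by
  cases k with
  | zero => simp [legendre]
  | succ k =>
    have := legendre_rec k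
    have e : C (2 * ((k + 1 : ℕ) : ℝ) + 1) * (X * legendre (k + 1)) -
        C (((k + 1 : ℕ) : ℝ) + 1) * legendre (k + 1 + 1) = C (k + 1 : ℝ) * legendre k := by
      have e1 : (2 * ((k + 1 : ℕ) : ℝ) + 1) = 2 * k + 3 := by push_cast; ring
      have e2 : (((k + 1 : ℕ) : ℝ) + 1) = k + 2 := by push_cast; ring
      rw [e1, e2, this]; ring
    rw [e]
    exact (natDegree_C_mul_le _ _).trans ((legendre_natDegree_le k).trans (by omega))

lemma polyInt_legendre_sq_mul_X (k : ℕ) :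
    polyInt (X * legendre k * legendre k) = 0 := by
  have h := polyInt_comp_neg (X * legendre k * legendre k)
  have e : (X * legendre k * legendre k).comp (-X) = -(X * legendre k * legendre k) := by
    simp only [mul_comp, X_comp, legendre_comp_neg]
    have h4 : (C ((-1 : ℝ) ^ k) * C ((-1) ^ k) : ℝ[X]) = 1 := by
      rw [← C_mul, ← mul_pow]; simp
    linear_combination (-X * legendre k * legendre k) * h4
  rw [e, map_neg] at h
  linarith

/-- Induction along the recurrence. Only the products with the two preceding polynomials are not
zero for reasons of degree: for `P_k` the two terms cancel by the values of the norms, for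
`P_{k+1}` by parity. -/
theorem legendre_orthogonal : ∀ k, ∀ j < k, polyInt (legendre j * legendre k) = 0 := by
  intro k
  induction k using Nat.strong_induction_on with
  | _ k ih =>
    match k with
    | 0 => intro j hj; omega
    | 1 =>
      intro j hj
      obtain rfl : j = 0 := by omega
      have := polyInt_legendre_sq_mul_X 0
      simpa [legendre] using this
    | k + 2 =>
      intro j hj
      have S1 := ih (k + 1) (by omega)
      have S0 := ih k (by omega)
      have hne : (k + 2 : ℝ) ≠ 0 := by positivity
      suffices h : (k + 2 : ℝ) * polyInt (legendre j * legendre (k + 2)) = 0 from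
        (mul_eq_zero.1 h).resolve_left hne
      have e : (k + 2 : ℝ) * polyInt (legendre j * legendre (k + 2)) =
          (2 * k + 3) * polyInt (X * legendre j * legendre (k + 1)) -
            (k + 1) * polyInt (legendre j * legendre k) := by
        rw [← polyInt_C_mul, ← polyInt_C_mul, ← polyInt_C_mul, ← map_sub]
        congr 1
        linear_combination legendre j * legendre_rec k
      rw [e]
      rcases (show j < k ∨ j = k ∨ j = k + 1 by omega) with h | rfl | rfl
      · rw [S0 j h, polyInt_mul_legendre_eq_zero S1, mul_zero, mul_zero, sub_zero]
        refine lt_of_le_of_lt natDegree_mul_le ?_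
        have := legendre_natDegree_le j
        rw [natDegree_X]; omega
      · have h0 := polyInt_mul_legendre_eq_zero S1
          (lt_of_le_of_lt (natDegree_X_mul_legendre_sub j) (Nat.lt_succ_self j))
        rw [sub_mul, map_sub, mul_assoc, polyInt_C_mul, mul_assoc (C (j + 1 : ℝ)), polyInt_C_mul,
          polyInt_legendre_sq_of_orthogonal S1] at h0
        rw [polyInt_legendre_sq_of_orthogonal S0]
        push_cast at h0
        have p1 : (2 * (j : ℝ) + 1) ≠ 0 := by positivity
        have p3 : (2 * (j : ℝ) + 3) ≠ 0 := by positivity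
        have p4 : (2 * ((j : ℝ) + 1) + 1) ≠ 0 := by positivity
        have h1 : polyInt (X * legendre j * legendre (j + 1)) =
            (j + 1) * (2 / (2 * j + 3)) / (2 * j + 1) := by
          rw [eq_div_iff p1]
          have : (2 * ((j : ℝ) + 1) + 1) = 2 * j + 3 := by ring
          rw [this] at h0
          linarith
        rw [h1]
        field_simp; ring
      · rw [polyInt_legendre_sq_mul_X, mul_comm (legendre (k + 1)), S1 k (Nat.lt_succ_self k)]
        ring

lemma polyInt_legendre_sq (k : ℕ) : polyInt (legendre k * legendre k) = 2 / (2 * k + 1) :=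
  polyInt_legendre_sq_of_orthogonal (legendre_orthogonal k)

lemma polyInt_legendre_mul (j k : ℕ) :
    polyInt (legendre j * legendre k) = if j = k then 2 / (2 * (k : ℝ) + 1) else 0 := by
  rcases lt_trichotomy j k with h | rfl | h
  · rw [if_neg h.ne, legendre_orthogonal k j h]
  · rw [if_pos rfl, polyInt_legendre_sq]
  · rw [if_neg h.ne', mul_comm, legendre_orthogonal j k h]

/-- Integration by parts, as `P_k''` is orthogonal to `P_k`. -/
lemma polyInt_legendre_derivative_sq (k : ℕ) :
    polyInt (derivative (legendre k) * derivative (legendre k)) = k * (k + 1) := by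
  have h1 := polyInt_derivative (derivative (legendre k) * legendre k)
  have h2 : polyInt (derivative (derivative (legendre k)) * legendre k) = 0 := by
    rcases Nat.eq_zero_or_pos k with rfl | hk
    · simp [legendre]
    · refine polyInt_mul_legendre_eq_zero (legendre_orthogonal k) ?_
      have a1 := natDegree_derivative_le (derivative (legendre k))
      have a2 := natDegree_derivative_le (legendre k)
      have := legendre_natDegree_le k
      omega
  rw [derivative_mul, map_add, h2] at h1
  simp only [eval_mul, legendre_eval_one, legendre_eval_neg_one, legendre_derivative_eval_one,
    legendre_derivative_eval_neg_one] at h1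
  have h4 : ((-1 : ℝ) ^ k * (-1) ^ k) = 1 := by rw [← mul_pow]; simp
  linear_combination h1 + (k * (k + 1) / 2 : ℝ) * h4

/-- Parseval's identity. -/
lemma polyInt_expansion_sq (N : ℕ) (a : ℕ → ℝ) :
    polyInt ((∑ k ∈ Finset.range (N + 1), C (a k) * legendre k) *
      (∑ k ∈ Finset.range (N + 1), C (a k) * legendre k)) =
        ∑ k ∈ Finset.range (N + 1), a k ^ 2 * (2 / (2 * k + 1)) := by
  rw [Finset.sum_mul_sum, map_sum]
  refine Finset.sum_congr rfl fun i hi => ?_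
  rw [map_sum, Finset.sum_eq_single i]
  · rw [mul_mul_mul_comm, ← C_mul, polyInt_C_mul, polyInt_legendre_sq]; ring
  · intro j _ hj
    rw [mul_mul_mul_comm, ← C_mul, polyInt_C_mul, polyInt_legendre_mul, if_neg hj.symm, mul_zero]
  · intro h; exact absurd hi h

/-- Cauchy's inequality for the value of a linear functional in the Legendre basis. -/
lemma sq_map_le_legendre (N : ℕ) {q : ℝ[X]} (hq : q.natDegree ≤ N) (φ : ℝ[X] →ₗ[ℝ] ℝ) :
    φ q ^ 2 ≤ polyInt (q * q) *
      ∑ k ∈ Finset.range (N + 1), (2 * k + 1) / 2 * φ (legendre k) ^ 2 := by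
  obtain ⟨a, rfl⟩ := exists_legendre_expansion N q hq
  rw [polyInt_expansion_sq, map_sum]
  refine Finset.sum_sq_le_sum_mul_sum_of_sq_le_mul _ (fun k _ => by positivity)
    (fun k _ => by positivity) fun k _ => le_of_eq ?_
  rw [← smul_eq_C_mul, map_smul, smul_eq_mul]
  have : (2 * k + 1 : ℝ) ≠ 0 := by positivity
  field_simp

lemma eval_sq_le_legendre (N : ℕ) {q : ℝ[X]} (hq : q.natDegree ≤ N) (x : ℝ) :
    q.eval x ^ 2 ≤ polyInt (q * q) *
      ∑ k ∈ Finset.range (N + 1), (2 * k + 1) / 2 * (legendre k).eval x ^ 2 :=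
  sq_map_le_legendre N hq (leval x)

lemma polyInt_mono {p q : ℝ[X]} (h : ∀ x, p.eval x ≤ q.eval x) : polyInt p ≤ polyInt q :=
  intervalIntegral.integral_mono_on (by norm_num) (p.continuous.intervalIntegrable _ _)
    (q.continuous.intervalIntegrable _ _) fun x _ => h x

lemma polyInt_mul_self_nonneg (q : ℝ[X]) : 0 ≤ polyInt (q * q) := by
  have := polyInt_mono (p := 0) (q := q * q) (fun x => by
    rw [eval_mul, eval_zero]; exact mul_self_nonneg _)
  simpa using this

/-- The `L²` Markov inequality on `[-1, 1]`. -/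
lemma polyInt_derivative_sq_le (N : ℕ) {q : ℝ[X]} (hq : q.natDegree ≤ N) :
    polyInt (derivative q * derivative q) ≤ (N + 1 : ℝ) ^ 4 * polyInt (q * q) := by
  have h1 : polyInt (derivative q * derivative q) ≤ polyInt (C (polyInt (q * q)) *
      ∑ k ∈ Finset.range (N + 1), C ((2 * k + 1 : ℝ) / 2) *
        (derivative (legendre k) * derivative (legendre k))) := by
    refine polyInt_mono fun x => ?_
    have := sq_map_le_legendre N hq ((leval x).comp derivative)
    simp only [LinearMap.comp_apply, leval_apply] at this
    simp only [eval_mul, eval_C, eval_finsetSum]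
    simpa only [sq] using this
  rw [polyInt_C_mul, map_sum] at h1
  refine h1.trans ?_
  rw [mul_comm]
  refine mul_le_mul_of_nonneg_right ?_ (polyInt_mul_self_nonneg q)
  have h2 : ∀ k ∈ Finset.range (N + 1), polyInt (C ((2 * k + 1 : ℝ) / 2) *
      (derivative (legendre k) * derivative (legendre k))) ≤ (N + 1 : ℝ) ^ 3 := by
    intro k hk
    have hk' : (k : ℝ) ≤ N := by exact_mod_cast Nat.lt_succ_iff.1 (Finset.mem_range.1 hk)
    rw [polyInt_C_mul, polyInt_legendre_derivative_sq]
    have : (2 * k + 1 : ℝ) / 2 ≤ N + 1 := by linarith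
    calc (2 * k + 1 : ℝ) / 2 * (k * (k + 1)) ≤ (N + 1) * ((N + 1) * (N + 1)) := by
          gcongr; linarith
      _ = _ := by ring
  refine (Finset.sum_le_card_nsmul _ _ _ h2).trans (le_of_eq ?_)
  rw [Finset.card_range, nsmul_eq_mul]; push_cast; ring

/-- The value of a polynomial at an end point is controlled by its `L²` norm. -/
lemma eval_one_sq_le (N : ℕ) {q : ℝ[X]} (hq : q.natDegree ≤ N) :
    q.eval 1 ^ 2 ≤ (N + 1 : ℝ) ^ 2 * polyInt (q * q) := by
  refine (eval_sq_le_legendre N hq 1).trans ?_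
  rw [mul_comm]
  refine mul_le_mul_of_nonneg_right ?_ (polyInt_mul_self_nonneg q)
  have h2 : ∀ k ∈ Finset.range (N + 1), (2 * k + 1 : ℝ) / 2 * (legendre k).eval 1 ^ 2
      ≤ (N + 1 : ℝ) := by
    intro k hk
    have hk' : (k : ℝ) ≤ N := by exact_mod_cast Nat.lt_succ_iff.1 (Finset.mem_range.1 hk)
    rw [legendre_eval_one]; linarith
  refine (Finset.sum_le_card_nsmul _ _ _ h2).trans (le_of_eq ?_)
  rw [Finset.card_range, nsmul_eq_mul]; push_cast; ring

/-! ### Growth outside the interval of integration -/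

lemma T_pos {t : ℝ} (ht : 1 ≤ t) : 0 < T t := by
  unfold T; have := Real.sqrt_nonneg (t ^ 2 - 1); linarith

lemma one_le_T {t : ℝ} (ht : 1 ≤ t) : 1 ≤ T t := by
  unfold T; have := Real.sqrt_nonneg (t ^ 2 - 1); linarith

lemma T_sq {t : ℝ} (ht : 1 ≤ t) : T t ^ 2 = 2 * t * T t - 1 := by
  have := Real.sq_sqrt (show 0 ≤ t ^ 2 - 1 by nlinarith)
  unfold T; linear_combination this

/-- For `t ≥ 1` the values of the Legendre polynomials increase with the degree, and their ratios
are at most `𝖳(t)`. -/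
lemma legendre_ratio {t : ℝ} (ht : 1 ≤ t) (k : ℕ) : 0 < (legendre k).eval t ∧
    (legendre k).eval t ≤ (legendre (k + 1)).eval t ∧
    (legendre (k + 1)).eval t ≤ T t * (legendre k).eval t := by
  induction k with
  | zero =>
    have : t ≤ T t := by unfold T; have := Real.sqrt_nonneg (t ^ 2 - 1); linarith
    simp [legendre, ht, this]
  | succ k ih =>
    obtain ⟨h0, h1, h2⟩ := ih
    have hT := T_pos ht
    have hrec := congrArg (eval t) (legendre_rec k)
    simp only [eval_mul, eval_C, eval_sub, eval_X] at hrec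
    have hk : (0 : ℝ) ≤ k := Nat.cast_nonneg k
    have hk2 : (0 : ℝ) < k + 2 := by positivity
    refine ⟨h0.trans_le h1, ?_, ?_⟩
    · refine le_of_mul_le_mul_left ?_ hk2
      rw [hrec]
      have a1 : 0 ≤ (2 * k + 3 : ℝ) * ((t - 1) * (legendre (k + 1)).eval t) := by
        have := sub_nonneg.2 ht
        have := (h0.trans_le h1).le
        positivity
      have a2 := mul_le_mul_of_nonneg_left h1 (show (0 : ℝ) ≤ k + 1 by positivity)
      linarith
    · refine le_of_mul_le_mul_left ?_ hk2
      refine le_of_mul_le_mul_left ?_ hT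
      rw [hrec]
      have a1 := mul_le_mul_of_nonneg_left h2 (show (0 : ℝ) ≤ k + 1 by positivity)
      -- After multiplication by `𝖳`, the claim follows from `𝖳 ^ 2 = 2 t 𝖳 - 1`.
      have hsq := T_sq ht
      have htT : t ≤ T t := by unfold T; have := Real.sqrt_nonneg (t ^ 2 - 1); linarith
      have a3 : 0 ≤ (legendre (k + 1)).eval t := (h0.trans_le h1).le
      have a4 : 0 ≤ T t * (T t - t) * (legendre (k + 1)).eval t :=
        mul_nonneg (mul_nonneg hT.le (sub_nonneg.2 htT)) a3
      have e : T t * ((k + 2) * (T t * (legendre (k + 1)).eval t)) =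
          (k + 2) * (2 * t * T t - 1) * (legendre (k + 1)).eval t := by rw [← hsq]; ring
      rw [e]
      have a5 : (T t * T t - T t * t) * (legendre (k + 1)).eval t =
        (T t * t - 1) * (legendre (k + 1)).eval t := by rw [← sq, hsq]; ring
      nlinarith

lemma legendre_eval_nonneg {t : ℝ} (ht : 1 ≤ t) (k : ℕ) : 0 ≤ (legendre k).eval t :=
  (legendre_ratio ht k).1.le

lemma legendre_eval_le {t : ℝ} (ht : 1 ≤ t) (k : ℕ) : (legendre k).eval t ≤ T t ^ k := by
  induction k with
  | zero => simp [legendre]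
  | succ k ih =>
    refine (legendre_ratio ht k).2.2.trans ?_
    rw [pow_succ']
    exact mul_le_mul_of_nonneg_left ih (T_pos ht).le

lemma continuous_T : Continuous T := by unfold T; fun_prop

lemma hasDerivAt_T {t : ℝ} (ht : 1 < t) : HasDerivAt T (T t / √(t ^ 2 - 1)) t := by
  have h0 : 0 < t ^ 2 - 1 := by nlinarith
  have h1 : HasDerivAt (fun t : ℝ => t ^ 2 - 1) (2 * t) t := by
    simpa using (hasDerivAt_pow 2 t).sub_const 1
  have h2 := (hasDerivAt_id t).add (h1.sqrt h0.ne')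
  have hs : 0 < √(t ^ 2 - 1) := Real.sqrt_pos.2 h0
  refine h2.congr_deriv ?_
  unfold T; field_simp; ring

/-- As `𝖳 ^ 2 - 1 = 2 √(t ^ 2 - 1) 𝖳`, the geometric sum is bounded by a multiple of the derivative
of `𝖳 ^ (2 N + 1)`, which is `(2 N + 1) 𝖳 ^ (2 N) 𝖳 / √(t ^ 2 - 1)`. -/
lemma sum_T_pow_le {t : ℝ} (ht : 1 < t) (N : ℕ) :
    ∑ k ∈ Finset.range (N + 1), (T t ^ k) ^ 2 ≤ T t ^ (2 * N) * (T t / √(t ^ 2 - 1)) / 2 := by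
  have h0 : 0 < t ^ 2 - 1 := by nlinarith
  have hs : 0 < √(t ^ 2 - 1) := Real.sqrt_pos.2 h0
  have hT := T_pos ht.le
  have hsq := Real.sq_sqrt h0.le
  have h1 : (T t ^ 2) - 1 = 2 * √(t ^ 2 - 1) * T t := by
    unfold T; linear_combination -hsq
  have hg := geom_sum_mul (T t ^ 2) (N + 1)
  have hsum : ∑ k ∈ Finset.range (N + 1), (T t ^ k) ^ 2 =
      ∑ k ∈ Finset.range (N + 1), (T t ^ 2) ^ k :=
    Finset.sum_congr rfl fun k _ => by rw [← pow_mul, ← pow_mul, mul_comm]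
  rw [hsum, mul_div_assoc', div_div, le_div_iff₀ (by positivity)]
  refine le_of_mul_le_mul_right ?_ hT
  calc (∑ k ∈ Finset.range (N + 1), (T t ^ 2) ^ k) * (√(t ^ 2 - 1) * 2) * T t
      = (∑ k ∈ Finset.range (N + 1), (T t ^ 2) ^ k) * (T t ^ 2 - 1) := by rw [h1]; ring
    _ = T t ^ (2 * N) * T t * T t - 1 := by rw [hg, ← pow_mul]; ring
    _ ≤ _ := by linarith

/-- The difference of the two sides is monotone in `t`, by `sum_T_pow_le`. -/
lemma integral_sum_T_pow_le {t : ℝ} (ht : 1 ≤ t) (N : ℕ) :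
    (2 * N + 1) * ∫ x in (1 : ℝ)..t, ∑ k ∈ Finset.range (N + 1), (T x ^ k) ^ 2 ≤
      T t ^ (2 * N + 1) / 2 := by
  set S : ℝ → ℝ := fun x => ∑ k ∈ Finset.range (N + 1), (T x ^ k) ^ 2 with hS
  have hSc : Continuous S := by have := continuous_T; fun_prop
  set H : ℝ → ℝ := fun x => T x ^ (2 * N + 1) / 2 - (2 * N + 1) * ∫ x in (1 : ℝ)..x, S x with hH
  have hd : ∀ x, HasDerivAt (fun x => ∫ y in (1 : ℝ)..x, S y) (S x) x := fun x =>
    intervalIntegral.integral_hasDerivAt_right (hSc.intervalIntegrable _ _)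
      (hSc.stronglyMeasurableAtFilter _ _) hSc.continuousAt
  have hder : ∀ x, 1 < x → HasDerivAt H (((2 * N + 1 : ℕ) * T x ^ (2 * N) *
      (T x / √(x ^ 2 - 1))) / 2 - (2 * N + 1) * S x) x := fun x hx => by
    exact (((hasDerivAt_T hx).pow (2 * N + 1)).div_const 2).sub ((hd x).const_mul _)
  have hHc : Continuous H := by
    have h1 : Continuous fun x => ∫ y in (1 : ℝ)..x, S y :=
      continuous_iff_continuousAt.2 fun x => (hd x).continuousAt
    have := continuous_T
    fun_prop
  have hmono : MonotoneOn H (Set.Ici 1) := by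
    refine monotoneOn_of_deriv_nonneg (convex_Ici 1) hHc.continuousOn ?_ ?_
    · rw [interior_Ici]
      exact fun x hx => (hder x hx).differentiableAt.differentiableWithinAt
    · rw [interior_Ici]
      intro x hx
      rw [(hder x hx).deriv, sub_nonneg]
      have := mul_le_mul_of_nonneg_left (sum_T_pow_le hx N) (show (0 : ℝ) ≤ 2 * N + 1 by positivity)
      refine this.trans (le_of_eq ?_)
      push_cast; ring
  have h1 := hmono (Set.mem_Ici.2 le_rfl) (Set.mem_Ici.2 ht) ht
  have h2 : 0 ≤ H 1 := by
    simp only [hH, intervalIntegral.integral_same, mul_zero, sub_zero]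
    have := T_pos le_rfl
    positivity
  have h3 : 0 ≤ H t := h2.trans h1
  simp only [hH] at h3
  linarith

/-- A polynomial of degree `N` grows outside of `[-1, 1]`, in the `L²` sense, no faster than
`𝖳 ^ N`. -/
lemma integral_sq_le_T_pow (N : ℕ) {q : ℝ[X]} (hq : q.natDegree ≤ N) {t : ℝ} (ht : 1 ≤ t) :
    ∫ x in (1 : ℝ)..t, q.eval x ^ 2 ≤ T t ^ (2 * N + 1) / 2 * polyInt (q * q) := by
  have hT := continuous_T
  have h1 : ∫ x in (1 : ℝ)..t, q.eval x ^ 2 ≤ ∫ x in (1 : ℝ)..t, polyInt (q * q) *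
      ((2 * N + 1) * ∑ k ∈ Finset.range (N + 1), (T x ^ k) ^ 2) := by
    refine intervalIntegral.integral_mono_on ht
      ((q.continuous.pow 2).intervalIntegrable _ _)
      (Continuous.intervalIntegrable (by fun_prop) _ _) fun x hx => ?_
    refine (eval_sq_le_legendre N hq x).trans ?_
    refine mul_le_mul_of_nonneg_left ?_ (polyInt_mul_self_nonneg q)
    rw [Finset.mul_sum]
    refine Finset.sum_le_sum fun k hk => ?_
    have hk' : (k : ℝ) ≤ N := by exact_mod_cast Nat.lt_succ_iff.1 (Finset.mem_range.1 hk)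
    have := legendre_eval_nonneg hx.1 k
    have := legendre_eval_le hx.1 k
    gcongr
    linarith
  refine h1.trans ?_
  rw [intervalIntegral.integral_const_mul, intervalIntegral.integral_const_mul, mul_comm]
  exact mul_le_mul_of_nonneg_right (integral_sum_T_pow_le ht N) (polyInt_mul_self_nonneg q)

end Legendre

/-! ### Weighted polynomial inequalities on `[0, R]` -/

section Weighted

open Polynomial

/-- `[-1, 1]` is mapped affinely onto `[0, L]`. -/
lemma integral_comp_Icc (f : ℝ → ℝ) {L : ℝ} (hL : L ≠ 0) (a b : ℝ) :
    ∫ s in (L / 2 * (a + 1))..(L / 2 * (b + 1)), f s = L / 2 * ∫ x in a..b, f (L / 2 * (x + 1)) := by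
  have := intervalIntegral.integral_comp_mul_add (a := a) (b := b) f
    (div_ne_zero hL (two_ne_zero (α := ℝ))) (L / 2)
  have e : ∀ x, L / 2 * (x + 1) = L / 2 * x + L / 2 := fun x => by ring
  simp only [e, this, smul_eq_mul]
  rw [← mul_assoc, mul_inv_cancel₀ (div_ne_zero hL two_ne_zero), one_mul]

lemma natDegree_comp_affine_le (r : ℝ[X]) (c : ℝ) :
    (r.comp (C c * (X + 1))).natDegree ≤ r.natDegree := by
  refine natDegree_comp_le.trans ?_
  have : (C c * (X + 1) : ℝ[X]).natDegree ≤ 1 :=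
    (natDegree_C_mul_le _ _).trans (by rw [← C_1, natDegree_X_add_C])
  exact (Nat.mul_le_mul_left _ this).trans (by simp)

lemma integral_sq_eq_polyInt (r : ℝ[X]) {L : ℝ} (hL : L ≠ 0) :
    ∫ s in (0 : ℝ)..L, r.eval s ^ 2 = L / 2 *
      polyInt (r.comp (C (L / 2) * (X + 1)) * r.comp (C (L / 2) * (X + 1))) := by
  have := integral_comp_Icc (fun s => r.eval s ^ 2) hL (-1) 1
  have e : L / 2 * ((1 : ℝ) + 1) = L := by ring
  rw [e] at this
  simp only [neg_add_cancel, mul_zero] at this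
  rw [this, polyInt_apply]
  simp [eval_comp, sq]

lemma eval_X_mul_sq (q : ℝ[X]) (s : ℝ) : (X * q).eval s ^ 2 = q.eval s ^ 2 * s ^ 2 := by
  rw [eval_mul, eval_X]; ring

lemma natDegree_X_mul_le' {q : ℝ[X]} {n : ℕ} (hq : q.natDegree ≤ n) :
    (X * q).natDegree ≤ n + 1 := by
  refine natDegree_mul_le.trans ?_
  rw [natDegree_X]; omega

/-- Extension from `[0, θR]` to `[0, R]`. The weight `s ^ 2`, which comes from polar coordinates, is
absorbed into the polynomial `X * q`. -/
lemma weighted_extension {n : ℕ} {q : ℝ[X]} (hq : q.natDegree ≤ n) {θ R : ℝ} (hθ : 0 < θ)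
    (hθ1 : θ ≤ 1) (hR : 0 < R) :
    ∫ s in (0 : ℝ)..R, q.eval s ^ 2 * s ^ 2 ≤
      (1 + T (2 / θ - 1) ^ (2 * n + 3) / 2) *
        ∫ s in (0 : ℝ)..(θ * R), q.eval s ^ 2 * s ^ 2 := by
  set r := X * q with hr
  simp only [← eval_X_mul_sq, ← hr]
  have hL : θ * R ≠ 0 := (mul_pos hθ hR).ne'
  set r' := r.comp (C (θ * R / 2) * (X + 1)) with hr'
  have hdeg : r'.natDegree ≤ n + 1 :=
    (natDegree_comp_affine_le _ _).trans (natDegree_X_mul_le' hq)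
  have h1 : ∫ s in (θ * R)..R, r.eval s ^ 2 =
      θ * R / 2 * ∫ x in (1 : ℝ)..(2 / θ - 1), r'.eval x ^ 2 := by
    have := integral_comp_Icc (fun s => r.eval s ^ 2) hL 1 (2 / θ - 1)
    have e1 : θ * R / 2 * ((1 : ℝ) + 1) = θ * R := by ring
    have e2 : θ * R / 2 * (2 / θ - 1 + 1) = R := by field_simp; ring
    rw [e1, e2] at this
    rw [this]
    simp [hr', eval_comp]
  have ht : 1 ≤ 2 / θ - 1 := by
    have : 2 ≤ 2 / θ := by rw [le_div_iff₀ hθ]; linarith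
    linarith
  have h2 := integral_sq_le_T_pow (n + 1) hdeg ht
  have hi : ∀ a b, IntervalIntegrable (fun s => r.eval s ^ 2) volume a b := fun a b =>
    (r.continuous.pow 2).intervalIntegrable a b
  rw [← intervalIntegral.integral_add_adjacent_intervals (hi 0 (θ * R)) (hi (θ * R) R), h1,
    integral_sq_eq_polyInt r hL, ← hr', add_mul, one_mul]
  have h3 := mul_le_mul_of_nonneg_left h2 (show 0 ≤ θ * R / 2 by positivity)
  refine add_le_add le_rfl (h3.trans (le_of_eq ?_))
  have : 2 * (n + 1) + 1 = 2 * n + 3 := by ring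
  rw [this]; ring

/-- The value at the end point is controlled by the weighted norm. -/
lemma weighted_trace {n : ℕ} {q : ℝ[X]} (hq : q.natDegree ≤ n) :
    q.eval 1 ^ 2 ≤ 2 * (n + 2 : ℝ) ^ 2 * ∫ s in (0 : ℝ)..1, q.eval s ^ 2 * s ^ 2 := by
  have h := eval_one_sq_le (n + 1) ((natDegree_comp_affine_le (X * q) (1 / 2)).trans
    (natDegree_X_mul_le' hq))
  have e : ((X * q).comp (C (1 / 2) * (X + 1))).eval 1 = q.eval 1 := by
    simp only [eval_comp, eval_mul, eval_C, eval_add, eval_X, eval_one]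
    norm_num
  rw [e] at h
  have h2 := integral_sq_eq_polyInt (X * q) one_ne_zero
  simp only [eval_X_mul_sq] at h2
  rw [h2]
  push_cast at h
  refine h.trans (le_of_eq ?_)
  ring

/-- Markov's inequality for the Euler operator: with `r = X * q` one has `s ^ 2 q' = s r' - r`. -/
lemma weighted_markov {n : ℕ} {q : ℝ[X]} (hq : q.natDegree ≤ n) {R : ℝ} (hR : 0 < R) :
    ∫ s in (0 : ℝ)..R, (s * (derivative q).eval s) ^ 2 * s ^ 2 ≤
      10 * (n + 2 : ℝ) ^ 4 * ∫ s in (0 : ℝ)..R, q.eval s ^ 2 * s ^ 2 := by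
  set r := X * q with hr
  have hdr : ∀ s, (derivative r).eval s = q.eval s + s * (derivative q).eval s := by
    intro s; rw [hr, derivative_mul, derivative_X]; simp
  set r' := r.comp (C (R / 2) * (X + 1)) with hr'
  have hdeg : r'.natDegree ≤ n + 1 :=
    (natDegree_comp_affine_le _ _).trans (natDegree_X_mul_le' hq)
  have hm := polyInt_derivative_sq_le (n + 1) hdeg
  have hd' : derivative r' = C (R / 2) * (derivative r).comp (C (R / 2) * (X + 1)) := by
    rw [hr', derivative_comp]; simp
  rw [hd', mul_mul_mul_comm, ← C_mul, polyInt_C_mul] at hm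
  have e1 := integral_sq_eq_polyInt (derivative r) hR.ne'
  have e2 := integral_sq_eq_polyInt r hR.ne'
  have hmk : R ^ 2 * ∫ s in (0 : ℝ)..R, (derivative r).eval s ^ 2 ≤
      4 * (n + 2 : ℝ) ^ 4 * ∫ s in (0 : ℝ)..R, r.eval s ^ 2 := by
    rw [e1, e2]
    have := mul_le_mul_of_nonneg_left hm (show 0 ≤ 2 * R by positivity)
    push_cast at this
    have e : ((n : ℝ) + 1 + 1) = n + 2 := by ring
    rw [e] at this
    refine le_trans (le_of_eq ?_) (this.trans (le_of_eq ?_)) <;> ring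
  have hi : ∀ p : ℝ[X], IntervalIntegrable (fun s => p.eval s ^ 2) volume 0 R := fun p =>
    (p.continuous.pow 2).intervalIntegrable 0 R
  have h1 : ∫ s in (0 : ℝ)..R, (s * (derivative q).eval s) ^ 2 * s ^ 2 ≤
      ∫ s in (0 : ℝ)..R, (2 * (R ^ 2 * (derivative r).eval s ^ 2) + 2 * r.eval s ^ 2) := by
    refine intervalIntegral.integral_mono_on hR.le (Continuous.intervalIntegrable
      (by fun_prop) _ _) (Continuous.intervalIntegrable (by fun_prop) _ _) fun s hs => ?_
    have e : (s * (derivative q).eval s) ^ 2 * s ^ 2 =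
        (s * (derivative r).eval s - r.eval s) ^ 2 := by
      rw [hdr, hr, eval_mul, eval_X]; ring
    rw [e]
    have a1 : s ^ 2 * (derivative r).eval s ^ 2 ≤ R ^ 2 * (derivative r).eval s ^ 2 := by
      have := hs.1; have := hs.2
      gcongr
    nlinarith [sq_nonneg (s * (derivative r).eval s + r.eval s)]
  have e3 : ∫ s in (0 : ℝ)..R, (2 * (R ^ 2 * (derivative r).eval s ^ 2) + 2 * r.eval s ^ 2) =
      2 * (R ^ 2 * ∫ s in (0 : ℝ)..R, (derivative r).eval s ^ 2) +
        2 * ∫ s in (0 : ℝ)..R, r.eval s ^ 2 := by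
    rw [intervalIntegral.integral_add ((((hi _).const_mul _)).const_mul _) ((hi _).const_mul _)]
    simp only [intervalIntegral.integral_const_mul]
  rw [e3] at h1
  simp only [← eval_X_mul_sq q, ← hr]
  have hpos : 0 ≤ ∫ s in (0 : ℝ)..R, r.eval s ^ 2 :=
    intervalIntegral.integral_nonneg hR.le fun s _ => sq_nonneg _
  have hn : (1 : ℝ) ≤ (n + 2 : ℝ) ^ 4 := one_le_pow₀ (by have := Nat.cast_nonneg (α := ℝ) n; linarith)
  nlinarith [mul_le_mul_of_nonneg_right hn hpos]

end Weighted

/-! ### Functions that are polynomials along lines, and star-shaped sets -/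

/-- Integration in polar coordinates around `A`. -/
lemma lintegral_polar (A : E3) {f : E3 → ℝ≥0∞} (hf : Measurable f) :
    ∫⁻ x, f x = ∫⁻ ω : Metric.sphere (0 : E3) 1, (∫⁻ r in Set.Ioi (0 : ℝ),
      f (A + r • (ω : E3)) * ENNReal.ofReal (r ^ 2)) ∂(volume : Measure E3).toSphere := by
  have hdim : Module.finrank ℝ E3 - 1 = 2 := by simp
  have hg : Measurable fun x => f (A + x) := hf.comp (measurable_const_add A)
  have hmp := (volume : Measure E3).measurePreserving_homeomorphUnitSphereProd
  have h0 : ∫⁻ x, f x = ∫⁻ x : ({0}ᶜ : Set E3), f (A + x) ∂((volume : Measure E3).comap (↑)) := by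
    rw [lintegral_subtype_comap (measurableSet_singleton (0 : E3)).compl fun x => f (A + x),
      restrict_compl_singleton, lintegral_add_left_eq_self f A]
  have h1 : ∫⁻ x : ({0}ᶜ : Set E3), f (A + x) ∂((volume : Measure E3).comap (↑)) =
      ∫⁻ y, f (A + ((homeomorphUnitSphereProd E3).symm y : E3))
        ∂((volume : Measure E3).toSphere.prod (.volumeIoiPow (Module.finrank ℝ E3 - 1))) := by
    rw [← hmp.lintegral_comp_emb (Homeomorph.measurableEmbedding _)]
    simp
  rw [h0, h1, lintegral_prod _ (by fun_prop), hdim, Measure.volumeIoiPow]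
  refine lintegral_congr fun ω => ?_
  rw [lintegral_withDensity_eq_lintegral_mul _ (by fun_prop) (by
    exact hg.comp (measurable_subtype_coe.comp
      ((homeomorphUnitSphereProd E3).symm.measurable.comp measurable_prodMk_left)))]
  have := lintegral_subtype_comap (μ := (volume : Measure ℝ)) measurableSet_Ioi
    (fun r : ℝ => f (A + r • (ω : E3)) * ENNReal.ofReal (r ^ 2)) (s := Set.Ioi 0)
  rw [← this]
  refine lintegral_congr fun r => ?_
  simp [mul_comm]

/-- An inequality between integrals that holds along all rays from `A` holds in space. -/
lemma lintegral_le_of_rays (A : E3) {f g : E3 → ℝ≥0∞} (hf : Measurable f) (hg : Measurable g)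
    (C : ℝ≥0∞) (h : ∀ ω : E3, ‖ω‖ = 1 →
      ∫⁻ r in Set.Ioi (0 : ℝ), f (A + r • ω) * ENNReal.ofReal (r ^ 2) ≤
        C * ∫⁻ r in Set.Ioi (0 : ℝ), g (A + r • ω) * ENNReal.ofReal (r ^ 2)) :
    ∫⁻ x, f x ≤ C * ∫⁻ x, g x := by
  rw [lintegral_polar A hf, lintegral_polar A hg, ← lintegral_const_mul]
  · exact lintegral_mono fun ω => h ω (by simp)
  · refine Measurable.lintegral_prod_right' (f := fun z : Metric.sphere (0 : E3) 1 × ℝ =>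
      g (A + z.2 • (z.1 : E3)) * ENNReal.ofReal (z.2 ^ 2)) ?_
    exact (hg.comp (by fun_prop)).mul (by fun_prop)

open Polynomial in
/-- Continuously differentiable functions whose restriction to every line is a polynomial of
degree at most `n`. -/
structure PolyOnLines (n : ℕ) (F : E3 → ℝ) : Prop where
  contDiff : ContDiff ℝ 1 F
  line : ∀ A w : E3, ∃ P : ℝ[X], P.natDegree ≤ n ∧ ∀ r : ℝ, F (A + r • w) = P.eval r

lemma PolyOnLines.continuous {n : ℕ} {F : E3 → ℝ} (hF : PolyOnLines n F) : Continuous F :=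
  hF.contDiff.continuous

lemma PolyOnLines.hasDerivAt {n : ℕ} {F : E3 → ℝ} (hF : PolyOnLines n F) (A w : E3) (r : ℝ) :
    HasDerivAt (fun r : ℝ => F (A + r • w)) (fderiv ℝ F (A + r • w) w) r := by
  have h1 : HasDerivAt (fun r : ℝ => A + r • w) w r := by
    simpa using ((hasDerivAt_id r).smul_const w).const_add A
  exact ((hF.contDiff.differentiable one_ne_zero (A + r • w)).hasFDerivAt).comp_hasDerivAt r h1

/-- A bounded closed set that is star-shaped with respect to one of its points meets every ray
from that point in a segment. -/
lemma exists_ray_eq {Q : Set E3} (hQ : IsCompact Q) {A : E3} (hA : A ∈ Q) (hs : StarConvex ℝ A Q)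
    {w : E3} (hw : ‖w‖ = 1) : ∃ R : ℝ, 0 ≤ R ∧ ∀ r : ℝ, 0 ≤ r → (A + r • w ∈ Q ↔ r ≤ R) := by
  set I : Set ℝ := {r | 0 ≤ r ∧ A + r • w ∈ Q} with hI
  have h0 : (0 : ℝ) ∈ I := ⟨le_rfl, by simpa using hA⟩
  have hclosed : IsClosed I :=
    (isClosed_Ici (a := (0 : ℝ))).inter (hQ.isClosed.preimage (by fun_prop : Continuous
      fun r : ℝ => A + r • w))
  have hbdd : BddAbove I := by
    obtain ⟨C, hC⟩ := hQ.isBounded.subset_closedBall A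
    refine ⟨C, fun r hr => ?_⟩
    have := hC hr.2
    rw [Metric.mem_closedBall, dist_eq_norm, add_sub_cancel_left, norm_smul, hw, mul_one,
      Real.norm_eq_abs, abs_of_nonneg hr.1] at this
    exact this
  refine ⟨sSup I, le_csSup hbdd h0, fun r hr => ⟨fun h => le_csSup hbdd ⟨hr, h⟩, fun h => ?_⟩⟩
  have hmem := (hclosed.csSup_mem ⟨0, h0⟩ hbdd).2
  rcases hr.eq_or_lt with rfl | hr
  · simpa using hA
  · have hR : 0 < sSup I := hr.trans_le h
    have := hs.add_smul_sub_mem hmem (t := r / sSup I) (by positivity) ((div_le_one hR).2 h)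
    rwa [add_sub_cancel_left, smul_smul, div_mul_cancel₀ _ hR.ne'] at this

lemma lintegral_ray_eq {g : E3 → ℝ} (hg0 : ∀ x, 0 ≤ g x) (A : E3) {w : E3}
    (hg : Continuous fun r : ℝ => g (A + r • w)) {Q : Set E3} {R : ℝ} (hR : 0 ≤ R)
    (h : ∀ r : ℝ, 0 < r → (A + r • w ∈ Q ↔ r ≤ R)) :
    ∫⁻ r in Set.Ioi (0 : ℝ), Q.indicator (fun x => ENNReal.ofReal (g x)) (A + r • w) *
      ENNReal.ofReal (r ^ 2) = ENNReal.ofReal (∫ r in (0 : ℝ)..R, g (A + r • w) * r ^ 2) := by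
  rw [intervalIntegral.integral_of_le hR, ofReal_integral_eq_lintegral_ofReal]
  · rw [← lintegral_indicator measurableSet_Ioi, ← lintegral_indicator measurableSet_Ioc]
    refine lintegral_congr fun r => ?_
    by_cases hr : 0 < r
    · rw [Set.indicator_of_mem (Set.mem_Ioi.2 hr)]
      by_cases hrR : r ≤ R
      · rw [Set.indicator_of_mem ((h r hr).2 hrR),
          Set.indicator_of_mem (show r ∈ Set.Ioc 0 R from ⟨hr, hrR⟩),
          ENNReal.ofReal_mul (hg0 _)]
      · rw [Set.indicator_of_notMem (fun h' => hrR ((h r hr).1 h')), zero_mul,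
          Set.indicator_of_notMem (fun h' => hrR h'.2)]
    · rw [Set.indicator_of_notMem (s := Set.Ioi 0) (fun h' => hr h'),
        Set.indicator_of_notMem (s := Set.Ioc 0 R) (fun h' => hr h'.1)]
  · exact ((hg.mul (by fun_prop)).integrableOn_Icc.mono_set Set.Ioc_subset_Icc_self)
  · exact ae_of_all _ fun r => mul_nonneg (hg0 _) (sq_nonneg r)

/-- A function that is polynomial along lines is controlled on a star-shaped set by its values
on a homothetic image. -/
theorem lintegral_sq_le_homothety {n : ℕ} {F : E3 → ℝ} (hF : PolyOnLines n F) {Q : Set E3}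
    (hQ : IsCompact Q) {A : E3} (hA : A ∈ Q) (hs : StarConvex ℝ A Q) {θ : ℝ} (hθ : 0 < θ)
    (hθ1 : θ ≤ 1) :
    ∫⁻ x in Q, ENNReal.ofReal (F x ^ 2) ≤
      ENNReal.ofReal (1 + T (2 / θ - 1) ^ (2 * n + 3) / 2) *
        ∫⁻ x in AffineMap.homothety A θ '' Q, ENNReal.ofReal (F x ^ 2) := by
  have hFm : Measurable fun x => ENNReal.ofReal (F x ^ 2) := by
    have := hF.continuous.measurable; fun_prop
  have hQ' : IsCompact (AffineMap.homothety A θ '' Q) :=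
    hQ.image (AffineMap.homothety_continuous A θ)
  rw [← lintegral_indicator hQ.measurableSet, ← lintegral_indicator hQ'.measurableSet]
  refine lintegral_le_of_rays A (hFm.indicator hQ.measurableSet)
    (hFm.indicator hQ'.measurableSet) _ fun w hw => ?_
  obtain ⟨R, hR, hray⟩ := exists_ray_eq hQ hA hs hw
  obtain ⟨P, hP, hPF⟩ := hF.line A w
  have hcont : Continuous fun r : ℝ => F (A + r • w) ^ 2 := by
    have := hF.continuous; fun_prop
  have hray' : ∀ r : ℝ, 0 < r → (A + r • w ∈ AffineMap.homothety A θ '' Q ↔ r ≤ θ * R) := by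
    intro r hr
    rw [← div_le_iff₀' hθ, ← hray (r / θ) (by positivity)]
    constructor
    · rintro ⟨y, hy, hyr⟩
      rw [AffineMap.homothety_apply, vsub_eq_sub, vadd_eq_add, add_comm, add_right_inj] at hyr
      have : A + (r / θ) • w = y := by
        rw [div_eq_inv_mul, mul_smul, ← hyr, smul_smul, inv_mul_cancel₀ hθ.ne', one_smul]
        abel
      rwa [this]
    · intro h
      refine ⟨_, h, ?_⟩
      rw [AffineMap.homothety_apply, vsub_eq_sub, vadd_eq_add, add_sub_cancel_left, smul_smul,
        mul_div_cancel₀ _ hθ.ne', add_comm]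
  have e1 := lintegral_ray_eq (g := fun x => F x ^ 2) (fun x => sq_nonneg _) A hcont hR
    (fun r hr => hray r hr.le)
  have e2 := lintegral_ray_eq (g := fun x => F x ^ 2) (fun x => sq_nonneg _) A hcont
    (mul_nonneg hθ.le hR) hray'
  rw [e1, e2, ← ENNReal.ofReal_mul (by
    have : 1 ≤ 2 / θ - 1 := by
      have : 2 ≤ 2 / θ := by rw [le_div_iff₀ hθ]; linarith
      linarith
    have := T_pos this
    positivity)]
  refine ENNReal.ofReal_le_ofReal ?_
  rcases hR.eq_or_lt with rfl | hR
  · simp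
  · simp only [hPF]
    exact weighted_extension hP hθ hθ1 hR

/-- Markov's inequality for the radial derivative. -/
theorem lintegral_radial_markov {n : ℕ} {F : E3 → ℝ} (hF : PolyOnLines n F) {Q : Set E3}
    (hQ : IsCompact Q) {A : E3} (hA : A ∈ Q) (hs : StarConvex ℝ A Q) :
    ∫⁻ x in Q, ENNReal.ofReal (fderiv ℝ F x (x - A) ^ 2) ≤
      ENNReal.ofReal (10 * (n + 2 : ℝ) ^ 4) * ∫⁻ x in Q, ENNReal.ofReal (F x ^ 2) := by
  have hFm : Measurable fun x => ENNReal.ofReal (F x ^ 2) := by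
    have := hF.continuous.measurable; fun_prop
  have hdc : Continuous fun x => fderiv ℝ F x (x - A) :=
    (hF.contDiff.continuous_fderiv one_ne_zero).clm_apply (by fun_prop)
  have hdm : Measurable fun x => ENNReal.ofReal (fderiv ℝ F x (x - A) ^ 2) := by
    have := hdc.measurable; fun_prop
  rw [← lintegral_indicator hQ.measurableSet, ← lintegral_indicator hQ.measurableSet]
  refine lintegral_le_of_rays A (hdm.indicator hQ.measurableSet)
    (hFm.indicator hQ.measurableSet) _ fun w hw => ?_
  obtain ⟨R, hR, hray⟩ := exists_ray_eq hQ hA hs hw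
  obtain ⟨P, hP, hPF⟩ := hF.line A w
  have hcont : Continuous fun r : ℝ => F (A + r • w) ^ 2 := by
    have := hF.continuous; fun_prop
  have hcont' : Continuous fun r : ℝ => fderiv ℝ F (A + r • w) (A + r • w - A) ^ 2 :=
    (hdc.comp (by fun_prop : Continuous fun r : ℝ => A + r • w)).pow 2
  have e1 := lintegral_ray_eq (g := fun x => F x ^ 2) (fun x => sq_nonneg _) A hcont hR
    (fun r hr => hray r hr.le)
  have e2 := lintegral_ray_eq (g := fun x => fderiv ℝ F x (x - A) ^ 2) (fun x => sq_nonneg _) A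
    hcont' hR (fun r hr => hray r hr.le)
  rw [e1, e2, ← ENNReal.ofReal_mul (by positivity)]
  refine ENNReal.ofReal_le_ofReal ?_
  have hd : ∀ r : ℝ, fderiv ℝ F (A + r • w) (A + r • w - A) =
      r * (Polynomial.derivative P).eval r := by
    intro r
    have h1 := hF.hasDerivAt A w r
    have h2 : HasDerivAt (fun r : ℝ => F (A + r • w)) ((Polynomial.derivative P).eval r) r := by
      simp only [hPF]; exact P.hasDerivAt r
    rw [add_sub_cancel_left, map_smul, h1.unique h2, smul_eq_mul]
  rcases hR.eq_or_lt with rfl | hR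
  · simp
  · simp only [hd, hPF]
    exact weighted_markov hP hR

/-- Markov's inequality for the derivative in direction `B - A`, for points `A` and `B` of a
convex set. It is the difference of the radial derivatives around `A` and `B`. -/
theorem lintegral_markov {n : ℕ} {F : E3 → ℝ} (hF : PolyOnLines n F) {Q : Set E3}
    (hQ : IsCompact Q) (hc : Convex ℝ Q) {A B : E3} (hA : A ∈ Q) (hB : B ∈ Q) :
    ∫⁻ x in Q, ENNReal.ofReal (fderiv ℝ F x (B - A) ^ 2) ≤
      ENNReal.ofReal (40 * (n + 2 : ℝ) ^ 4) * ∫⁻ x in Q, ENNReal.ofReal (F x ^ 2) := by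
  have hdm : ∀ A : E3, Measurable fun x => ENNReal.ofReal (fderiv ℝ F x (x - A) ^ 2) := by
    intro A
    have : Continuous fun x => fderiv ℝ F x (x - A) :=
      (hF.contDiff.continuous_fderiv one_ne_zero).clm_apply (by fun_prop)
    have := this.measurable
    fun_prop
  calc ∫⁻ x in Q, ENNReal.ofReal (fderiv ℝ F x (B - A) ^ 2)
      ≤ ∫⁻ x in Q, (ENNReal.ofReal 2 * ENNReal.ofReal (fderiv ℝ F x (x - A) ^ 2) +
          ENNReal.ofReal 2 * ENNReal.ofReal (fderiv ℝ F x (x - B) ^ 2)) := by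
        refine lintegral_mono fun x => ?_
        rw [← ENNReal.ofReal_mul zero_le_two, ← ENNReal.ofReal_mul zero_le_two,
          ← ENNReal.ofReal_add (by positivity) (by positivity)]
        refine ENNReal.ofReal_le_ofReal ?_
        have e : fderiv ℝ F x (B - A) = fderiv ℝ F x (x - A) - fderiv ℝ F x (x - B) := by
          rw [← map_sub]; congr 1; abel
        rw [e]
        nlinarith [sq_nonneg (fderiv ℝ F x (x - A) + fderiv ℝ F x (x - B))]
    _ ≤ ENNReal.ofReal 2 * (ENNReal.ofReal (10 * (n + 2 : ℝ) ^ 4) *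
          ∫⁻ x in Q, ENNReal.ofReal (F x ^ 2)) + ENNReal.ofReal 2 *
          (ENNReal.ofReal (10 * (n + 2 : ℝ) ^ 4) * ∫⁻ x in Q, ENNReal.ofReal (F x ^ 2)) := by
        rw [lintegral_add_left ((hdm A).const_mul _), lintegral_const_mul _ (hdm A),
          lintegral_const_mul _ (hdm B)]
        gcongr
        · exact lintegral_radial_markov hF hQ hA (hc.starConvex hA)
        · exact lintegral_radial_markov hF hQ hB (hc.starConvex hB)
    _ = _ := by
        rw [← mul_assoc, ← ENNReal.ofReal_mul zero_le_two, ← add_mul,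
          ← ENNReal.ofReal_add (by positivity) (by positivity)]
        congr 2; ring

/-! ### Graph coordinates -/

/-- The plane in which the parameters of a graph vary. -/
abbrev E2 := EuclideanSpace ℝ (Fin 2)

/-- The first two coordinates in the frame `L`. -/
def proj (L : E3 ≃ₗᵢ[ℝ] E3) (y : E3) : E2 := !₂[(L y) 0, (L y) 1]

/-- The point with the coordinates `(x, z)` in the frame `L`. -/
def chart (L : E3 ≃ₗᵢ[ℝ] E3) (x : E2) (z : ℝ) : E3 := L.symm !₂[x 0, x 1, z]

/-- The vertical unit vector of the frame `L`. -/
def vert (L : E3 ≃ₗᵢ[ℝ] E3) : E3 := L.symm !₂[0, 0, 1]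

lemma proj_chart (L : E3 ≃ₗᵢ[ℝ] E3) (x : E2) (z : ℝ) : proj L (chart L x z) = x := by
  ext i; fin_cases i <;> simp [proj, chart]

lemma chart_two (L : E3 ≃ₗᵢ[ℝ] E3) (x : E2) (z : ℝ) : (L (chart L x z)) 2 = z := by
  simp [chart]

lemma chart_proj (L : E3 ≃ₗᵢ[ℝ] E3) (y : E3) : chart L (proj L y) ((L y) 2) = y := by
  rw [chart, LinearIsometryEquiv.symm_apply_eq]
  ext i; fin_cases i <;> simp [proj]

lemma chart_add (L : E3 ≃ₗᵢ[ℝ] E3) (x y : E2) (z w : ℝ) :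
    chart L (x + y) (z + w) = chart L x z + chart L y w := by
  rw [chart, chart, chart, ← map_add]
  congr 1; ext i; fin_cases i <;> simp

lemma chart_smul (L : E3 ≃ₗᵢ[ℝ] E3) (x : E2) (z c : ℝ) :
    chart L (c • x) (c * z) = c • chart L x z := by
  rw [chart, chart, ← map_smul]
  congr 1; ext i; fin_cases i <;> simp

lemma chart_zero_right (L : E3 ≃ₗᵢ[ℝ] E3) (t : ℝ) : chart L 0 t = t • vert L := by
  rw [chart, vert, ← map_smul]
  congr 1; ext i; fin_cases i <;> simp

lemma chart_sub_smul_vert (L : E3 ≃ₗᵢ[ℝ] E3) (x : E2) (z t : ℝ) :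
    chart L x (z - t) = chart L x z - t • vert L := by
  have := chart_add L x 0 z (-t)
  rw [add_zero, chart_zero_right, neg_smul] at this
  rw [sub_eq_add_neg, this, sub_eq_add_neg]

lemma norm_vert (L : E3 ≃ₗᵢ[ℝ] E3) : ‖vert L‖ = 1 := by
  rw [vert, LinearIsometryEquiv.norm_map, EuclideanSpace.norm_eq]
  simp [Fin.sum_univ_three]

lemma norm_chart_le (L : E3 ≃ₗᵢ[ℝ] E3) (x : E2) (z : ℝ) : ‖chart L x z‖ ≤ ‖x‖ + |z| := by
  have h := chart_add L x 0 0 z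
  rw [add_zero, zero_add] at h
  rw [h]
  refine (norm_add_le _ _).trans (add_le_add (le_of_eq ?_) (le_of_eq ?_))
  · rw [chart, LinearIsometryEquiv.norm_map, EuclideanSpace.norm_eq, EuclideanSpace.norm_eq]
    simp [Fin.sum_univ_three, Fin.sum_univ_two]
  · rw [chart_zero_right, norm_smul, norm_vert, mul_one, Real.norm_eq_abs]

lemma norm_proj_le (L : E3 ≃ₗᵢ[ℝ] E3) (y : E3) : ‖proj L y‖ ≤ ‖y‖ := by
  rw [← LinearIsometryEquiv.norm_map L y, EuclideanSpace.norm_eq, EuclideanSpace.norm_eq]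
  refine Real.sqrt_le_sqrt ?_
  rw [Fin.sum_univ_two, Fin.sum_univ_three]
  simp only [proj]
  have := sq_nonneg ‖(L y) 2‖
  simpa using this

lemma proj_sub (L : E3 ≃ₗᵢ[ℝ] E3) (x y : E3) : proj L (x - y) = proj L x - proj L y := by
  ext i; fin_cases i <;> simp [proj]

lemma lipschitzWith_proj (L : E3 ≃ₗᵢ[ℝ] E3) : LipschitzWith 1 (proj L) :=
  LipschitzWith.of_dist_le_mul fun x y => by
    rw [dist_eq_norm, dist_eq_norm, ← proj_sub, NNReal.coe_one, one_mul]
    exact norm_proj_le L _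

lemma continuous_chart (L : E3 ≃ₗᵢ[ℝ] E3) : Continuous fun p : E2 × ℝ => chart L p.1 p.2 := by
  refine L.symm.continuous.comp ?_
  refine (PiLp.continuous_toLp 2 _).comp (continuous_pi fun i => ?_)
  fin_cases i <;> simp <;> fun_prop

lemma lipschitzWith_graph (L : E3 ≃ₗᵢ[ℝ] E3) {Ψ : E2 → ℝ} {C : ℝ≥0} (hΨ : LipschitzWith C Ψ) :
    LipschitzWith (1 + C) fun x => chart L x (Ψ x) :=
  LipschitzWith.of_dist_le_mul fun x y => by
    have e : chart L x (Ψ x) - chart L y (Ψ y) = chart L (x - y) (Ψ x - Ψ y) := by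
      rw [sub_eq_iff_eq_add, ← chart_add, sub_add_cancel, sub_add_cancel]
    rw [dist_eq_norm, e]
    refine (norm_chart_le L _ _).trans ?_
    have := hΨ.dist_le_mul x y
    rw [Real.dist_eq, dist_eq_norm] at this
    rw [dist_eq_norm]; push_cast; linarith

lemma lipschitzWith_chart_const (L : E3 ≃ₗᵢ[ℝ] E3) (c : ℝ) :
    LipschitzWith 1 fun x => chart L x c := by
  simpa using lipschitzWith_graph L (LipschitzWith.const (α := E2) c)

lemma measurePreserving_chart (L : E3 ≃ₗᵢ[ℝ] E3) :
    MeasurePreserving (fun p : E2 × ℝ => chart L p.1 p.2)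
      ((volume : Measure E2).prod (volume : Measure ℝ)) volume := by
  have h1 := (PiLp.volume_preserving_ofLp (Fin 2)).prod (MeasurePreserving.id (volume : Measure ℝ))
  have h2 : MeasurePreserving Prod.swap
    ((volume : Measure (Fin 2 → ℝ)).prod (volume : Measure ℝ)) _ := Measure.measurePreserving_swap
  have h3 := (volume_preserving_piFinSuccAbove (fun _ : Fin 3 => ℝ) 2).symm
  have h4 := PiLp.volume_preserving_toLp (Fin 3)
  have h5 := L.symm.measurePreserving
  have h := h5.comp (h4.comp (h3.comp (h2.comp h1)))
  refine (congrArg (fun g => MeasurePreserving g _ _) (funext fun p => ?_)).mp h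
  rw [chart]
  simp only [Function.comp_apply]
  congr 1
  ext i
  fin_cases i <;> rfl

lemma lintegral_chart (L : E3 ≃ₗᵢ[ℝ] E3) {f : E3 → ℝ≥0∞} (hf : Measurable f) :
    ∫⁻ y, f y = ∫⁻ x : E2, ∫⁻ z : ℝ, f (chart L x z) := by
  rw [← (measurePreserving_chart L).lintegral_comp hf,
    lintegral_prod (fun p : E2 × ℝ => f (chart L p.1 p.2))
      (hf.comp (continuous_chart L).measurable).aemeasurable]

lemma lintegral_chart_symm (L : E3 ≃ₗᵢ[ℝ] E3) {f : E3 → ℝ≥0∞} (hf : Measurable f) :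
    ∫⁻ y, f y = ∫⁻ z : ℝ, ∫⁻ x : E2, f (chart L x z) := by
  rw [← (measurePreserving_chart L).lintegral_comp hf,
    lintegral_prod_symm (fun p : E2 × ℝ => f (chart L p.1 p.2))
      (hf.comp (continuous_chart L).measurable).aemeasurable]

/-! ### Surface measure -/

lemma area_image_le {X : Type*} [EMetricSpace X] [MeasurableSpace X] [BorelSpace X]
    {g : X → E3} {C : ℝ≥0} (hg : LipschitzWith C g) (s : Set X) :
    area (g '' s) ≤ (C : ℝ≥0∞) ^ 2 * μHE[2] s := by
  rw [area, Measure.euclideanHausdorffMeasure_def, Measure.euclideanHausdorffMeasure_def]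
  have := hg.hausdorffMeasure_image_le (d := (2 : ℕ)) (by positivity) s
  rw [ENNReal.rpow_natCast] at this
  simp only [Measure.smul_apply, ENNReal.smul_def, smul_eq_mul]
  rw [mul_left_comm]
  exact mul_le_mul_right this _

lemma volume_image_le_area {g : E3 → E2} (hg : LipschitzWith 1 g) (s : Set E3) :
    volume (g '' s) ≤ area s := by
  rw [area, ← EuclideanSpace.euclideanHausdorffMeasure_eq_volume,
    Measure.euclideanHausdorffMeasure_def, Measure.euclideanHausdorffMeasure_def]
  have := hg.hausdorffMeasure_image_le (d := (2 : ℕ)) (by positivity) s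
  rw [ENNReal.coe_one, ENNReal.one_rpow, one_mul] at this
  simp only [Measure.smul_apply, ENNReal.smul_def, smul_eq_mul]
  exact mul_le_mul_right this _

/-- Surface integrals over a Lipschitz parametrised surface are controlled by integrals over the
parameter domain. -/
lemma setLIntegral_area_le {g : E2 → E3} {C : ℝ≥0} (hg : LipschitzWith C g) {S : Set E3}
    (hSg : S ⊆ Set.range g) {f : E3 → ℝ≥0∞} (hf : Measurable f) :
    ∫⁻ y in S, f y ∂area ≤ (C : ℝ≥0∞) ^ 2 * ∫⁻ x in g ⁻¹' S, f (g x) := by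
  have hle : area.restrict S ≤
      ((C : ℝ≥0∞) ^ 2) • ((volume : Measure E2).restrict (g ⁻¹' S)).map g := by
    refine Measure.le_iff.2 fun t ht => ?_
    rw [Measure.restrict_apply ht, Measure.smul_apply,
      Measure.map_apply hg.continuous.measurable ht,
      Measure.restrict_apply (hg.continuous.measurable ht), smul_eq_mul]
    have e : t ∩ S = g '' (g ⁻¹' t ∩ g ⁻¹' S) := by
      rw [← Set.preimage_inter, Set.image_preimage_eq_inter_range, eq_comm, Set.inter_eq_left]
      exact Set.inter_subset_right.trans hSg
    rw [e, ← EuclideanSpace.euclideanHausdorffMeasure_eq_volume]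
    exact area_image_le hg _
  refine (lintegral_mono' hle le_rfl).trans ?_
  rw [lintegral_smul_measure, smul_eq_mul, lintegral_map hf hg.continuous.measurable]

/-- If `Y` parametrises a piece of `S` over a plane to which it projects orthogonally, integrals
over the parameter domain are controlled by surface integrals. -/
lemma lintegral_param_le (L : E3 ≃ₗᵢ[ℝ] E3) {Y : E2 → E3} (hY : Measurable Y) {U : Set E2}
    (hYp : ∀ x, proj L (Y x) = x) {S : Set E3} (hYS : ∀ x ∈ U, Y x ∈ S)
    {f : E3 → ℝ≥0∞} (hf : Measurable f) :
    ∫⁻ x in U, f (Y x) ≤ ∫⁻ y in S, f y ∂area := by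
  rw [← lintegral_map hf hY]
  refine lintegral_mono' (Measure.le_iff.2 fun t ht => ?_) le_rfl
  rw [Measure.map_apply hY ht, Measure.restrict_apply (hY ht), Measure.restrict_apply ht]
  refine (measure_mono ?_).trans (volume_image_le_area (lipschitzWith_proj L) _)
  rintro x ⟨hxt, hxU⟩
  exact ⟨Y x, ⟨hxt, hYS x hxU⟩, hYp x⟩

/-! ### Traces on plane faces -/

lemma lintegral_comp_add_smul {E : Type*} [NormedAddCommGroup E] [NormedSpace ℝ E]
    [MeasurableSpace E] [BorelSpace E] [FiniteDimensional ℝ E] (μ : Measure E)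
    [μ.IsAddHaarMeasure] {f : E → ℝ≥0∞} (hf : Measurable f) (a : E) {s : ℝ} (hs : s ≠ 0) :
    ∫⁻ x, f x ∂μ = ENNReal.ofReal (|s| ^ Module.finrank ℝ E) * ∫⁻ y, f (a + s • y) ∂μ := by
  have h1 := lintegral_map (μ := μ) (f := fun x => f (a + x)) (g := fun y : E => s • y)
    (hf.comp (measurable_const_add a)) (measurable_const_smul s)
  rw [Measure.map_addHaar_smul μ hs, lintegral_smul_measure, smul_eq_mul,
    lintegral_add_left_eq_self f a] at h1
  rw [← h1, ← mul_assoc, ← ENNReal.ofReal_mul (by positivity), abs_inv, abs_pow,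
    mul_inv_cancel₀ (by positivity), ENNReal.ofReal_one, one_mul]

/-- The trace inequality on a plane section of a convex set, from the cone over the section with
a vertex `A` in the set. -/
theorem lintegral_plane_trace {n : ℕ} {F : E3 → ℝ} (hF : PolyOnLines n F) {Q : Set E3}
    (hQ : IsCompact Q) (hc : Convex ℝ Q) (L : E3 ≃ₗᵢ[ℝ] E3) {A : E3} (hA : A ∈ Q) (c : ℝ)
    (hcA : c ≠ (L A) 2) :
    ENNReal.ofReal |c - (L A) 2| *
      ∫⁻ x : E2, Q.indicator (fun y => ENNReal.ofReal (F y ^ 2)) (chart L x c) ≤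
        ENNReal.ofReal (2 * (n + 2 : ℝ) ^ 2) * ∫⁻ y in Q, ENNReal.ofReal (F y ^ 2) := by
  set a := (L A) 2 with ha
  set a' := proj L A with ha'
  have hd : c - a ≠ 0 := sub_ne_zero.2 hcA
  set G : E3 → ℝ≥0∞ := Q.indicator (fun y => ENNReal.ofReal (F y ^ 2)) with hG
  have hFm : Measurable fun x => ENNReal.ofReal (F x ^ 2) := by
    have := hF.continuous.measurable; fun_prop
  have hGm : Measurable G := hFm.indicator hQ.measurableSet
  have hGc : Measurable fun p : E2 × ℝ => G (chart L p.1 p.2) :=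
    hGm.comp (continuous_chart L).measurable
  have hpt : ∀ (x : E2) (s : ℝ), chart L (a' + s • (x - a')) (a + s * (c - a)) =
      A + s • (chart L x c - A) := by
    intro x s
    rw [chart_add, chart_smul, ha', ha, chart_proj]
    congr 2
    have := chart_add L (x - proj L A) (proj L A) (c - (L A) 2) ((L A) 2)
    rw [sub_add_cancel, sub_add_cancel, chart_proj] at this
    rw [this, add_sub_cancel_right]
  -- the slices of `Q` parallel to the section contain homothetic copies of the section
  have h1 : ∫⁻ y in Q, ENNReal.ofReal (F y ^ 2) = ENNReal.ofReal |c - a| *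
      ∫⁻ s : ℝ, ∫⁻ x : E2, G (chart L x (a + s * (c - a))) := by
    rw [← lintegral_indicator hQ.measurableSet, ← hG, lintegral_chart_symm L hGm,
      lintegral_comp_add_smul volume _ a hd]
    · simp [mul_comm]
    · exact Measurable.lintegral_prod_left' (f := fun p : E2 × ℝ => G (chart L p.1 p.2)) hGc
  have h2 : ∀ s : ℝ, 0 < s → ∫⁻ x : E2, G (chart L x (a + s * (c - a))) =
      ∫⁻ x : E2, ENNReal.ofReal (s ^ 2) * G (A + s • (chart L x c - A)) := by
    intro s hs
    have hm : Measurable fun x : E2 => G (chart L x (a + s * (c - a))) :=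
      hGc.comp (measurable_prodMk_right)
    rw [lintegral_comp_add_smul volume hm (a' - s • a') hs.ne', lintegral_const_mul]
    · simp only [← hpt]
      rw [abs_of_pos hs, finrank_euclideanSpace_fin]
      refine congrArg _ (lintegral_congr fun x => ?_)
      rw [smul_sub]; congr 2; abel
    · refine hGm.comp ?_
      have : Continuous fun x : E2 => chart L x c := (lipschitzWith_chart_const L c).continuous
      fun_prop
  have hcc : Continuous fun x : E2 => chart L x c := (lipschitzWith_chart_const L c).continuous
  have h3 : ∫⁻ s in Set.Ioc (0 : ℝ) 1, ∫⁻ x : E2,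
      ENNReal.ofReal (s ^ 2) * G (A + s • (chart L x c - A)) ≤
        ∫⁻ s : ℝ, ∫⁻ x : E2, G (chart L x (a + s * (c - a))) := by
    refine (le_of_eq ?_).trans (setLIntegral_le_lintegral (Set.Ioc (0 : ℝ) 1) _)
    exact setLIntegral_congr_fun measurableSet_Ioc fun s hs => (h2 s hs.1).symm
  have hm3 : Measurable fun p : ℝ × E2 =>
      ENNReal.ofReal (p.1 ^ 2) * G (A + p.1 • (chart L p.2 c - A)) := by
    refine Measurable.mul (by fun_prop) (hGm.comp ?_)
    have : Continuous fun p : ℝ × E2 => A + p.1 • (chart L p.2 c - A) := by fun_prop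
    exact this.measurable
  rw [lintegral_lintegral_swap hm3.aemeasurable] at h3
  rw [h1, ← mul_assoc, mul_comm (ENNReal.ofReal (2 * (n + 2 : ℝ) ^ 2)), mul_assoc]
  refine mul_le_mul_right ?_ _
  refine le_trans ?_ (mul_le_mul_right h3 _)
  rw [← lintegral_const_mul _ (Measurable.lintegral_prod_left' hm3)]
  refine lintegral_mono fun x => ?_
  by_cases hx : chart L x c ∈ Q
  · obtain ⟨P, hP, hPF⟩ := hF.line A (chart L x c - A)
    have h1 : chart L x c = A + (1 : ℝ) • (chart L x c - A) := by simp
    have e1 : G (chart L x c) = ENNReal.ofReal (P.eval 1 ^ 2) := by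
      rw [hG, Set.indicator_of_mem hx, h1, hPF]
    have e2 : ∫⁻ s in Set.Ioc (0 : ℝ) 1, ENNReal.ofReal (s ^ 2) * G (A + s • (chart L x c - A)) =
        ENNReal.ofReal (∫ s in (0 : ℝ)..1, P.eval s ^ 2 * s ^ 2) := by
      rw [intervalIntegral.integral_of_le zero_le_one, ofReal_integral_eq_lintegral_ofReal]
      · refine setLIntegral_congr_fun measurableSet_Ioc fun s hs => ?_
        have : A + s • (chart L x c - A) ∈ Q := (hc.starConvex hA).add_smul_sub_mem hx hs.1.le hs.2
        simp only [hG]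
        rw [Set.indicator_of_mem this, hPF, ← ENNReal.ofReal_mul (sq_nonneg _), mul_comm]
      · exact (Continuous.integrableOn_Icc (by fun_prop)).mono_set Set.Ioc_subset_Icc_self
      · exact ae_of_all _ fun s => by positivity
    rw [e1, e2, ← ENNReal.ofReal_mul (by positivity)]
    exact ENNReal.ofReal_le_ofReal (weighted_trace hP)
  · rw [hG, Set.indicator_of_notMem hx]
    exact zero_le

/-! ### Traces on the faces of a box -/

namespace Box

variable (K : Box)

lemma carrier_eq : K.carrier = (WithLp.ofLp : E3 → Fin 3 → ℝ) ⁻¹'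
    Set.univ.pi fun i => Set.Ioo (K.lo i) (K.hi i) := by
  ext x; simp [carrier]

lemma isOpen_carrier : IsOpen K.carrier := by
  rw [carrier_eq]
  exact (isOpen_set_pi Set.finite_univ fun i _ => isOpen_Ioo).preimage
    (PiLp.continuous_ofLp 2 _)

lemma closure_carrier : closure K.carrier = {x | ∀ i, K.lo i ≤ x i ∧ x i ≤ K.hi i} := by
  have h := (PiLp.homeomorph 2 (fun _ : Fin 3 => ℝ)).preimage_closure
    (Set.univ.pi fun i => Set.Ioo (K.lo i) (K.hi i))
  have e : K.carrier = (PiLp.homeomorph 2 (fun _ : Fin 3 => ℝ)) ⁻¹'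
    Set.univ.pi fun i => Set.Ioo (K.lo i) (K.hi i) := K.carrier_eq
  rw [e, ← h, closure_pi_set]
  ext x
  simp only [closure_Ioo (K.lt _).ne, Set.mem_preimage, Set.mem_pi, Set.mem_univ, true_imp_iff,
    Set.mem_Icc, Set.mem_ofPred_eq]
  rfl

lemma convex_carrier : Convex ℝ K.carrier := by
  rw [carrier_eq]
  exact (convex_pi fun i _ => convex_Ioo _ _).linear_preimage
    (WithLp.linearEquiv 2 ℝ (Fin 3 → ℝ)).toLinearMap

lemma isCompact_closure_carrier : IsCompact (closure K.carrier) := by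
  have h : IsCompact (Set.univ.pi fun i => Set.Icc (K.lo i) (K.hi i)) :=
    isCompact_univ_pi fun i => isCompact_Icc
  have h2 := h.image (PiLp.continuous_toLp 2 (fun _ : Fin 3 => ℝ))
  convert h2 using 1
  rw [closure_carrier]
  ext x
  constructor
  · intro hx
    exact ⟨WithLp.ofLp x, fun i _ => hx i, rfl⟩
  · rintro ⟨y, hy, rfl⟩
    exact fun i => hy i trivial

/-- The two values of the `i`-th coordinate on the faces orthogonal to the `i`-th axis. -/
def side (j : Fin 3) (b : Bool) : ℝ := if b then K.hi j else K.lo j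

/-- The closed faces. -/
def face (j : Fin 3) (b : Bool) : Set E3 := {x ∈ closure K.carrier | x j = K.side j b}

lemma isClosed_face (j : Fin 3) (b : Bool) : IsClosed (K.face j b) :=
  isClosed_closure.inter (isClosed_eq (by fun_prop) continuous_const)

lemma exists_mem_face {x : E3} (hx : x ∈ closure K.carrier) (hx' : x ∉ K.carrier) :
    ∃ j b, x ∈ K.face j b := by
  have h := hx
  rw [closure_carrier] at h
  simp only [carrier, Set.mem_ofPred_eq, not_forall, not_and_or, not_lt] at hx'
  obtain ⟨j, hj | hj⟩ := hx'
  · exact ⟨j, false, hx, by simpa [side] using le_antisymm hj (h j).1⟩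
  · exact ⟨j, true, hx, by simpa [side] using le_antisymm (h j).2 hj⟩

/-- A convex part `Q` of a closed box that contains a vertex `A` of the box and, on each of the
edges at this vertex, a point at distance at least `m` from `A`. -/
structure IsCore (m : ℝ) (Q : Set E3) (A : E3) : Prop where
  pos : 0 < m
  compact : IsCompact Q
  convex : Convex ℝ Q
  subset : Q ⊆ closure K.carrier
  mem : A ∈ Q
  vertex : ∀ j, ∃ b, A j = K.side j b
  edge : ∀ j, ∃ t : ℝ, m ≤ |t| ∧ A + t • EuclideanSpace.single j (1 : ℝ) ∈ Q

end Box

/-- The frame in which the `j`-th axis is vertical. -/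
def axisFrame (j : Fin 3) : E3 ≃ₗᵢ[ℝ] E3 :=
  LinearIsometryEquiv.piLpCongrLeft 2 ℝ ℝ (Equiv.swap j 2)

lemma axisFrame_two (j : Fin 3) (y : E3) : (axisFrame j y) 2 = y j := by
  simp [axisFrame, LinearIsometryEquiv.piLpCongrLeft_apply, Equiv.piCongrLeft']

namespace Box.IsCore

variable {K : Box} {m : ℝ} {Q : Set E3} {A : E3} {n : ℕ} {F : E3 → ℝ}

lemma le_length (h : K.IsCore m Q A) (j : Fin 3) : m ≤ K.hi j - K.lo j := by
  obtain ⟨t, ht, hB⟩ := h.edge j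
  have hA := h.subset h.mem
  have hB := h.subset hB
  rw [K.closure_carrier] at hA hB
  have h1 := hA j
  have h2 := hB j
  simp only [PiLp.add_apply, PiLp.smul_apply, PiLp.single_apply, if_true, smul_eq_mul,
    mul_one] at h2
  refine ht.trans (abs_le.2 ⟨?_, ?_⟩) <;> linarith

/-- A core has a point at distance at least `m` from the plane of each face: the vertex `A`, or the
point on the edge at `A` if `A` lies on the face. -/
lemma exists_apex (h : K.IsCore m Q A) (j : Fin 3) (b : Bool) :
    ∃ B ∈ Q, m ≤ |K.side j b - B j| := by
  by_cases hA : A j = K.side j b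
  · obtain ⟨t, ht, hB⟩ := h.edge j
    refine ⟨_, hB, ?_⟩
    simp only [PiLp.add_apply, PiLp.smul_apply, PiLp.single_apply, if_true, smul_eq_mul,
      mul_one, hA]
    rw [sub_add_cancel_left, abs_neg]
    exact ht
  · refine ⟨A, h.mem, ?_⟩
    obtain ⟨b', hb'⟩ := h.vertex j
    have hl := h.le_length j
    rw [hb'] at hA ⊢
    have := abs_of_pos (sub_pos.2 (K.lt j))
    cases b <;> cases b' <;> simp [Box.side] at hA ⊢
    · rwa [abs_sub_comm, this]
    · rwa [this]

/-- The trace inequality on the part of a face in a core. -/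
theorem face_trace (h : K.IsCore m Q A) (hF : PolyOnLines n F) (j : Fin 3) (b : Bool) :
    ∫⁻ y in K.face j b ∩ Q, ENNReal.ofReal (F y ^ 2) ∂area ≤
      ENNReal.ofReal (2 * (n + 2 : ℝ) ^ 2 / m) * ∫⁻ y in Q, ENNReal.ofReal (F y ^ 2) := by
  obtain ⟨B, hB, hBm⟩ := h.exists_apex j b
  set c := K.side j b
  set L := axisFrame j
  have hFm : Measurable fun x => ENNReal.ofReal (F x ^ 2) := by
    have := hF.continuous.measurable; fun_prop
  have hm := h.pos
  have hne : c ≠ (L B) 2 := by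
    rw [axisFrame_two]
    intro h0
    rw [h0, sub_self, abs_zero] at hBm
    linarith
  have h1 := lintegral_plane_trace hF h.compact h.convex L hB c hne
  have hface : MeasurableSet (K.face j b ∩ Q) :=
    (K.isClosed_face j b).measurableSet.inter h.compact.measurableSet
  have hmem : ∀ y ∈ K.face j b, chart L (proj L y) c = y := by
    intro y hy
    have : (L y) 2 = c := (axisFrame_two j y).trans hy.2
    rw [← this, chart_proj]
  have h2 := setLIntegral_area_le (lipschitzWith_chart_const L c) (S := K.face j b ∩ Q)
    (fun y hy => ⟨_, hmem y hy.1⟩) hFm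
  rw [ENNReal.coe_one, one_pow, one_mul] at h2
  have h3 : ∫⁻ x in (fun x => chart L x c) ⁻¹' (K.face j b ∩ Q),
      ENNReal.ofReal (F (chart L x c) ^ 2) ≤
        ∫⁻ x : E2, Q.indicator (fun y => ENNReal.ofReal (F y ^ 2)) (chart L x c) := by
    refine le_trans (setLIntegral_mono' ((lipschitzWith_chart_const L c).continuous.measurable
      hface) fun x hx => ?_) (setLIntegral_le_lintegral _ _)
    exact (Set.indicator_of_mem (show chart L x c ∈ Q from hx.2)
      (fun y => ENNReal.ofReal (F y ^ 2))).ge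
  refine (h2.trans h3).trans ?_
  rw [axisFrame_two] at h1
  have h4 : ENNReal.ofReal m * ∫⁻ x : E2, Q.indicator (fun y => ENNReal.ofReal (F y ^ 2))
      (chart L x c) ≤ ENNReal.ofReal (2 * (n + 2 : ℝ) ^ 2) *
        ∫⁻ y in Q, ENNReal.ofReal (F y ^ 2) :=
    le_trans (mul_le_mul_left (ENNReal.ofReal_le_ofReal hBm) _) h1
  have hm0 : ENNReal.ofReal m ≠ 0 := by simpa using hm
  rw [ENNReal.ofReal_div_of_pos hm, div_eq_mul_inv, mul_right_comm, ← div_eq_mul_inv,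
    ENNReal.le_div_iff_mul_le (Or.inl hm0) (Or.inl ENNReal.ofReal_ne_top), mul_comm]
  exact h4

/-- Markov's inequality for directional derivatives. -/
theorem markov (h : K.IsCore m Q A) (hF : PolyOnLines n F) {w : E3} (hw : ‖w‖ = 1) :
    ∫⁻ y in Q, ENNReal.ofReal (fderiv ℝ F y w ^ 2) ≤
      ENNReal.ofReal (120 * (n + 2 : ℝ) ^ 4 / m ^ 2) * ∫⁻ y in Q, ENNReal.ofReal (F y ^ 2) := by
  have hm := h.pos
  have hdm : ∀ w : E3, Measurable fun x => ENNReal.ofReal (fderiv ℝ F x w ^ 2) := by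
    intro w
    have : Continuous fun x => fderiv ℝ F x w :=
      (hF.contDiff.continuous_fderiv one_ne_zero).clm_apply (by fun_prop)
    have := this.measurable
    fun_prop
  choose t ht hB using h.edge
  have h1 : ∀ j, ∫⁻ y in Q, ENNReal.ofReal
      (fderiv ℝ F y (t j • EuclideanSpace.single j (1 : ℝ)) ^ 2) ≤
      ENNReal.ofReal (40 * (n + 2 : ℝ) ^ 4) * ∫⁻ x in Q, ENNReal.ofReal (F x ^ 2) := by
    intro j
    have := lintegral_markov hF h.compact h.convex h.mem (hB j)
    simpa only [add_sub_cancel_left] using this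
  have h2 : ∀ y, ENNReal.ofReal (fderiv ℝ F y w ^ 2) ≤ ∑ j, ENNReal.ofReal (1 / m ^ 2) *
      ENNReal.ofReal (fderiv ℝ F y (t j • EuclideanSpace.single j (1 : ℝ)) ^ 2) := by
    intro y
    have hsum : w = ∑ j, w j • EuclideanSpace.single j (1 : ℝ) := by
      ext i; simp [Fin.sum_univ_three]; fin_cases i <;> simp
    have hw2 : ∑ j, w j ^ 2 = 1 := by
      have := EuclideanSpace.norm_sq_eq w
      rw [hw] at this
      simpa using this.symm
    simp only [← ENNReal.ofReal_mul (show 0 ≤ 1 / m ^ 2 by positivity)]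
    rw [← ENNReal.ofReal_sum_of_nonneg (fun j _ => by positivity)]
    refine ENNReal.ofReal_le_ofReal ?_
    have e : fderiv ℝ F y w = ∑ j, w j * fderiv ℝ F y (EuclideanSpace.single j (1 : ℝ)) := by
      conv_lhs => rw [hsum]
      rw [map_sum]
      simp only [map_smul, smul_eq_mul]
    rw [e]
    refine (Finset.sum_mul_sq_le_sq_mul_sq _ _ _).trans ?_
    rw [hw2, one_mul]
    refine Finset.sum_le_sum fun j _ => ?_
    rw [map_smul, smul_eq_mul, mul_pow, ← mul_assoc]
    have : 1 ≤ 1 / m ^ 2 * t j ^ 2 := by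
      rw [one_div, ← div_eq_inv_mul, le_div_iff₀ (by positivity), one_mul, ← sq_abs (t j)]
      exact pow_le_pow_left₀ hm.le (ht j) 2
    exact le_mul_of_one_le_left (sq_nonneg _) this
  refine (lintegral_mono h2).trans ?_
  rw [lintegral_finsetSum _ fun j _ => (hdm _).const_mul _]
  have h3 : ∀ j ∈ (Finset.univ : Finset (Fin 3)), ∫⁻ y in Q, ENNReal.ofReal (1 / m ^ 2) *
      ENNReal.ofReal (fderiv ℝ F y (t j • EuclideanSpace.single j (1 : ℝ)) ^ 2) ≤
      ENNReal.ofReal (1 / m ^ 2) * (ENNReal.ofReal (40 * (n + 2 : ℝ) ^ 4) *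
        ∫⁻ x in Q, ENNReal.ofReal (F x ^ 2)) := by
    intro j _
    rw [lintegral_const_mul _ (hdm _)]
    exact mul_le_mul_right (h1 j) _
  refine (Finset.sum_le_card_nsmul _ _ _ h3).trans (le_of_eq ?_)
  rw [Finset.card_fin, nsmul_eq_mul, ← mul_assoc, ← mul_assoc,
    show ((3 : ℕ) : ℝ≥0∞) = ENNReal.ofReal 3 by simp,
    ← ENNReal.ofReal_mul (by positivity), ← ENNReal.ofReal_mul (by positivity)]
  congr 2; field_simp; ring

end Box.IsCore

/-! ### Traces on Lipschitz surfaces -/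

/-- In the ball, `D` is the set below the graph of the Lipschitz function `Ψ` in the frame `L`. -/
structure IsGraphChart (D : Set E3) (x₀ : E3) (r : ℝ) (L : E3 ≃ₗᵢ[ℝ] E3) (Ψ : E2 → ℝ)
    (C : ℝ≥0) : Prop where
  pos : 0 < r
  lipschitz : LipschitzWith C Ψ
  iff : ∀ y ∈ Metric.ball x₀ r, (y ∈ D ↔ (L y) 2 < Ψ (proj L y))

lemma continuous_proj (L : E3 ≃ₗᵢ[ℝ] E3) : Continuous (proj L) := (lipschitzWith_proj L).continuous

namespace IsGraphChart

variable {D : Set E3} {x₀ : E3} {r : ℝ} {L : E3 ≃ₗᵢ[ℝ] E3} {Ψ : E2 → ℝ} {C : ℝ≥0}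

lemma frontier_eq (h : IsGraphChart D x₀ r L Ψ C) {y : E3} (hy : y ∈ Metric.ball x₀ r)
    (hyD : y ∈ frontier D) : (L y) 2 = Ψ (proj L y) := by
  have hz : Continuous fun y : E3 => (L y) 2 := by fun_prop
  have hΨ : Continuous fun y : E3 => Ψ (proj L y) :=
    h.lipschitz.continuous.comp (continuous_proj L)
  have hb : Metric.ball x₀ r ∈ 𝓝 y := Metric.isOpen_ball.mem_nhds hy
  rcases lt_trichotomy ((L y) 2) (Ψ (proj L y)) with hlt | heq | hgt
  · exfalso
    refine hyD.2 (mem_interior_iff_mem_nhds.2 ?_)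
    filter_upwards [hb, (isOpen_lt hz hΨ).mem_nhds hlt] with w hw hw'
    exact (h.iff w hw).2 hw'
  · exact heq
  · exfalso
    have : ∀ᶠ w in 𝓝 y, w ∉ D := by
      filter_upwards [hb, (isOpen_lt hΨ hz).mem_nhds hgt] with w hw hw' hwD
      exact lt_asymm ((h.iff w hw).1 hwD) hw'
    exact (mem_closure_iff_frequently.1 hyD.1) this

lemma frontier_subset_range (h : IsGraphChart D x₀ r L Ψ C) {y : E3} (hy : y ∈ Metric.ball x₀ r)
    (hyD : y ∈ frontier D) : chart L (proj L y) (Ψ (proj L y)) = y := by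
  rw [← h.frontier_eq hy hyD, chart_proj]

/-- The vertical line below a point of the graph stays in `D` for a fixed length. -/
lemma sub_smul_vert_mem (h : IsGraphChart D x₀ r L Ψ C) {y : E3}
    (hy : y ∈ Metric.ball x₀ (r / 2)) (hyD : y ∈ frontier D) {t : ℝ} (ht : 0 < t)
    (htr : t < r / 2) : y - t • vert L ∈ D := by
  have hr := h.pos
  have hy' : y ∈ Metric.ball x₀ r := Metric.ball_subset_ball (by linarith) hy
  have hb : y - t • vert L ∈ Metric.ball x₀ r := by
    rw [Metric.mem_ball, dist_eq_norm] at hy ⊢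
    calc ‖y - t • vert L - x₀‖ = ‖(y - x₀) - t • vert L‖ := by congr 1; abel
      _ ≤ ‖y - x₀‖ + ‖t • vert L‖ := norm_sub_le _ _
      _ < r / 2 + r / 2 := by
        rw [norm_smul, norm_vert, mul_one, Real.norm_eq_abs, abs_of_pos ht]
        exact add_lt_add hy htr
      _ = r := by ring
  rw [h.iff _ hb]
  have e := h.frontier_subset_range hy' hyD
  have e2 : y - t • vert L = chart L (proj L y) (Ψ (proj L y) - t) := by
    rw [chart_sub_smul_vert, e]
  rw [e2, proj_chart, chart_two]
  linarith

end IsGraphChart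

lemma continuous_line_sub (y w : E3) : Continuous fun t : ℝ => y - t • w := by fun_prop

/-- The fundamental theorem of calculus for `F ^ 2` on a segment. -/
lemma sq_le_sq_add_lintegral {n : ℕ} {F : E3 → ℝ} (hF : PolyOnLines n F) (y w : E3) {lam : ℝ}
    (hlam : 0 < lam) {e : ℝ} (he : 0 ≤ e) :
    ENNReal.ofReal (F y ^ 2) ≤ ENNReal.ofReal (F (y - e • w) ^ 2) +
      ∫⁻ t in Set.Ioc 0 e, ENNReal.ofReal (lam * F (y - t • w) ^ 2 +
        lam⁻¹ * fderiv ℝ F (y - t • w) w ^ 2) := by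
  set k : ℝ → ℝ := fun t => lam * F (y - t • w) ^ 2 + lam⁻¹ * fderiv ℝ F (y - t • w) w ^ 2 with hk
  have hl := continuous_line_sub y w
  have hFc : Continuous fun t : ℝ => F (y - t • w) := hF.continuous.comp hl
  have hdc : Continuous fun t : ℝ => fderiv ℝ F (y - t • w) w :=
    ((hF.contDiff.continuous_fderiv one_ne_zero).comp hl).clm_apply continuous_const
  have hkc : Continuous k :=
    ((hFc.pow 2).const_mul lam).add ((hdc.pow 2).const_mul lam⁻¹)
  have hpc : Continuous fun t : ℝ => -(2 * F (y - t • w) * fderiv ℝ F (y - t • w) w) :=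
    ((hFc.const_mul 2).mul hdc).neg
  have hk0 : ∀ t, 0 ≤ k t := fun t => by positivity
  have hder : ∀ t, HasDerivAt (fun t : ℝ => F (y - t • w) ^ 2)
      (-(2 * F (y - t • w) * fderiv ℝ F (y - t • w) w)) t := by
    intro t
    have h1 := hF.hasDerivAt y (-w) t
    simp only [smul_neg, ← sub_eq_add_neg, map_neg] at h1
    refine (h1.pow 2).congr_deriv ?_
    simp
  have hint := intervalIntegral.integral_eq_sub_of_hasDerivAt (a := 0) (b := e)
    (fun t _ => hder t) (hpc.intervalIntegrable _ _)
  have hle : -∫ t in (0 : ℝ)..e, -(2 * F (y - t • w) * fderiv ℝ F (y - t • w) w) ≤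
      ∫ t in (0 : ℝ)..e, k t := by
    rw [← intervalIntegral.integral_neg]
    refine intervalIntegral.integral_mono_on he (hpc.neg.intervalIntegrable _ _)
      (hkc.intervalIntegrable _ _) fun t _ => ?_
    rw [neg_neg, hk]
    set a := F (y - t • w)
    set b := fderiv ℝ F (y - t • w) w
    have h1 : lam * a ^ 2 + lam⁻¹ * b ^ 2 - 2 * a * b = lam * (a - lam⁻¹ * b) ^ 2 := by
      field_simp; ring
    have h2 : 0 ≤ lam * (a - lam⁻¹ * b) ^ 2 := by positivity
    linarith
  rw [hint] at hle
  simp only [zero_smul, sub_zero] at hle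
  have hke : ∫⁻ t in Set.Ioc 0 e, ENNReal.ofReal (k t) =
      ENNReal.ofReal (∫ t in (0 : ℝ)..e, k t) := by
    rw [intervalIntegral.integral_of_le he, ofReal_integral_eq_lintegral_ofReal]
    · exact hkc.integrableOn_Icc.mono_set Set.Ioc_subset_Icc_self
    · exact ae_of_all _ hk0
  rw [hke, ← ENNReal.ofReal_add (sq_nonneg _)
    (intervalIntegral.integral_nonneg he fun t _ => hk0 t)]
  exact ENNReal.ofReal_le_ofReal (by linarith)

namespace Box.IsCore

variable {K : Box} {m : ℝ} {Q : Set E3} {A : E3} {n : ℕ} {F : E3 → ℝ}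
  {D : Set E3} {x₀ : E3} {r : ℝ} {L : E3 ≃ₗᵢ[ℝ] E3} {Ψ : E2 → ℝ} {C : ℝ≥0}

/-- The point of the plane of a face on the vertical line through a point `y`. -/
def _root_.UnfittedMaxwell.Box.exitPoint (K : Box) (L : E3 ≃ₗᵢ[ℝ] E3) (j : Fin 3) (b : Bool)
    (y : E3) : E3 := y - ((y j - K.side j b) / (vert L) j) • vert L

/-- Going down vertically from a point of the surface one stays in `D`, until one leaves the box
through a face, or for a fixed length. -/
lemma sq_le_on_graph (h : K.IsCore m Q A) (hF : PolyOnLines n F)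
    (hD : IsGraphChart D x₀ r L Ψ C) (hKQ : K.carrier ∩ D ⊆ Q) {lam : ℝ} (hlam : 0 < lam) {y : E3}
    (hyK : y ∈ K.carrier) (hyD : y ∈ frontier D) (hy : y ∈ Metric.ball x₀ (r / 2)) :
    ENNReal.ofReal (F y ^ 2) ≤
      (∑ j, ∑ b, (K.face j b ∩ Q).indicator (fun z => ENNReal.ofReal (F z ^ 2))
        (K.exitPoint L j b y)) +
      (ENNReal.ofReal (2 / r) * (∫⁻ t : ℝ, Q.indicator (fun z => ENNReal.ofReal (F z ^ 2))
        (y - t • vert L)) +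
       ∫⁻ t : ℝ, Q.indicator (fun z => ENNReal.ofReal (lam * F z ^ 2 +
          lam⁻¹ * fderiv ℝ F z (vert L) ^ 2)) (y - t • vert L)) := by
  set w := vert L with hw
  set kk : E3 → ℝ≥0∞ := fun z => ENNReal.ofReal (lam * F z ^ 2 +
          lam⁻¹ * fderiv ℝ F z w ^ 2) with hkk
  have hr := hD.pos
  have hl := continuous_line_sub y w
  have hQm := h.compact.measurableSet
  have hint : ∀ e : ℝ, 0 ≤ e → (∀ t : ℝ, 0 < t → t ≤ e → y - t • w ∈ Q) →
      ∫⁻ t in Set.Ioc 0 e, kk (y - t • w) ≤ ∫⁻ t : ℝ, Q.indicator kk (y - t • w) := by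
    intro e _ hQ
    rw [← lintegral_indicator measurableSet_Ioc]
    refine lintegral_mono fun t => ?_
    by_cases ht : t ∈ Set.Ioc 0 e
    · rw [Set.indicator_of_mem ht, Set.indicator_of_mem (hQ t ht.1 ht.2)]
    · rw [Set.indicator_of_notMem ht]; exact zero_le
  set I : Set ℝ := {t | 0 ≤ t ∧ t < r / 2 ∧ y - t • w ∉ K.carrier} with hI
  by_cases hne : I.Nonempty
  · -- the line leaves the box, for the first time at the parameter `e`
    set e := sInf I with he
    have hbdd : BddBelow I := ⟨0, fun t ht => ht.1⟩
    have he0 : 0 ≤ e := le_csInf hne fun t ht => ht.1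
    have her : e < r / 2 := by
      obtain ⟨t, ht⟩ := hne
      exact (csInf_le hbdd ht).trans_lt ht.2.1
    have hlt : ∀ t, 0 ≤ t → t < e → y - t • w ∈ K.carrier := by
      intro t ht hte
      by_contra hcon
      exact absurd (csInf_le hbdd ⟨ht, hte.trans her, hcon⟩) (not_le.2 hte)
    have heK : y - e • w ∉ K.carrier := by
      intro hcon
      have hopen : {t : ℝ | y - t • w ∈ K.carrier} ∈ 𝓝 e :=
        (K.isOpen_carrier.preimage hl).mem_nhds hcon
      obtain ⟨δ, hδ, hball⟩ := Metric.mem_nhds_iff.1 hopen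
      obtain ⟨t, ht, htlt⟩ := exists_lt_of_csInf_lt hne (show sInf I < e + δ by linarith)
      have hte : e ≤ t := csInf_le hbdd ht
      refine ht.2.2 (hball ?_)
      rw [Metric.mem_ball, Real.dist_eq, abs_of_nonneg (by linarith)]
      linarith
    have hepos : 0 < e := by
      rcases he0.eq_or_lt with h0 | h0
      · rw [← h0, zero_smul, sub_zero] at heK; exact absurd hyK heK
      · exact h0
    have hQlt : ∀ t, 0 < t → t < e → y - t • w ∈ Q := fun t ht hte =>
      hKQ ⟨hlt t ht.le hte, hD.sub_smul_vert_mem hy hyD ht (hte.trans her)⟩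
    have hclos : ∀ S : Set E3, (∀ t, 0 < t → t < e → y - t • w ∈ S) →
        y - e • w ∈ closure S := by
      intro S hS
      refine mem_closure_of_tendsto (f := fun t : ℝ => y - t • w) (b := 𝓝[<] e)
        (hl.continuousAt.tendsto.mono_left nhdsWithin_le_nhds) ?_
      filter_upwards [Ioo_mem_nhdsLT hepos] with t ht using hS t ht.1 ht.2
    have heQ : y - e • w ∈ Q := by
      have := hclos Q hQlt
      rwa [h.compact.isClosed.closure_eq] at this
    have heKc : y - e • w ∈ closure K.carrier := hclos _ fun t ht hte => hlt t ht.le hte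
    obtain ⟨j, b, hjb⟩ := K.exists_mem_face heKc heK
    have hexit : K.exitPoint L j b y = y - e • w := by
      have h1 : y j - e * w j = K.side j b := by simpa using hjb.2
      have h2 : w j ≠ 0 := by
        intro h0
        rw [h0, mul_zero, sub_zero] at h1
        have := hyK j
        cases b <;> simp [Box.side] at h1 <;> linarith
      rw [Box.exitPoint, ← hw, show (y j - K.side j b) / w j = e by
        rw [div_eq_iff h2]; linarith]
    refine (sq_le_sq_add_lintegral hF y w hlam he0).trans (add_le_add ?_ ?_)
    · have h1 : ENNReal.ofReal (F (y - e • w) ^ 2) = (K.face j b ∩ Q).indicator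
          (fun z => ENNReal.ofReal (F z ^ 2)) (K.exitPoint L j b y) := by
        rw [hexit, Set.indicator_of_mem (show y - e • w ∈ K.face j b ∩ Q from ⟨hjb, heQ⟩)]
      rw [h1]
      refine le_trans ?_ (Finset.single_le_sum (fun _ _ => zero_le) (Finset.mem_univ j))
      exact Finset.single_le_sum (f := fun b => (K.face j b ∩ Q).indicator
          (fun z => ENNReal.ofReal (F z ^ 2)) (K.exitPoint L j b y))
        (fun _ _ => zero_le) (Finset.mem_univ b)
    · refine (hint e he0 fun t ht hte => ?_).trans le_add_self
      rcases hte.eq_or_lt with rfl | hte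
      · exact heQ
      · exact hQlt t ht hte
  · -- the line stays in the box, and the values on it are averaged
    refine le_trans ?_ le_add_self
    have hQ : ∀ t, 0 < t → t < r / 2 → y - t • w ∈ Q := by
      intro t ht htr
      refine hKQ ⟨?_, hD.sub_smul_vert_mem hy hyD ht htr⟩
      by_contra hcon
      exact hne ⟨t, ht.le, htr, hcon⟩
    set X := ∫⁻ t : ℝ, Q.indicator kk (y - t • w)
    have h1 : ∀ e ∈ Set.Ioo 0 (r / 2), ENNReal.ofReal (F y ^ 2) ≤
        Q.indicator (fun z => ENNReal.ofReal (F z ^ 2)) (y - e • w) + X := by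
      intro e he
      refine (sq_le_sq_add_lintegral hF y w hlam he.1.le).trans (add_le_add ?_ ?_)
      · rw [Set.indicator_of_mem (hQ e he.1 he.2)]
      · exact hint e he.1.le fun t ht hte => hQ t ht (hte.trans_lt he.2)
    have h2 := setLIntegral_mono' (μ := volume) measurableSet_Ioo h1
    rw [setLIntegral_const, Real.volume_Ioo, sub_zero, lintegral_add_right _ measurable_const,
      setLIntegral_const, Real.volume_Ioo, sub_zero] at h2
    have hc : ENNReal.ofReal (2 / r) * ENNReal.ofReal (r / 2) = 1 := by
      rw [← ENNReal.ofReal_mul (by positivity)]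
      rw [show 2 / r * (r / 2) = 1 by field_simp, ENNReal.ofReal_one]
    calc ENNReal.ofReal (F y ^ 2)
        = ENNReal.ofReal (2 / r) * (ENNReal.ofReal (F y ^ 2) * ENNReal.ofReal (r / 2)) := by
          rw [mul_left_comm, hc, mul_one]
      _ ≤ ENNReal.ofReal (2 / r) * ((∫⁻ e in Set.Ioo 0 (r / 2),
            Q.indicator (fun z => ENNReal.ofReal (F z ^ 2)) (y - e • w)) +
              X * ENNReal.ofReal (r / 2)) := mul_le_mul_right h2 _
      _ = ENNReal.ofReal (2 / r) * (∫⁻ e in Set.Ioo 0 (r / 2),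
            Q.indicator (fun z => ENNReal.ofReal (F z ^ 2)) (y - e • w)) + X := by
          rw [mul_add, mul_left_comm, hc, mul_one]
      _ ≤ _ := by
          gcongr
          exact Measure.restrict_le_self

/-- The trace inequality on the part of a Lipschitz surface in a box. -/
theorem graph_trace (h : K.IsCore m Q A) (hF : PolyOnLines n F)
    (hD : IsGraphChart D x₀ r L Ψ C) (hKQ : K.carrier ∩ D ⊆ Q) :
    ∫⁻ y in K.carrier ∩ frontier D ∩ Metric.ball x₀ (r / 2), ENNReal.ofReal (F y ^ 2) ∂area ≤
      ENNReal.ofReal ((1 + C) ^ 2 * (2 / r + 133 * (n + 2 : ℝ) ^ 2 / m)) *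
        ∫⁻ y in Q, ENNReal.ofReal (F y ^ 2) := by
  set S := K.carrier ∩ frontier D ∩ Metric.ball x₀ (r / 2) with hS
  set g : E2 → E3 := fun x => chart L x (Ψ x) with hg
  have hm := h.pos
  have hr := hD.pos
  have hlip : LipschitzWith (1 + C) g := lipschitzWith_graph L hD.lipschitz
  have hball : Metric.ball x₀ (r / 2) ⊆ Metric.ball x₀ r := Metric.ball_subset_ball (by linarith)
  have hrange : S ⊆ Set.range g := fun y hy =>
    ⟨proj L y, hD.frontier_subset_range (hball hy.2) hy.1.2⟩
  have hFm : Measurable fun x => ENNReal.ofReal (F x ^ 2) := by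
    have := hF.continuous.measurable; fun_prop
  have hdc : Continuous fun x => fderiv ℝ F x (vert L) :=
    (hF.contDiff.continuous_fderiv one_ne_zero).clm_apply (by fun_prop)
  have hdm : Measurable fun x => ENNReal.ofReal (fderiv ℝ F x (vert L) ^ 2) := by
    have := hdc.measurable; fun_prop
  have hQm := h.compact.measurableSet
  -- `lam` balances the terms of Young's inequality: by Markov's inequality the square of the
  -- derivative costs a factor of order `(n + 2) ^ 4 / m ^ 2`.
  set lam : ℝ := (n + 2 : ℝ) ^ 2 / m with hlam
  have hlam0 : 0 < lam := by positivity
  set kk : E3 → ℝ≥0∞ := fun z => ENNReal.ofReal (lam * F z ^ 2 +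
          lam⁻¹ * fderiv ℝ F z (vert L) ^ 2) with hkk
  have hkm : Measurable kk := by
    have := hdc.measurable; have := hF.continuous.measurable; fun_prop
  have hSm : MeasurableSet S :=
    (K.isOpen_carrier.measurableSet.inter isClosed_frontier.measurableSet).inter
      measurableSet_ball
  have hshift : ∀ (f : E3 → ℝ≥0∞) (x : E2),
      ∫⁻ t : ℝ, f (g x - t • vert L) = ∫⁻ z : ℝ, f (chart L x z) := by
    intro f x
    rw [← lintegral_sub_left_eq_self (fun z => f (chart L x z)) (Ψ x)]
    simp only [hg, chart_sub_smul_vert]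
  have hY : ∀ j b, Measurable fun x : E2 => K.exitPoint L j b (g x) := by
    intro j b
    have := hlip.continuous
    have : Continuous fun x : E2 => K.exitPoint L j b (g x) := by
      unfold Box.exitPoint; fun_prop
    exact this.measurable
  -- Points are moved vertically only, so that all the integrals have the same parameter domain.
  have hYp : ∀ j b x, proj L (K.exitPoint L j b (g x)) = x := by
    intro j b x
    rw [Box.exitPoint, hg, ← chart_sub_smul_vert, proj_chart]
  have hfm : ∀ j b, MeasurableSet (K.face j b ∩ Q) := fun j b =>
    (K.isClosed_face j b).measurableSet.inter hQm
  set X := ∫⁻ y in Q, ENNReal.ofReal (F y ^ 2) with hX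
  have h1 : ∫⁻ x in g ⁻¹' S, ENNReal.ofReal (F (g x) ^ 2) ≤
      ∫⁻ x : E2, ((∑ j, ∑ b, (K.face j b ∩ Q).indicator (fun z => ENNReal.ofReal (F z ^ 2))
        (K.exitPoint L j b (g x))) +
      (ENNReal.ofReal (2 / r) * (∫⁻ z : ℝ, Q.indicator (fun z => ENNReal.ofReal (F z ^ 2))
        (chart L x z)) + ∫⁻ z : ℝ, Q.indicator kk (chart L x z))) := by
    refine le_trans ?_ (setLIntegral_le_lintegral (g ⁻¹' S) _)
    refine setLIntegral_mono' (hlip.continuous.measurable hSm) fun x hx => ?_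
    have := h.sq_le_on_graph hF hD hKQ hlam0 (y := g x) hx.1.1 hx.1.2 hx.2
    rwa [hshift, hshift] at this
  have hcm : ∀ f : E3 → ℝ≥0∞, Measurable f → Measurable fun x : E2 => ∫⁻ z : ℝ, f (chart L x z) :=
    fun f hf => Measurable.lintegral_prod_right'
      (f := fun p : E2 × ℝ => f (chart L p.1 p.2)) (hf.comp (continuous_chart L).measurable)
  have hFi : Measurable (Q.indicator fun z => ENNReal.ofReal (F z ^ 2)) := hFm.indicator hQm
  have hki : Measurable (Q.indicator kk) := hkm.indicator hQm
  have hYi : ∀ j b, Measurable fun x : E2 => (K.face j b ∩ Q).indicator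
      (fun z => ENNReal.ofReal (F z ^ 2)) (K.exitPoint L j b (g x)) := fun j b =>
    (hFm.indicator (hfm j b)).comp (hY j b)
  rw [lintegral_add_left (Finset.measurable_fun_sum _ fun j _ =>
      Finset.measurable_fun_sum _ fun b _ => hYi j b),
    lintegral_add_left ((hcm _ hFi).const_mul _), lintegral_const_mul _ (hcm _ hFi),
    ← lintegral_chart L hFi, ← lintegral_chart L hki, lintegral_indicator hQm,
    lintegral_indicator hQm,
    lintegral_finsetSum _ fun j _ => Finset.measurable_fun_sum _ fun b _ => hYi j b] at h1
  have hface : ∀ j b, ∫⁻ x : E2, (K.face j b ∩ Q).indicator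
      (fun z => ENNReal.ofReal (F z ^ 2)) (K.exitPoint L j b (g x)) ≤
        ENNReal.ofReal (2 * (n + 2 : ℝ) ^ 2 / m) * X := by
    intro j b
    have h2 := lintegral_param_le L (hY j b) (U := Set.univ) (hYp j b) (S := Set.univ)
      (fun _ _ => trivial) (hFm.indicator (hfm j b))
    rw [Measure.restrict_univ, Measure.restrict_univ, lintegral_indicator (hfm j b)] at h2
    exact h2.trans (h.face_trace hF j b)
  have hfaces : ∑ j, ∫⁻ x : E2, ∑ b, (K.face j b ∩ Q).indicator
      (fun z => ENNReal.ofReal (F z ^ 2)) (K.exitPoint L j b (g x)) ≤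
        ENNReal.ofReal (12 * (n + 2 : ℝ) ^ 2 / m) * X := by
    have h2 : ∀ j ∈ (Finset.univ : Finset (Fin 3)), ∫⁻ x : E2, ∑ b, (K.face j b ∩ Q).indicator
        (fun z => ENNReal.ofReal (F z ^ 2)) (K.exitPoint L j b (g x)) ≤
          2 * (ENNReal.ofReal (2 * (n + 2 : ℝ) ^ 2 / m) * X) := by
      intro j _
      rw [lintegral_finsetSum _ fun b _ => hYi j b, Fintype.sum_bool, two_mul]
      exact add_le_add (hface j true) (hface j false)
    refine (Finset.sum_le_card_nsmul _ _ _ h2).trans (le_of_eq ?_)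
    rw [Finset.card_fin, nsmul_eq_mul, ← mul_assoc, ← mul_assoc,
      show ((3 : ℕ) : ℝ≥0∞) = ENNReal.ofReal 3 by simp,
      show (2 : ℝ≥0∞) = ENNReal.ofReal 2 by simp,
      ← ENNReal.ofReal_mul (by positivity), ← ENNReal.ofReal_mul (by positivity)]
    congr 2; ring
  have hk : ∫⁻ y in Q, kk y ≤ ENNReal.ofReal (121 * (n + 2 : ℝ) ^ 2 / m) * X := by
    have e : ∀ y, kk y = ENNReal.ofReal lam * ENNReal.ofReal (F y ^ 2) +
        ENNReal.ofReal lam⁻¹ * ENNReal.ofReal (fderiv ℝ F y (vert L) ^ 2) := by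
      intro y
      rw [hkk, ← ENNReal.ofReal_mul hlam0.le, ← ENNReal.ofReal_mul (inv_pos.2 hlam0).le,
        ← ENNReal.ofReal_add (by positivity) (by positivity)]
    simp only [e]
    rw [lintegral_add_left (hFm.const_mul _), lintegral_const_mul _ hFm,
      lintegral_const_mul _ hdm]
    refine (add_le_add le_rfl (mul_le_mul_right (h.markov hF (norm_vert L)) _)).trans ?_
    rw [← mul_assoc, ← ENNReal.ofReal_mul (inv_pos.2 hlam0).le, ← hX, ← add_mul,
      ← ENNReal.ofReal_add hlam0.le (by positivity)]
    refine mul_le_mul_left (ENNReal.ofReal_le_ofReal (le_of_eq ?_)) _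
    rw [hlam]; field_simp; ring
  refine (setLIntegral_area_le hlip hrange hFm).trans ?_
  have h2 := h1.trans (add_le_add hfaces (add_le_add le_rfl hk))
  refine (mul_le_mul_right h2 _).trans (le_of_eq ?_)
  rw [← add_mul, ← add_mul, ← mul_assoc, ← ENNReal.ofReal_add (by positivity) (by positivity),
    ← ENNReal.ofReal_add (by positivity) (by positivity),
    show (((1 + C : ℝ≥0) : ℝ≥0∞)) ^ 2 = ENNReal.ofReal ((1 + C : ℝ) ^ 2) by
      rw [ENNReal.ofReal_pow (by positivity)]
      rw [← ENNReal.ofReal_coe_nnreal, NNReal.coe_add, NNReal.coe_one],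
    ← ENNReal.ofReal_mul (by positivity)]
  congr 2; ring

end Box.IsCore

/-! ### Compact Lipschitz surfaces -/

/-- Near each boundary point, `D` is the set below the graph of a Lipschitz function. -/
def IsLocallyGraph (D : Set E3) : Prop :=
  ∀ x ∈ frontier D, ∃ r L Ψ C, IsGraphChart D x r L Ψ C

lemma HasLipschitzBoundary.isLocallyGraph {D : Set E3} (hD : HasLipschitzBoundary D) :
    IsLocallyGraph D := by
  intro x hx
  obtain ⟨r, hr, L, Ψ, ⟨C, hC⟩, h⟩ := hD x hx
  exact ⟨r, L, Ψ, C, hr, hC, h⟩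

/-- A `C²` function is locally Lipschitz; its restriction to a ball is extended to the plane. -/
lemma HasC2Boundary.exists_chart {D : Set E3} (hD : HasC2Boundary D) {x : E3}
    (hx : x ∈ frontier D) :
    ∃ r L Ψ C, IsGraphChart D x r L Ψ C ∧ DifferentiableAt ℝ Ψ (proj L x) := by
  obtain ⟨r, hr, L, Ψ, hΨ, h⟩ := hD x hx
  have hΨ1 : ContDiffAt ℝ 1 Ψ (proj L x) := (hΨ.of_le (by norm_num)).contDiffAt
  obtain ⟨C, t, ht, hC⟩ := hΨ1.exists_lipschitzOnWith
  obtain ⟨g, hg, hgt⟩ := hC.extend_real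
  obtain ⟨e, he, hball⟩ := Metric.mem_nhds_iff.1 ht
  refine ⟨min r e, L, g, C, ⟨lt_min hr he, hg, fun y hy => ?_⟩, ?_⟩
  · have h1 : proj L y ∈ t := by
      refine hball ?_
      rw [Metric.mem_ball] at hy ⊢
      have := (lipschitzWith_proj L).dist_le_mul y x
      rw [NNReal.coe_one, one_mul] at this
      exact this.trans_lt (hy.trans_le (min_le_right _ _))
    rw [← hgt h1]
    exact h y (Metric.ball_subset_ball (min_le_left _ _) hy)
  · refine (hΨ1.differentiableAt one_ne_zero).congr_of_eventuallyEq ?_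
    filter_upwards [ht] with y hy using (hgt hy).symm

lemma HasC2Boundary.isLocallyGraph {D : Set E3} (hD : HasC2Boundary D) : IsLocallyGraph D := by
  intro x hx
  obtain ⟨r, L, Ψ, C, h, -⟩ := hD.exists_chart hx
  exact ⟨r, L, Ψ, C, h⟩

lemma isCompact_frontier_of_isBounded {D : Set E3} (hb : Bornology.IsBounded D) :
    IsCompact (frontier D) :=
  Metric.isCompact_of_isClosed_isBounded isClosed_frontier
    (hb.closure.subset frontier_subset_closure)

namespace IsLocallyGraph

variable {D : Set E3}

lemma exists_finite_cover (hD : IsLocallyGraph D) (hb : Bornology.IsBounded D) :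
    ∃ (s : Finset E3) (r : E3 → ℝ) (L : E3 → E3 ≃ₗᵢ[ℝ] E3) (Ψ : E3 → E2 → ℝ) (C : E3 → ℝ≥0),
      (∀ x ∈ s, IsGraphChart D x (r x) (L x) (Ψ x) (C x)) ∧
        frontier D ⊆ ⋃ x ∈ s, Metric.ball x (r x / 2) := by
  have h : ∀ x : E3, ∃ r L Ψ C, x ∈ frontier D → IsGraphChart D x r L Ψ C := by
    intro x
    by_cases hx : x ∈ frontier D
    · obtain ⟨r, L, Ψ, C, h⟩ := hD x hx
      exact ⟨r, L, Ψ, C, fun _ => h⟩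
    · exact ⟨0, LinearIsometryEquiv.refl _ _, 0, 0, fun h => absurd h hx⟩
  choose r L Ψ C h using h
  obtain ⟨s, hs, hcov⟩ := (isCompact_frontier_of_isBounded hb).elim_nhds_subcover
    (fun x => Metric.ball x (r x / 2))
    fun x hx => Metric.ball_mem_nhds _ (half_pos (h x hx).pos)
  exact ⟨s, r, L, Ψ, C, fun x hx => h x (hs x hx), hcov⟩

/-- The trace inequality on the part of the surface `frontier D` in a box, with a constant that
does not depend on the box. -/
theorem exists_trace_const (hD : IsLocallyGraph D) (hb : Bornology.IsBounded D) :
    ∃ c : ℝ, 0 < c ∧ ∀ (K : Box) (m : ℝ) (Q : Set E3) (A : E3) (n : ℕ) (F : E3 → ℝ),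
      K.IsCore m Q A → PolyOnLines n F → K.carrier ∩ D ⊆ Q →
      ∫⁻ y in K.carrier ∩ frontier D, ENNReal.ofReal (F y ^ 2) ∂area ≤
        ENNReal.ofReal (c * (1 + (n + 2 : ℝ) ^ 2 / m)) * ∫⁻ y in Q, ENNReal.ofReal (F y ^ 2) := by
  obtain ⟨s, r, L, Ψ, C, hs, hcov⟩ := hD.exists_finite_cover hb
  have hterm : ∀ x ∈ s, (0 : ℝ) ≤ (1 + C x) ^ 2 * (2 / r x + 133) := fun x hx => by
    have := (hs x hx).pos
    positivity
  refine ⟨∑ x ∈ s, (1 + C x : ℝ) ^ 2 * (2 / r x + 133) + 1,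
    add_pos_of_nonneg_of_pos (Finset.sum_nonneg hterm) one_pos, ?_⟩
  intro K m Q A n F hK hF hKQ
  have hm := hK.pos
  set X := ∫⁻ y in Q, ENNReal.ofReal (F y ^ 2)
  have hsub : K.carrier ∩ frontier D ⊆
      ⋃ x ∈ s, K.carrier ∩ frontier D ∩ Metric.ball x (r x / 2) := by
    intro y hy
    have := hcov hy.2
    simp only [Set.mem_iUnion] at this ⊢
    obtain ⟨x, hx, hxy⟩ := this
    exact ⟨x, hx, hy, hxy⟩
  have hone : ∀ x ∈ s, ∫⁻ y in K.carrier ∩ frontier D ∩ Metric.ball x (r x / 2),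
      ENNReal.ofReal (F y ^ 2) ∂area ≤
        ENNReal.ofReal ((1 + C x : ℝ) ^ 2 * (2 / r x + 133) * (1 + (n + 2 : ℝ) ^ 2 / m)) * X := by
    intro x hx
    refine (hK.graph_trace hF (hs x hx) hKQ).trans ?_
    gcongr ENNReal.ofReal ?_ * _
    rw [mul_assoc]
    have := (hs x hx).pos
    refine mul_le_mul_of_nonneg_left ?_ (by positivity)
    have h1 : 0 ≤ 2 / r x := by positivity
    have h2 : 0 ≤ (n + 2 : ℝ) ^ 2 / m := by positivity
    have h3 : 133 * (n + 2 : ℝ) ^ 2 / m = 133 * ((n + 2 : ℝ) ^ 2 / m) := by ring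
    rw [h3]
    nlinarith [mul_nonneg h1 h2]
  calc ∫⁻ y in K.carrier ∩ frontier D, ENNReal.ofReal (F y ^ 2) ∂area
      ≤ ∫⁻ y in ⋃ x ∈ s, K.carrier ∩ frontier D ∩ Metric.ball x (r x / 2),
          ENNReal.ofReal (F y ^ 2) ∂area := lintegral_mono_set hsub
    _ ≤ ∑ x ∈ s, ∫⁻ y in K.carrier ∩ frontier D ∩ Metric.ball x (r x / 2),
          ENNReal.ofReal (F y ^ 2) ∂area := by
        rw [← Finset.sum_coe_sort s (fun x =>
          ∫⁻ y in K.carrier ∩ frontier D ∩ Metric.ball x (r x / 2), ENNReal.ofReal (F y ^ 2) ∂area),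
          ← Finset.set_biUnion_coe, Set.biUnion_eq_iUnion]
        refine (lintegral_iUnion_le _ _).trans (le_of_eq ?_)
        exact tsum_fintype _
    _ ≤ ∑ x ∈ s, ENNReal.ofReal ((1 + C x : ℝ) ^ 2 * (2 / r x + 133) *
          (1 + (n + 2 : ℝ) ^ 2 / m)) * X := Finset.sum_le_sum hone
    _ = ENNReal.ofReal (∑ x ∈ s, (1 + C x : ℝ) ^ 2 * (2 / r x + 133) *
          (1 + (n + 2 : ℝ) ^ 2 / m)) * X := by
        rw [← Finset.sum_mul, ENNReal.ofReal_sum_of_nonneg]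
        exact fun x hx => mul_nonneg (hterm x hx) (by positivity)
    _ ≤ _ := by
        gcongr ENNReal.ofReal ?_ * _
        rw [← Finset.sum_mul]
        gcongr
        linarith

lemma area_frontier_lt_top (hD : IsLocallyGraph D) (hb : Bornology.IsBounded D) :
    area (frontier D) < ⊤ := by
  obtain ⟨s, r, L, Ψ, C, hs, hcov⟩ := hD.exists_finite_cover hb
  have hsub : frontier D ⊆ ⋃ x ∈ s, frontier D ∩ Metric.ball x (r x / 2) := by
    intro y hy
    have := hcov hy
    simp only [Set.mem_iUnion] at this ⊢
    obtain ⟨x, hx, hxy⟩ := this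
    exact ⟨x, hx, hy, hxy⟩
  refine (measure_mono hsub).trans_lt ((measure_biUnion_finset_le _ _).trans_lt ?_)
  refine ENNReal.sum_lt_top.2 fun x hx => ?_
  have hr := (hs x hx).pos
  have h1 : frontier D ∩ Metric.ball x (r x / 2) ⊆
      (fun z => chart (L x) z (Ψ x z)) '' Metric.closedBall (proj (L x) x) (r x) := by
    rintro y ⟨hy, hyb⟩
    have hyb' : y ∈ Metric.ball x (r x) := Metric.ball_subset_ball (by linarith) hyb
    refine ⟨proj (L x) y, ?_, (hs x hx).frontier_subset_range hyb' hy⟩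
    have := (lipschitzWith_proj (L x)).dist_le_mul y x
    rw [NNReal.coe_one, one_mul] at this
    exact this.trans (Metric.mem_ball.1 hyb').le
  refine (measure_mono h1).trans_lt
    ((area_image_le (lipschitzWith_graph (L x) (hs x hx).lipschitz) _).trans_lt ?_)
  rw [EuclideanSpace.euclideanHausdorffMeasure_eq_volume]
  exact ENNReal.mul_lt_top (by simp) measure_closedBall_lt_top

end IsLocallyGraph

lemma volume_eq_zero_of_area_lt_top {s : Set E3} (hs : area s < ⊤) : volume s = 0 := by
  rw [← EuclideanSpace.euclideanHausdorffMeasure_eq_volume 3]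
  exact (Measure.euclideanHausdorffMeasure_zero_or_top (by norm_num : 2 < 3) s).resolve_right hs.ne

/-! ### Unit normals -/

section Normals

variable {D : Set E3} {x n w : E3}

lemma tendsto_line (x w : E3) : Tendsto (fun t : ℝ => x + t • w) (𝓝[>] 0) (𝓝 x) := by
  have : Continuous fun t : ℝ => x + t • w := by fun_prop
  have := (this.tendsto 0).mono_left (nhdsWithin_le_nhds (s := Set.Ioi 0))
  simpa using this

lemma IsOuterNormal.eventually_mem (h : IsOuterNormal D x n) (hw : inner ℝ w n < 0) :
    ∀ᶠ t in 𝓝[>] (0 : ℝ), x + t • w ∈ D := by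
  have hw0 : w ≠ 0 := fun h0 => by simp [h0] at hw
  have hw1 : 0 < ‖w‖ := norm_pos_iff.2 hw0
  have hk : 0 < -inner ℝ w n / (2 * ‖w‖) := div_pos (neg_pos.2 hw) (by positivity)
  filter_upwards [(tendsto_line x w).eventually (h.2 _ hk), self_mem_nhdsWithin] with t ht ht0
  refine ht.1 ?_
  have ht0 : 0 < t := ht0
  rw [add_sub_cancel_left, inner_smul_left, norm_smul, Real.norm_eq_abs, abs_of_pos ht0]
  simp only [conj_trivial]
  have : -(-inner ℝ w n / (2 * ‖w‖) * (t * ‖w‖)) = t * inner ℝ w n / 2 := by field_simp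
  rw [this]
  nlinarith

lemma IsOuterNormal.eventually_notMem (h : IsOuterNormal D x n) (hw : 0 < inner ℝ w n) :
    ∀ᶠ t in 𝓝[>] (0 : ℝ), x + t • w ∉ closure D := by
  have hw0 : w ≠ 0 := fun h0 => by simp [h0] at hw
  have hw1 : 0 < ‖w‖ := norm_pos_iff.2 hw0
  have hk : 0 < inner ℝ w n / (2 * ‖w‖) := div_pos hw (by positivity)
  filter_upwards [(tendsto_line x w).eventually (h.2 _ hk).eventually_nhds, self_mem_nhdsWithin]
    with t ht ht0 hcl
  have ht0 : 0 < t := ht0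
  have hopen : ∀ᶠ y in 𝓝 (x + t • w), inner ℝ w n / (2 * ‖w‖) * ‖y - x‖ < inner ℝ (y - x) n := by
    refine (isOpen_lt (by fun_prop) (by fun_prop)).mem_nhds ?_
    simp only [Set.mem_ofPred_eq]
    rw [add_sub_cancel_left, inner_smul_left, norm_smul, Real.norm_eq_abs, abs_of_pos ht0]
    simp only [conj_trivial]
    have : inner ℝ w n / (2 * ‖w‖) * (t * ‖w‖) = t * inner ℝ w n / 2 := by field_simp
    rw [this]
    nlinarith
  have hn : ∀ᶠ y in 𝓝 (x + t • w), y ∉ D := by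
    filter_upwards [ht, hopen] with y hy hy' using hy.2 hy'
  exact (mem_closure_iff_frequently.1 hcl) hn

lemma IsOuterNormal.unique {n' : E3} (h : IsOuterNormal D x n) (h' : IsOuterNormal D x n') :
    n = n' := by
  by_contra hne
  have hlt : inner ℝ n n' < 1 := (inner_lt_one_iff_real_of_norm_eq_one h.1 h'.1).2 hne
  have h1 : inner ℝ (n' - n) n < 0 := by
    rw [inner_sub_left, real_inner_self_eq_norm_sq, h.1, real_inner_comm]
    linarith
  have h2 : 0 < inner ℝ (n' - n) n' := by
    rw [inner_sub_left, real_inner_self_eq_norm_sq, h'.1]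
    linarith
  obtain ⟨t, ht1, ht2⟩ := ((h.eventually_mem h1).and (h'.eventually_notMem h2)).exists
  exact ht2 (subset_closure ht1)

lemma IsOuterNormal.outerNormal_eq (h : IsOuterNormal D x n) : outerNormal D x = n := by
  have hex : ∃ n, IsOuterNormal D x n := ⟨n, h⟩
  rw [outerNormal, dif_pos hex]
  exact hex.choose_spec.unique h

lemma isOuterNormal_outerNormal (h : outerNormal D x ≠ 0) :
    IsOuterNormal D x (outerNormal D x) := by
  by_cases hex : ∃ n, IsOuterNormal D x n
  · obtain ⟨n, hn⟩ := hex
    rwa [hn.outerNormal_eq]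
  · rw [outerNormal, dif_neg hex] at h
    exact absurd rfl h

lemma norm_outerNormal_le (D : Set E3) (x : E3) : ‖outerNormal D x‖ ≤ 1 := by
  by_cases h : outerNormal D x = 0
  · rw [h, norm_zero]; exact zero_le_one
  · exact (isOuterNormal_outerNormal h).1.le

/-- The pairs of a point and a unit outer normal form a Borel set, as the definition can be
written with countably many closed conditions. -/
lemma measurableSet_isOuterNormal (D : Set E3) :
    MeasurableSet {p : E3 × E3 | IsOuterNormal D p.1 p.2} := by
  set C : ℕ → ℕ → Set (E3 × E3) := fun i k => {p | ∀ y, dist y p.1 < 1 / (k + 1 : ℝ) →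
    (inner ℝ (y - p.1) p.2 < -(1 / (i + 1 : ℝ) * ‖y - p.1‖) → y ∈ D) ∧
    (1 / (i + 1 : ℝ) * ‖y - p.1‖ < inner ℝ (y - p.1) p.2 → y ∉ D)} with hC
  have hclosed : ∀ i k, IsClosed (C i k) := by
    intro i k
    simp only [hC, Set.ofPred_forall]
    refine isClosed_iInter fun y => ?_
    rw [← isOpen_compl_iff]
    have h1 : IsOpen {p : E3 × E3 | dist y p.1 < 1 / (k + 1 : ℝ)} :=
      isOpen_lt (by fun_prop) (by fun_prop)
    have h2 : IsOpen {p : E3 × E3 | inner ℝ (y - p.1) p.2 < -(1 / (i + 1 : ℝ) * ‖y - p.1‖)} :=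
      isOpen_lt (by fun_prop) (by fun_prop)
    have h3 : IsOpen {p : E3 × E3 | 1 / (i + 1 : ℝ) * ‖y - p.1‖ < inner ℝ (y - p.1) p.2} :=
      isOpen_lt (by fun_prop) (by fun_prop)
    by_cases hy : y ∈ D
    · convert h1.inter h3 using 1
      ext p; simp [hy]
    · convert h1.inter h2 using 1
      ext p; simp [hy]
  have e : {p : E3 × E3 | IsOuterNormal D p.1 p.2} =
      {p | ‖p.2‖ = 1} ∩ ⋂ i, ⋃ k, C i k := by
    ext ⟨x, n⟩
    simp only [IsOuterNormal, Set.mem_ofPred_eq, Set.mem_inter_iff, Set.mem_iInter, Set.mem_iUnion,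
      hC]
    refine and_congr_right fun _ => ⟨fun h i => ?_, fun h κ hκ => ?_⟩
    · obtain ⟨e, he, hball⟩ := Metric.eventually_nhds_iff.1 (h (1 / (i + 1 : ℝ)) (by positivity))
      obtain ⟨k, hk⟩ := exists_nat_one_div_lt he
      exact ⟨k, fun y hy => hball (hy.trans hk)⟩
    · obtain ⟨i, hi⟩ := exists_nat_one_div_lt hκ
      obtain ⟨k, hk⟩ := h i
      refine Metric.eventually_nhds_iff.2 ⟨1 / (k + 1 : ℝ), by positivity, fun y hy => ?_⟩
      have hle : 1 / (i + 1 : ℝ) * ‖y - x‖ ≤ κ * ‖y - x‖ :=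
        mul_le_mul_of_nonneg_right hi.le (norm_nonneg _)
      exact ⟨fun h => (hk y hy).1 (by linarith), fun h => (hk y hy).2 (by linarith)⟩
  rw [e]
  refine MeasurableSet.inter (isClosed_eq (by fun_prop) continuous_const).measurableSet ?_
  exact MeasurableSet.iInter fun i => MeasurableSet.iUnion fun k => (hclosed i k).measurableSet

/-- The graph of the normal is Borel and its projection to the points is injective, so that
preimages are images of Borel sets under injective continuous maps (Lusin–Souslin). -/
lemma measurable_outerNormal (D : Set E3) : Measurable (outerNormal D) := by
  set N := {p : E3 × E3 | IsOuterNormal D p.1 p.2} with hN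
  have hNm := measurableSet_isOuterNormal D
  have himage : ∀ B : Set E3, MeasurableSet B →
      MeasurableSet (Prod.fst '' (N ∩ Prod.snd ⁻¹' B)) := by
    intro B hB
    refine (hNm.inter (measurable_snd hB)).image_of_continuousOn_injOn
      continuous_fst.continuousOn ?_
    rintro ⟨x, n⟩ ⟨hn, -⟩ ⟨x', n'⟩ ⟨hn', -⟩ (rfl : x = x')
    rw [show n = n' from IsOuterNormal.unique hn hn']
  intro B hB
  have hS := himage Set.univ MeasurableSet.univ
  have e : outerNormal D ⁻¹' B = Prod.fst '' (N ∩ Prod.snd ⁻¹' B) ∪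
      ((Prod.fst '' (N ∩ Prod.snd ⁻¹' Set.univ))ᶜ ∩ {_x | (0 : E3) ∈ B}) := by
    ext x
    by_cases hex : ∃ n, IsOuterNormal D x n
    · obtain ⟨n, hn⟩ := hex
      have hx : x ∈ Prod.fst '' (N ∩ Prod.snd ⁻¹' Set.univ) := ⟨(x, n), ⟨hn, trivial⟩, rfl⟩
      constructor
      · intro hB'
        refine Or.inl ⟨(x, n), ⟨hn, ?_⟩, rfl⟩
        rw [← hn.outerNormal_eq]; exact hB'
      · rintro (⟨⟨x', n'⟩, ⟨hn', hB'⟩, rfl⟩ | ⟨h, -⟩)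
        · have h1 : outerNormal D x' = n' := IsOuterNormal.outerNormal_eq hn'
          change outerNormal D x' ∈ B
          rw [h1]; exact hB'
        · exact absurd hx h
    · have hx : ∀ B : Set E3, x ∉ Prod.fst '' (N ∩ Prod.snd ⁻¹' B) := by
        rintro B ⟨⟨x', n'⟩, ⟨hn', -⟩, rfl⟩
        exact hex ⟨n', hn'⟩
      have h0 : outerNormal D x = 0 := dif_neg hex
      simp only [Set.mem_preimage, h0, Set.mem_union, hx, false_or, Set.mem_inter_iff,
        Set.mem_compl_iff, not_false_eq_true, true_and, Set.mem_ofPred_eq]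
  rw [e]
  refine (himage B hB).union (hS.compl.inter ?_)
  by_cases h0 : (0 : E3) ∈ B <;> simp [h0]

/-- A `C²` surface has a unit normal everywhere: minus the normalised gradient of the height
`φ` of the graph above a point. -/
lemma HasC2Boundary.outerNormal_ne_zero (hD : HasC2Boundary D) (hx : x ∈ frontier D) :
    outerNormal D x ≠ 0 := by
  obtain ⟨r, L, Ψ, C, h, hd⟩ := hD.exists_chart hx
  set φ : E3 → ℝ := fun y => Ψ (proj L y) - (L y) 2 with hφ
  have hpd : Differentiable ℝ (proj L) := by
    rw [differentiable_euclidean]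
    intro i
    fin_cases i <;> simp [proj] <;> fun_prop
  have hφd : DifferentiableAt ℝ φ x := by
    refine DifferentiableAt.sub (DifferentiableAt.comp x hd (hpd x)) ?_
    fun_prop
  have hφ0 : φ x = 0 := by
    rw [hφ]
    exact sub_eq_zero.2 (h.frontier_eq (Metric.mem_ball_self h.pos) hx).symm
  set v := gradient φ x with hv
  have hgrad : HasGradientAt φ v x := hφd.hasGradientAt
  -- the vertical derivative of `φ` is `-1`
  have hv0 : v ≠ 0 := by
    intro h0
    have h1 : HasDerivAt (fun t : ℝ => φ (x - t • vert L)) (inner ℝ v (-vert L)) 0 := by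
      have hl : HasDerivAt (fun t : ℝ => x - t • vert L) (-vert L) 0 := by
        simpa using ((hasDerivAt_id (0 : ℝ)).smul_const (vert L)).const_sub x
      have hf := hgrad.hasFDerivAt
      have : HasFDerivAt φ (InnerProductSpace.toDual ℝ E3 v) (x - (0 : ℝ) • vert L) := by
        simpa using hf
      exact this.comp_hasDerivAt (0 : ℝ) hl
    have h2 : (fun t : ℝ => φ (x - t • vert L)) = fun t => φ x + t := by
      funext t
      have e : x - t • vert L = chart L (proj L x) ((L x) 2 - t) := by
        rw [chart_sub_smul_vert, chart_proj]
      simp only [hφ]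
      rw [e, proj_chart, chart_two]; ring
    rw [h2, h0, inner_zero_left] at h1
    have h3 : HasDerivAt (fun t : ℝ => φ x + t) 1 0 := (hasDerivAt_id (0 : ℝ)).const_add _
    exact zero_ne_one (h1.unique h3)
  have hv1 : 0 < ‖v‖ := norm_pos_iff.2 hv0
  have hn : IsOuterNormal D x (-(‖v‖⁻¹ • v)) := by
    refine ⟨by rw [norm_neg, norm_smul, norm_inv, norm_norm, inv_mul_cancel₀ hv1.ne'], ?_⟩
    intro κ hκ
    have hlit := (hasGradientAt_iff_isLittleO.1 hgrad).def (c := κ * ‖v‖) (by positivity)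
    filter_upwards [hlit, Metric.ball_mem_nhds x h.pos] with y hy hyb
    rw [hφ0, sub_zero, Real.norm_eq_abs] at hy
    have hin : inner ℝ (y - x) (-(‖v‖⁻¹ • v)) = -(‖v‖⁻¹ * inner ℝ v (y - x)) := by
      rw [inner_neg_right, inner_smul_right, real_inner_comm]
    rw [hin]
    have hi : inner ℝ v (y - x) = ‖v‖ * (‖v‖⁻¹ * inner ℝ v (y - x)) := by
      rw [← mul_assoc, mul_inv_cancel₀ hv1.ne', one_mul]
    have hmem : y ∈ D ↔ 0 < φ y := by rw [h.iff y hyb, hφ]; exact sub_pos.symm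
    rw [hmem, not_lt]
    rw [hi] at hy
    obtain ⟨hy1, hy2⟩ := abs_le.1 hy
    set a := ‖v‖⁻¹ * inner ℝ v (y - x)
    constructor
    · intro hlt
      have := mul_lt_mul_of_pos_left (neg_lt_neg_iff.1 hlt) hv1
      nlinarith
    · intro hlt
      have := mul_lt_mul_of_pos_left hlt hv1
      nlinarith
  rw [hn.outerNormal_eq, neg_ne_zero]
  exact smul_ne_zero (inv_ne_zero hv1.ne') hv0

end Normals

/-! ### Null sets in coordinate planes -/

/-- A Borel set in a coordinate plane whose points are isolated from one side in a coordinate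
direction has area zero. -/
lemma area_eq_zero_of_isolated {B : Set E3} (hB : MeasurableSet B) {j k : Fin 3} (hjk : k ≠ j)
    {c : ℝ} (hc : ∀ x ∈ B, x j = c)
    (h : ∀ x ∈ B, ∀ᶠ t in 𝓝[>] (0 : ℝ), x + t • EuclideanSpace.single k (1 : ℝ) ∉ B) :
    area B = 0 := by
  set L := axisFrame j
  set e : E3 := EuclideanSpace.single k (1 : ℝ) with he
  set g : E2 → E3 := fun x => chart L x c with hg
  have hlip : LipschitzWith 1 g := lipschitzWith_chart_const L c
  have hrange : B ⊆ Set.range g := fun y hy => ⟨proj L y, by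
    have := chart_proj L y
    rw [axisFrame_two, hc y hy] at this
    exact this⟩
  have h1 := setLIntegral_area_le hlip hrange (f := fun _ => 1) measurable_const
  simp only [lintegral_one, Measure.restrict_apply_univ] at h1
  have he2 : chart L (proj L e) 0 = e := by
    have := chart_proj L e
    rw [axisFrame_two] at this
    simpa [he, PiLp.single_apply, hjk.symm] using this
  have hshift : ∀ (x : E2) (t : ℝ), g (x + t • proj L e) = g x + t • e := by
    intro x t
    have := chart_add L x (t • proj L e) c 0
    rw [add_zero] at this
    rw [hg]
    simp only [this]
    have h3 := chart_smul L (proj L e) 0 t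
    rw [mul_zero, he2] at h3
    rw [h3]
  have hgB : MeasurableSet (g ⁻¹' B) := hlip.continuous.measurable hB
  -- On each line in the direction the set is countable, as its points are isolated from the right.
  have h2 : ∀ᵐ y : E2, y ∈ (g ⁻¹' B)ᶜ := by
    refine ae_mem_of_ae_add_linearMap_mem (LinearMap.toSpanSingleton ℝ E2 (proj L e))
      (volume : Measure ℝ) (volume : Measure E2) hgB.compl fun y => ?_
    set s : Set ℝ := {t | g y + t • e ∈ B} with hs
    have hcount : s.Countable := by
      refine (countable_setOfPred_isolated_right_within (s := s)).mono ?_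
      intro t ht
      refine ⟨ht, ?_⟩
      have hev := h _ ht
      rw [← Filter.empty_mem_iff_bot, Set.inter_comm, nhdsWithin_inter', Filter.mem_inf_principal]
      have htend : Tendsto (fun u : ℝ => u - t) (𝓝[>] t) (𝓝[>] 0) := by
        refine tendsto_nhdsWithin_iff.2 ⟨?_, ?_⟩
        · have : Continuous fun u : ℝ => u - t := by fun_prop
          have := (this.tendsto t).mono_left (nhdsWithin_le_nhds (s := Set.Ioi t))
          simpa using this
        · filter_upwards [self_mem_nhdsWithin] with u hu using Set.mem_Ioi.2 (sub_pos.2 (Set.mem_Ioi.1 hu))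
      filter_upwards [htend.eventually hev] with u hu hus
      refine hu ?_
      have e1 : g y + t • e + (u - t) • e = g y + u • e := by rw [add_assoc, ← add_smul]; congr 2; ring
      rw [e1]
      exact hus
    filter_upwards [hcount.ae_notMem volume] with t ht
    simp only [Set.mem_compl_iff, Set.mem_preimage, LinearMap.toSpanSingleton_apply, hshift]
    exact ht
  have h3 : volume (g ⁻¹' B) = 0 := by
    have := ae_iff.1 h2
    simp only [Set.mem_compl_iff, not_not] at this
    exact this
  rw [h3, mul_zero] at h1
  exact le_antisymm h1 bot_le

lemma area_coord_line {j k : Fin 3} (hjk : k ≠ j) (c d : ℝ) :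
    area {x : E3 | x j = c ∧ x k = d} = 0 := by
  refine area_eq_zero_of_isolated (j := j) (k := k) (c := c) ?_ hjk (fun x hx => hx.1) ?_
  · exact ((isClosed_eq (by fun_prop) continuous_const).inter
      (isClosed_eq (by fun_prop) continuous_const)).measurableSet
  · rintro x ⟨-, hx⟩
    filter_upwards [self_mem_nhdsWithin] with t ht
    rintro ⟨-, h⟩
    have ht : 0 < t := ht
    simp [hx] at h
    exact ht.ne' h

/-- Where a surface touches a coordinate plane, its normal is almost everywhere the normal of the
plane. -/
lemma area_tangential {D : Set E3} (hD : IsOpen D) {j k : Fin 3} (hjk : k ≠ j) (c : ℝ) :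
    area {x ∈ frontier D | x j = c ∧ outerNormal D x k ≠ 0} = 0 := by
  refine area_eq_zero_of_isolated (j := j) (k := k) (c := c) ?_ hjk (fun x hx => hx.2.1) ?_
  · refine isClosed_frontier.measurableSet.inter
      ((isClosed_eq (by fun_prop) continuous_const).measurableSet.inter ?_)
    have h1 : Measurable fun x => outerNormal D x k :=
      ((by fun_prop : Continuous fun y : E3 => y k).measurable).comp (measurable_outerNormal D)
    exact (h1 (measurableSet_singleton 0)).compl
  · rintro x ⟨-, -, hx⟩
    have hn : IsOuterNormal D x (outerNormal D x) :=
      isOuterNormal_outerNormal fun h0 => hx (by rw [h0]; rfl)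
    have hin : inner ℝ (EuclideanSpace.single k (1 : ℝ)) (outerNormal D x) = outerNormal D x k := by
      rw [EuclideanSpace.inner_single_left]; simp
    rcases lt_or_gt_of_ne hx with h | h
    · filter_upwards [hn.eventually_mem (hin.trans_lt h)] with t ht hcon
      have := hcon.1.2
      rw [hD.interior_eq] at this
      exact this ht
    · filter_upwards [hn.eventually_notMem (h.trans_eq hin.symm)] with t ht hcon
      exact ht hcon.1.1

/-! ### Measurability of one-sidedness -/

/-- The condition that the ray from a point in a direction starts in an open set is Borel. -/
lemma measurableSet_eventually_ray {U : Set E3} (hU : IsOpen U) :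
    MeasurableSet {p : E3 × E3 | ∀ᶠ t in 𝓝[>] (0 : ℝ), p.1 + t • p.2 ∈ U} := by
  have hopen : ∀ a b : ℝ, IsOpen {p : E3 × E3 | ∀ t ∈ Set.Icc a b, p.1 + t • p.2 ∈ U} := by
    intro a b
    refine isOpen_iff_mem_nhds.2 fun p hp => ?_
    refine isCompact_Icc.eventually_forall_of_forall_eventually fun t ht => ?_
    have hc : Continuous fun z : (E3 × E3) × ℝ => z.1.1 + z.2 • z.1.2 := by fun_prop
    exact (hU.preimage hc).mem_nhds (hp t ht)
  have e : {p : E3 × E3 | ∀ᶠ t in 𝓝[>] (0 : ℝ), p.1 + t • p.2 ∈ U} =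
      ⋃ k : ℕ, ⋂ m : ℕ, {p : E3 × E3 | ∀ t ∈ Set.Icc (1 / (m + 1 : ℝ)) (1 / (k + 1 : ℝ)),
        p.1 + t • p.2 ∈ U} := by
    ext p
    simp only [Set.mem_ofPred_eq, Set.mem_iUnion, Set.mem_iInter]
    constructor
    · intro h
      obtain ⟨u, hu, hsub⟩ := mem_nhdsGT_iff_exists_Ioo_subset.1 h
      obtain ⟨k, hk⟩ := exists_nat_one_div_lt (show (0 : ℝ) < u from hu)
      refine ⟨k, fun m t ht => hsub ⟨lt_of_lt_of_le (by positivity) ht.1, ht.2.trans_lt hk⟩⟩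
    · rintro ⟨k, hk⟩
      refine mem_nhdsGT_iff_exists_Ioo_subset.2 ⟨1 / (k + 1 : ℝ), Set.mem_Ioi.2 (by positivity), fun t ht => ?_⟩
      obtain ⟨m, hm⟩ := exists_nat_one_div_lt ht.1
      exact hk m t ⟨hm.le, ht.2.le⟩
  rw [e]
  exact MeasurableSet.iUnion fun k => MeasurableSet.iInter fun m => (hopen _ _).measurableSet

/-! ### Cores of cut elements -/

lemma Convex.subset_of_disjoint_frontier {C D : Set E3} (hC : Convex ℝ C) (hD : IsOpen D)
    (hne : (C ∩ D).Nonempty) (hCD : Disjoint C (frontier D)) : C ⊆ D := by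
  refine hC.isPreconnected.subset_of_closure_inter_subset hD hne ?_
  rintro x ⟨hx, hxC⟩
  by_contra hxD
  exact Set.disjoint_left.1 hCD hxC ⟨hx, by rwa [hD.interior_eq]⟩

lemma volume_level_set {n : E3} (hn : n ≠ 0) (c : ℝ) : volume {x : E3 | inner ℝ n x = c} = 0 := by
  have hsurj : Function.Surjective (innerSL ℝ n) := by
    intro y
    refine ⟨(y / ‖n‖ ^ 2) • n, ?_⟩
    have : ‖n‖ ≠ 0 := norm_ne_zero_iff.2 hn
    rw [innerSL_apply_apply, inner_smul_right, real_inner_self_eq_norm_sq]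
    field_simp
  have h := (innerSL ℝ n).frontier_preimage hsurj (Set.Iic c)
  rw [frontier_Iic] at h
  have e : {x : E3 | inner ℝ n x = c} = (innerSL ℝ n) ⁻¹' {c} := rfl
  rw [e, ← h]
  exact ((convex_Iic c).linear_preimage (innerSL ℝ n).toLinearMap).addHaar_frontier volume

lemma T_le_ten {t : ℝ} (ht : 1 ≤ t) (ht5 : t ≤ 5) : T t ≤ 10 := by
  have : √(t ^ 2 - 1) ≤ 5 := Real.sqrt_le_iff.2 ⟨by norm_num, by nlinarith⟩
  rw [T]; linarith

namespace Box

variable (K : Box)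

lemma h_pos : 0 < K.h := by
  rw [h]
  refine dist_pos.2 fun e => ?_
  have := K.lt 0
  rw [e] at this
  exact lt_irrefl _ this

lemma vertex_mem (c : Fin 3 → Bool) : K.vertex c ∈ closure K.carrier := by
  rw [closure_carrier]
  intro i
  have := (K.lt i).le
  simp only [vertex]
  cases c i <;> simp [this]

lemma vertex_update (c : Fin 3 → Bool) (j : Fin 3) (s : ℝ) :
    AffineMap.lineMap (K.vertex (Function.update c j false))
      (K.vertex (Function.update c j true)) s =
    K.vertex c + ((if c j then s - 1 else s) * (K.hi j - K.lo j)) •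
      EuclideanSpace.single j (1 : ℝ) := by
  ext i
  rw [AffineMap.lineMap_apply_module']
  by_cases hi : i = j
  · subst hi
    cases h : c i <;> simp [vertex, h] <;> ring
  · cases h : c j <;> simp [vertex, hi]

/-- On each edge at a vertex in `D`, a part of fixed relative length lies in `D`; in particular
there is a point at a fixed relative distance from the vertex. -/
lemma IsLarge.exists_mem {δ₀ : ℝ} {D : Set E3} (hδ : 0 < δ₀) (h : K.IsLarge δ₀ D)
    {c : Fin 3 → Bool} (hc : K.vertex c ∈ D) (j : Fin 3) :
    ∃ t : ℝ, δ₀ / 2 * (K.hi j - K.lo j) ≤ |t| ∧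
      K.vertex c + t • EuclideanSpace.single j (1 : ℝ) ∈ D ∩ closure K.carrier := by
  have hl := sub_pos.2 (K.lt j)
  have hs0 : AffineMap.lineMap (K.vertex (Function.update c j false))
      (K.vertex (Function.update c j true)) (if c j then (1 : ℝ) else 0) = K.vertex c := by
    rw [vertex_update]; cases c j <;> simp
  have hne : (K.edge j c ∩ D).Nonempty := by
    refine ⟨K.vertex c, ?_, hc⟩
    rw [edge, segment_eq_image_lineMap]
    refine ⟨_, ?_, hs0⟩
    cases c j <;> simp
  have hfrac := h j c hne
  by_contra hcon
  push Not at hcon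
  have hsub : {s : ℝ | s ∈ Set.Icc (0 : ℝ) 1 ∧
      AffineMap.lineMap (K.vertex (Function.update c j false))
      (K.vertex (Function.update c j true)) s ∈ D} ⊆
      Set.Icc (if c j then 1 - δ₀ / 2 else 0) (if c j then 1 else δ₀ / 2) := by
    rintro s ⟨hs, hsD⟩
    have hscl : AffineMap.lineMap (K.vertex (Function.update c j false))
      (K.vertex (Function.update c j true)) s ∈ closure K.carrier :=
      K.convex_carrier.closure.lineMap_mem (K.vertex_mem _) (K.vertex_mem _) hs
    rw [vertex_update] at hsD hscl
    have hlt : |(if c j then s - 1 else s) * (K.hi j - K.lo j)| <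
        δ₀ / 2 * (K.hi j - K.lo j) := by
      by_contra h'
      exact hcon _ (not_lt.1 h') ⟨hsD, hscl⟩
    rw [abs_mul, abs_of_pos hl] at hlt
    have hlt := lt_of_mul_lt_mul_right hlt hl.le
    cases hcj : c j
    · simp only [hcj, Bool.false_eq_true, if_false] at hlt ⊢
      rw [abs_of_nonneg hs.1] at hlt
      exact ⟨hs.1, hlt.le⟩
    · simp only [hcj, if_true] at hlt ⊢
      rw [abs_of_nonpos (by linarith [hs.2])] at hlt
      exact ⟨by linarith, hs.2⟩
  have h2 := hfrac.trans (measure_mono hsub)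
  rw [Real.volume_Icc] at h2
  have h3 : δ₀ ≤ δ₀ / 2 := by
    refine (ENNReal.ofReal_le_ofReal_iff (by positivity)).1 (h2.trans (le_of_eq ?_))
    congr 1
    cases c j <;> simp
  linarith

/-- The box itself is a core. -/
lemma isCore_closure {m : ℝ} (hm : 0 < m) (hmK : ∀ j, m ≤ K.hi j - K.lo j) :
    K.IsCore m (closure K.carrier) K.lo := by
  have hlo : K.lo ∈ closure K.carrier := by
    rw [closure_carrier]
    exact fun i => ⟨le_rfl, (K.lt i).le⟩
  refine ⟨hm, K.isCompact_closure_carrier, K.convex_carrier.closure, subset_rfl, hlo,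
    fun j => ⟨false, by simp [side]⟩, fun j => ⟨K.hi j - K.lo j, ?_, ?_⟩⟩
  · exact (hmK j).trans (le_abs_self _)
  · rw [closure_carrier]
    intro i
    have := (K.lt i).le
    by_cases hi : i = j
    · subst hi; simp [this]
    · simp [hi, this]

lemma volume_frontier : volume (frontier K.carrier) = 0 :=
  K.convex_carrier.addHaar_frontier volume

lemma setLIntegral_closure_inter_le (s : Set E3) (f : E3 → ℝ≥0∞) :
    ∫⁻ x in closure K.carrier ∩ s, f x ≤ ∫⁻ x in K.carrier ∩ s, f x := by
  have h : (closure K.carrier ∩ s : Set E3) ≤ᵐ[volume] (K.carrier ∩ s : Set E3) := by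
    have h0 : ∀ᵐ x : E3, x ∉ frontier K.carrier := by
      simpa [ae_iff] using K.volume_frontier
    filter_upwards [h0] with x hx hxs
    refine ⟨?_, hxs.2⟩
    by_contra hxK
    exact hx ⟨hxs.1, by rwa [K.isOpen_carrier.interior_eq]⟩
  exact lintegral_mono' (Measure.restrict_mono_ae h) le_rfl

/-- If a surface that bounds `D` in the box deviates little from a plane, relative to the distance
of a vertex in `D` from the plane, then the part of the box in `D` is contained in a core over
which the integrals of squares of polynomials are controlled by those over that part.
The half space that lies at the side of the vertex at the distance of the deviation from the plane
and the opposite half space do not meet the surface. -/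
theorem exists_core {D S : Set E3} (hD : IsOpen D) (hS : K.carrier ∩ frontier D ⊆ S)
    {P : AffineSubspace ℝ E3} (hP : (P : Set E3).Nonempty) {c : Fin 3 → Bool}
    (hA : K.vertex c ∈ D) (hAP : K.vertex c ∉ P) {η : ℝ} (hη0 : 0 ≤ η) (hη : η ≤ 1 / 2)
    (hdist : distH (K.carrier ∩ S) P / Metric.infDist (K.vertex c) P ≤ η)
    {m : ℝ} (hm : 0 < m)
    (hedge : ∀ j, ∃ t : ℝ, m ≤ |t| ∧
      K.vertex c + t • EuclideanSpace.single j (1 : ℝ) ∈ D ∩ closure K.carrier) :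
    ∃ Q, K.IsCore m Q (K.vertex c) ∧ K.carrier ∩ D ⊆ Q ∧
      ∀ (n : ℕ) (F : E3 → ℝ), PolyOnLines n F →
        ∫⁻ x in Q, ENNReal.ofReal (F x ^ 2) ≤
          ENNReal.ofReal (1 + T ((1 + 3 * η) / (1 - η)) ^ (2 * n + 3) / 2) *
            ∫⁻ x in K.carrier ∩ D, ENNReal.ofReal (F x ^ 2) := by
  set A := K.vertex c with hAdef
  have : Nonempty P := hP.to_subtype
  set pr : E3 := (EuclideanGeometry.orthogonalProjection P A : E3) with hpr
  have hprP : pr ∈ P := EuclideanGeometry.orthogonalProjection_mem A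
  set ν := A - pr with hν
  have hνP : ν ∈ P.directionᗮ :=
    EuclideanGeometry.vsub_orthogonalProjection_mem_direction_orthogonal P A
  have hd : Metric.infDist A P = ‖ν‖ := by
    rw [← EuclideanGeometry.dist_orthogonalProjection_eq_infDist, dist_eq_norm]
  have hν0 : ν ≠ 0 := fun h0 => hAP (by rw [sub_eq_zero.1 h0]; exact hprP)
  have hd0 : 0 < ‖ν‖ := norm_pos_iff.2 hν0
  -- `f` is `‖ν‖` times the signed distance from the plane, positive at the vertex
  set f : E3 → ℝ := fun x => inner ℝ ν (x - pr) with hf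
  have hfc : Continuous f := by fun_prop
  have hfA : f A = ‖ν‖ ^ 2 := by rw [hf]; exact real_inner_self_eq_norm_sq ν
  have hf_le : ∀ x, |f x| ≤ ‖ν‖ * Metric.infDist x P := by
    intro x
    have h1 : ∀ y ∈ (P : Set E3), |f x| / ‖ν‖ ≤ dist x y := by
      intro y hy
      have h2 : inner ℝ ν (y - pr) = 0 :=
        (Submodule.mem_orthogonal' _ _).1 hνP _ (P.vsub_mem_direction hy hprP)
      have h3 : f x = inner ℝ ν (x - y) := by
        simp only [hf]
        rw [show x - pr = (x - y) + (y - pr) by abel, inner_add_right, h2, add_zero]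
      rw [h3, div_le_iff₀ hd0, dist_eq_norm, mul_comm]
      exact abs_real_inner_le_norm _ _
    have := (Metric.le_infDist hP).2 (fun y hy => h1 y hy)
    rw [div_le_iff₀ hd0] at this
    linarith
  have hfS : ∀ x ∈ K.carrier ∩ S, |f x| ≤ η * ‖ν‖ ^ 2 := by
    intro x hx
    have hbdd : BddAbove (Set.range fun x : (K.carrier ∩ S : Set E3) =>
        Metric.infDist (x : E3) P) := by
      obtain ⟨B, hB⟩ := K.isCompact_closure_carrier.bddAbove_image
        (f := fun x => Metric.infDist x (P : Set E3)) (Metric.continuous_infDist_pt _).continuousOn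
      refine ⟨B, ?_⟩
      rintro _ ⟨y, rfl⟩
      exact hB ⟨y, subset_closure y.2.1, rfl⟩
    have h1 : Metric.infDist x P ≤ distH (K.carrier ∩ S) P := le_ciSup hbdd ⟨x, hx⟩
    rw [hd, div_le_iff₀ hd0] at hdist
    calc |f x| ≤ ‖ν‖ * Metric.infDist x P := hf_le x
      _ ≤ ‖ν‖ * (η * ‖ν‖) := by gcongr; exact h1.trans hdist
      _ = _ := by ring
  have hf_conv : ∀ x y : E3, ∀ a b : ℝ, a + b = 1 → f (a • x + b • y) = a * f x + b * f y := by
    intro x y a b hab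
    have : a • x + b • y - pr = a • (x - pr) + b • (y - pr) := by
      rw [smul_sub, smul_sub]
      have h1 : pr = a • pr + b • pr := by rw [← add_smul, hab, one_smul]
      nth_rewrite 1 [h1]; abel
    rw [hf]
    simp only [this, inner_add_right, inner_smul_right]
  set e := η * ‖ν‖ ^ 2 with he
  have hpos : 0 < ‖ν‖ ^ 2 := by positivity
  have he_lt : e < ‖ν‖ ^ 2 := by rw [he]; nlinarith
  have he0 : 0 ≤ e := by positivity
  have hconv_gt : Convex ℝ {x | e < f x} := by
    intro x hx y hy a b ha hb hab
    simp only [Set.mem_ofPred_eq] at hx hy ⊢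
    rw [hf_conv x y a b hab]
    have : 0 < a ∨ 0 < b := by by_contra hc; push Not at hc; linarith
    have hb' : b = 1 - a := by linarith
    subst hb'
    rcases this with h | h <;> nlinarith
  have hconv_lt : Convex ℝ {x | f x < -e} := by
    intro x hx y hy a b ha hb hab
    simp only [Set.mem_ofPred_eq] at hx hy ⊢
    rw [hf_conv x y a b hab]
    have : 0 < a ∨ 0 < b := by by_contra hc; push Not at hc; linarith
    have hb' : b = 1 - a := by linarith
    subst hb'
    rcases this with h | h <;> nlinarith
  have hconv_ge : Convex ℝ {x | -e ≤ f x} := by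
    intro x hx y hy a b ha hb hab
    simp only [Set.mem_ofPred_eq] at hx hy ⊢
    rw [hf_conv x y a b hab]
    have hb' : b = 1 - a := by linarith
    subst hb'
    nlinarith
  set C₁ := K.carrier ∩ {x | e < f x} with hC₁
  set C₂ := K.carrier ∩ {x | f x < -e} with hC₂
  have hAcl : A ∈ closure K.carrier := K.vertex_mem c
  -- the part near the vertex lies in `D`
  have hC₁D : C₁ ⊆ D := by
    refine Convex.subset_of_disjoint_frontier (K.convex_carrier.inter hconv_gt) hD ?_ ?_
    · have hopen : IsOpen ({x | e < f x} ∩ D) := (isOpen_lt continuous_const hfc).inter hD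
      obtain ⟨x, hx, hxK⟩ := mem_closure_iff.1 hAcl _ hopen ⟨by simpa [hfA] using he_lt, hA⟩
      exact ⟨x, ⟨hxK, hx.1⟩, hx.2⟩
    · refine Set.disjoint_left.2 fun x hx hxf => ?_
      have := hfS x ⟨hx.1, hS ⟨hx.1, hxf⟩⟩
      exact absurd ((le_abs_self _).trans this) (not_le.2 hx.2)
  -- the part far from the vertex may also lie in `D`, but then it does so entirely
  have hC₂D : (C₂ ∩ D).Nonempty → C₂ ⊆ D := by
    intro hne
    refine Convex.subset_of_disjoint_frontier (K.convex_carrier.inter hconv_lt) hD hne ?_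
    refine Set.disjoint_left.2 fun x hx hxf => ?_
    have := hfS x ⟨hx.1, hS ⟨hx.1, hxf⟩⟩
    have h2 : f x < -e := hx.2
    linarith [neg_abs_le (f x)]
  set Q' := closure K.carrier ∩ {x | -e ≤ f x} with hQ'
  have hQ'c : IsCompact Q' :=
    K.isCompact_closure_carrier.inter_right (isClosed_le continuous_const hfc)
  have hQ'conv : Convex ℝ Q' := K.convex_carrier.closure.inter hconv_ge
  have hAQ' : A ∈ Q' := ⟨hAcl, by simp only [Set.mem_ofPred_eq, hfA]; linarith⟩
  set θ := (1 - η) / (1 + η) with hθ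
  have hθ0 : 0 < θ := div_pos (by linarith) (by linarith)
  have hθ1 : θ ≤ 1 := by rw [hθ, div_le_one (by linarith)]; linarith
  have hθη : θ * (1 + η) = 1 - η := div_mul_cancel₀ _ (by linarith)
  have hTe : 2 / θ - 1 = (1 + 3 * η) / (1 - η) := by
    have h1 : (1 : ℝ) - η ≠ 0 := by linarith
    have h2 : (1 : ℝ) + η ≠ 0 := by linarith
    rw [hθ]; field_simp; ring
  -- `θ` is chosen such that the level `-e` of `f` is mapped to the level `e`
  have himage : AffineMap.homothety A θ '' Q' ⊆ closure K.carrier ∩ {x | e ≤ f x} := by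
    rintro _ ⟨x, hx, rfl⟩
    have h1 : AffineMap.homothety A θ x = (1 - θ) • A + θ • x := by
      rw [AffineMap.homothety_apply, vsub_eq_sub, vadd_eq_add]
      rw [smul_sub, sub_smul, one_smul]; abel
    rw [h1]
    refine ⟨K.convex_carrier.closure hAcl hx.1 (by linarith) hθ0.le (by ring), ?_⟩
    simp only [Set.mem_ofPred_eq]
    rw [hf_conv _ _ _ _ (by ring), hfA]
    have h2 : -e ≤ f x := hx.2
    have h3 : θ * -e ≤ θ * f x := mul_le_mul_of_nonneg_left h2 hθ0.le
    have h4 : (1 - θ) * ‖ν‖ ^ 2 + θ * -e = e := by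
      rw [he]; linear_combination (-‖ν‖ ^ 2) * hθη
    linarith
  have hlev : ∀ᵐ x : E3, f x ≠ e := by
    have h0 : {x | f x = e} = {x : E3 | inner ℝ ν x = e + inner ℝ ν pr} := by
      ext x; simp only [hf, Set.mem_ofPred_eq, inner_sub_right]
      exact sub_eq_iff_eq_add
    rw [ae_iff]
    simp only [ne_eq, not_not]
    change volume {x | f x = e} = 0
    rw [h0]
    exact volume_level_set hν0 _
  have hmain : ∀ (n : ℕ) (F : E3 → ℝ), PolyOnLines n F →
      ∫⁻ x in Q', ENNReal.ofReal (F x ^ 2) ≤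
        ENNReal.ofReal (1 + T ((1 + 3 * η) / (1 - η)) ^ (2 * n + 3) / 2) *
          ∫⁻ x in C₁, ENNReal.ofReal (F x ^ 2) := by
    intro n F hF
    have h1 := lintegral_sq_le_homothety hF hQ'c hAQ' (hQ'conv.starConvex hAQ') hθ0 hθ1
    rw [hTe] at h1
    refine h1.trans (mul_le_mul_right ?_ _)
    refine (lintegral_mono_set himage).trans
      ((K.setLIntegral_closure_inter_le _ _).trans ?_)
    refine lintegral_mono' (Measure.restrict_mono_ae ?_) le_rfl
    filter_upwards [hlev] with x hx hxs
    exact ⟨hxs.1, lt_of_le_of_ne hxs.2 (Ne.symm hx)⟩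
  have hvert : ∀ j, ∃ b, A j = K.side j b := fun j => ⟨c j, by simp [hAdef, vertex, side]⟩
  -- If the far part lies in `D`, the whole box is a core; otherwise `Q'` is.
  by_cases hne : (C₂ ∩ D).Nonempty
  · refine ⟨closure K.carrier, ⟨hm, K.isCompact_closure_carrier, K.convex_carrier.closure,
      subset_rfl, hAcl, hvert, fun j => ?_⟩, fun x hx => subset_closure hx.1, ?_⟩
    · obtain ⟨t, ht, htD⟩ := hedge j
      exact ⟨t, ht, htD.2⟩
    · intro n F hF
      set c' := ENNReal.ofReal (1 + T ((1 + 3 * η) / (1 - η)) ^ (2 * n + 3) / 2) with hc'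
      have ht1 : 1 ≤ (1 + 3 * η) / (1 - η) := by rw [le_div_iff₀ (by linarith)]; linarith
      have hc1 : 1 ≤ c' := by
        rw [hc', ENNReal.one_le_ofReal]
        have := pow_pos (T_pos ht1) (2 * n + 3)
        linarith
      have hsplit : closure K.carrier = Q' ∪ (closure K.carrier ∩ {x | f x < -e}) := by
        ext x
        simp only [hQ', Set.mem_union, Set.mem_inter_iff, Set.mem_ofPred_eq]
        have := le_or_gt (-e) (f x)
        tauto
      have hdisj : Disjoint C₁ C₂ := Set.disjoint_left.2 fun x h1 h2 => by
        have h3 : e < f x := h1.2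
        have h4 : f x < -e := h2.2
        linarith
      have hC₂m : MeasurableSet C₂ :=
        K.isOpen_carrier.measurableSet.inter (isOpen_lt hfc continuous_const).measurableSet
      calc ∫⁻ x in closure K.carrier, ENNReal.ofReal (F x ^ 2)
          ≤ (∫⁻ x in Q', ENNReal.ofReal (F x ^ 2)) +
              ∫⁻ x in closure K.carrier ∩ {x | f x < -e}, ENNReal.ofReal (F x ^ 2) := by
            nth_rewrite 1 [hsplit]
            exact lintegral_union_le _ _ _
        _ ≤ c' * (∫⁻ x in C₁, ENNReal.ofReal (F x ^ 2)) +
              c' * ∫⁻ x in C₂, ENNReal.ofReal (F x ^ 2) := by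
            refine add_le_add (hmain n F hF) ?_
            refine (K.setLIntegral_closure_inter_le _ _).trans ?_
            exact le_mul_of_one_le_left zero_le hc1
        _ = c' * ∫⁻ x in C₁ ∪ C₂, ENNReal.ofReal (F x ^ 2) := by
            rw [lintegral_union hC₂m hdisj, mul_add]
        _ ≤ _ := by
            refine mul_le_mul_right (lintegral_mono_set ?_) _
            rintro x (hx | hx)
            · exact ⟨hx.1, hC₁D hx⟩
            · exact ⟨hx.1, hC₂D hne hx⟩
  · refine ⟨Q', ⟨hm, hQ'c, hQ'conv, Set.inter_subset_left, hAQ', hvert, fun j => ?_⟩, ?_, ?_⟩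
    · obtain ⟨t, ht, htD, htK⟩ := hedge j
      refine ⟨t, ht, htK, ?_⟩
      by_contra hlt
      have hopen : IsOpen ({x | f x < -e} ∩ D) := (isOpen_lt hfc continuous_const).inter hD
      obtain ⟨x, hx, hxK⟩ := mem_closure_iff.1 htK _ hopen ⟨show f _ < -e from not_le.1 hlt, htD⟩
      exact hne ⟨x, ⟨hxK, hx.1⟩, hx.2⟩
    · intro x hx
      refine ⟨subset_closure hx.1, ?_⟩
      by_contra hlt
      exact hne ⟨x, ⟨hx.1, show f x < -e from not_le.1 hlt⟩, hx.2⟩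
    · intro n F hF
      refine (hmain n F hF).trans (mul_le_mul_right (lintegral_mono_set ?_) _)
      exact fun x hx => ⟨hx.1, hC₁D hx⟩

end Box

/-! ### Cores of mesh elements -/

namespace Geometry

variable (G : Geometry)

lemma isOpen_sub (i : Fin 2) : IsOpen (G.sub i) := by
  fin_cases i
  · exact G.isOpen_Ω₁
  · exact G.isOpen_Ω.sdiff isClosed_closure

lemma sub_subset (i : Fin 2) : G.sub i ⊆ G.Ω := by
  fin_cases i
  · exact subset_closure.trans G.closure_Ω₁
  · exact Set.sdiff_subset

lemma Γ_subset : G.Γ ⊆ G.Ω := frontier_subset_closure.trans G.closure_Ω₁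

lemma bd_disjoint : Disjoint G.bd G.Ω :=
  disjoint_frontier_iff_isOpen.2 G.isOpen_Ω

lemma disjoint_sub {i i' : Fin 2} (h : i ≠ i') : Disjoint (G.sub i) (G.sub i') := by
  have h01 : Disjoint (G.sub 0) (G.sub 1) :=
    Set.disjoint_left.2 fun x hx hx' => hx'.2 (subset_closure hx)
  fin_cases i <;> fin_cases i' <;> first | exact absurd rfl h | exact h01 | exact h01.symm

lemma mem_Ω_cases {x : E3} (hx : x ∈ G.Ω) : (∃ i, x ∈ G.sub i) ∨ x ∈ G.Γ := by
  by_cases h1 : x ∈ G.Ω₁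
  · exact Or.inl ⟨0, h1⟩
  by_cases h2 : x ∈ closure G.Ω₁
  · exact Or.inr ⟨h2, by rwa [G.isOpen_Ω₁.interior_eq]⟩
  · exact Or.inl ⟨1, hx, h2⟩

lemma frontier_sub_one_subset : frontier (G.sub 1) ⊆ G.bd ∪ G.Γ := by
  have h := frontier_inter_subset G.Ω (closure G.Ω₁)ᶜ
  intro x hx
  rcases h hx with h | h
  · exact Or.inl h.1
  · refine Or.inr ?_
    have := h.2
    rw [frontier_compl] at this
    exact frontier_closure_subset this

end Geometry

namespace Mesh

variable {G : Geometry} {M : Mesh G}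

lemma _root_.UnfittedMaxwell.InterfaceCut.η_nonneg {K : Box} (c : InterfaceCut G K) : 0 ≤ c.η :=
  Real.iSup_nonneg fun _ => div_nonneg (Real.iSup_nonneg fun _ => Metric.infDist_nonneg)
    Metric.infDist_nonneg

lemma _root_.UnfittedMaxwell.BoundaryCut.η_nonneg {K : Box} (c : BoundaryCut G K) : 0 ≤ c.η :=
  div_nonneg (Real.iSup_nonneg fun _ => Metric.infDist_nonneg) Metric.infDist_nonneg

lemma η_nonneg (M : Mesh G) (K : Fin M.n) : 0 ≤ M.η K := by
  rw [η]
  split_ifs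
  · exact InterfaceCut.η_nonneg _
  · exact BoundaryCut.η_nonneg _
  · exact le_rfl

lemma one_le_ratio {η : ℝ} (hη0 : 0 ≤ η) (hη : η ≤ 1 / 2) : 1 ≤ (1 + 3 * η) / (1 - η) := by
  rw [le_div_iff₀ (by linarith)]; linarith

lemma ratio_le {η : ℝ} (hη : η ≤ 1 / 2) : (1 + 3 * η) / (1 - η) ≤ 5 := by
  rw [div_le_iff₀ (by linarith)]; linarith

variable {δ₀ σ ρ : ℝ}

lemma Admissible.one_le_ΘK (h : M.Admissible δ₀ σ ρ) (p : ℕ) (K : Fin M.n) : 1 ≤ M.ΘK p K := by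
  rw [ΘK]
  split_ifs with hK
  · exact one_le_pow₀ (one_le_T (one_le_ratio (M.η_nonneg K) (h.deviation K hK)))
  · exact le_rfl

/-- The factor of the core exceeds `Θ_K` by three powers of `𝖳`, which are bounded as `η ≤ 1/2`. -/
lemma core_const_le {η : ℝ} (hη0 : 0 ≤ η) (hη : η ≤ 1 / 2) (p : ℕ) :
    1 + T ((1 + 3 * η) / (1 - η)) ^ (2 * (3 * p) + 3) / 2 ≤
      501 * T ((1 + 3 * η) / (1 - η)) ^ (6 * p) := by
  set t := T ((1 + 3 * η) / (1 - η)) with ht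
  have h1 : 1 ≤ t := one_le_T (one_le_ratio hη0 hη)
  have h2 : t ≤ 10 := T_le_ten (one_le_ratio hη0 hη) (ratio_le hη)
  have h3 : 1 ≤ t ^ (6 * p) := one_le_pow₀ h1
  have h4 : t ^ 3 ≤ 10 ^ 3 := pow_le_pow_left₀ (by linarith) h2 3
  rw [show 2 * (3 * p) + 3 = 6 * p + 3 by ring, pow_add]
  nlinarith

/-- What is needed of the part of an element in a subdomain: it is contained in a core over which
the integrals of squares of polynomials of degree `p` in each variable are controlled. -/
structure HasCore (M : Mesh G) (p : ℕ) (K : Fin M.n) (i : Fin 2) (m : ℝ) (Q : Set E3) (A : E3) :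
    Prop where
  core : (M.elem K).IsCore m Q A
  subset : (M.elem K).carrier ∩ G.sub i ⊆ Q
  le_diam : m ≤ Metric.diam G.Ω
  lintegral_le : ∀ F : E3 → ℝ, PolyOnLines (3 * p) F →
    ∫⁻ x in Q, ENNReal.ofReal (F x ^ 2) ≤ ENNReal.ofReal (501 * M.ΘK p K) *
      ∫⁻ x in (M.elem K).carrier ∩ G.sub i, ENNReal.ofReal (F x ^ 2)

lemma length_ge (h : M.Admissible δ₀ σ ρ) {δ : ℝ} (hδ : 0 < δ) (K : Fin M.n) (j : Fin 3) :
    δ / (max σ 1) * (M.elem K).h ≤ δ * ((M.elem K).hi j - (M.elem K).lo j) := by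
  have h1 := h.shape_regular K j
  have hl := sub_pos.2 ((M.elem K).lt j)
  have hs : (0 : ℝ) < max σ 1 := lt_max_of_lt_right one_pos
  have h2 : (M.elem K).h ≤ max σ 1 * ((M.elem K).hi j - (M.elem K).lo j) :=
    h1.trans (mul_le_mul_of_nonneg_right (le_max_left _ _) hl.le)
  rw [div_mul_eq_mul_div, div_le_iff₀ hs]
  nlinarith

/-- The size of the cores relative to the size of the elements. -/
def coreRatio (δ₀ σ : ℝ) : ℝ := δ₀ / 2 / max σ 1

lemma coreRatio_pos (hδ : 0 < δ₀) : 0 < coreRatio δ₀ σ :=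
  div_pos (half_pos hδ) (lt_max_of_lt_right one_pos)

lemma le_diam_of_mem {x : E3} {j : Fin 3} {m t : ℝ} (hm : m ≤ |t|) (hx : x ∈ closure G.Ω)
    (hxt : x + t • EuclideanSpace.single j (1 : ℝ) ∈ closure G.Ω) : m ≤ Metric.diam G.Ω := by
  rw [← Metric.diam_closure]
  have := Metric.dist_le_diam_of_mem G.bounded_Ω.closure hxt hx
  rw [dist_eq_norm, add_sub_cancel_left, norm_smul, PiLp.norm_single, norm_one,
    mul_one, Real.norm_eq_abs] at this
  exact hm.trans this

/-- The core of a cut element, whose surface `S` is the interface or the boundary. -/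
lemma hasCore_of_cut (h : M.Admissible δ₀ σ ρ) (hδ : 0 < δ₀) (p : ℕ) {K : Fin M.n} {i : Fin 2}
    {S : Set E3} (hK : M.MeetsΓ K ∨ M.MeetsBd K)
    (hS : (M.elem K).carrier ∩ frontier (G.sub i) ⊆ S)
    (hlarge : (M.elem K).IsLarge δ₀ (G.sub i)) {V : Set E3} (t : Triangles V)
    {A : E3} (hA : A ∈ (M.elem K).vertices ∩ G.sub i) (hAP : A ∉ t.plane t.sel)
    (hdist : distH ((M.elem K).carrier ∩ S) (t.plane t.sel) /
      Metric.infDist A (t.plane t.sel) ≤ M.η K) :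
    ∃ Q A, M.HasCore p K i (coreRatio δ₀ σ * (M.elem K).h) Q A := by
  obtain ⟨⟨c, rfl⟩, hA⟩ := hA
  have hη0 := M.η_nonneg K
  have hη := h.deviation K hK
  have hm : 0 < coreRatio δ₀ σ * (M.elem K).h := mul_pos (coreRatio_pos hδ) (M.elem K).h_pos
  have hedge : ∀ j, ∃ t : ℝ, coreRatio δ₀ σ * (M.elem K).h ≤ |t| ∧
      (M.elem K).vertex c + t • EuclideanSpace.single j (1 : ℝ) ∈
        G.sub i ∩ closure (M.elem K).carrier := by
    intro j
    obtain ⟨t, ht, htD⟩ := Box.IsLarge.exists_mem _ hδ hlarge hA j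
    exact ⟨t, (length_ge h (half_pos hδ) K j).trans ht, htD⟩
  obtain ⟨Q, hQ, hsub, hint⟩ := (M.elem K).exists_core (G.isOpen_sub i) hS
    (P := affineSpan ℝ (Set.range (t.tri t.sel)))
    ⟨t.tri t.sel 0, subset_affineSpan ℝ _ ⟨0, rfl⟩⟩ hA hAP hη0 hη hdist hm hedge
  refine ⟨Q, _, hQ, hsub, ?_, fun F hF => (hint _ F hF).trans ?_⟩
  · obtain ⟨t, ht, htD⟩ := hedge 0
    exact le_diam_of_mem ht (subset_closure (G.sub_subset i hA))
      (subset_closure (G.sub_subset i htD.1))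
  · refine mul_le_mul_left (ENNReal.ofReal_le_ofReal ?_) _
    rw [ΘK, if_pos hK]
    exact core_const_le hη0 hη p

/-- Each nonempty part of an element in a subdomain has a core. -/
theorem Admissible.exists_hasCore (h : M.Admissible δ₀ σ ρ) (hδ : 0 < δ₀) (hδ1 : δ₀ < 1 / 2)
    (p : ℕ) (K : Fin M.n) (i : Fin 2) (hne : ((M.elem K).carrier ∩ G.sub i).Nonempty) :
    ∃ Q A, M.HasCore p K i (coreRatio δ₀ σ * (M.elem K).h) Q A := by
  by_cases hΓ : M.MeetsΓ K
  · have hB : ¬ M.MeetsBd K := fun hB => h.not_both K ⟨hΓ, hB⟩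
    have hηK : M.η K = (M.cutΓ K hΓ).η := by rw [η, dif_pos hΓ]
    refine hasCore_of_cut h hδ p (Or.inl hΓ) (S := G.Γ) ?_ (h.large_Γ K hΓ i)
      (M.cutΓ K hΓ).tris ((M.cutΓ K hΓ).part i).apex_mem ((M.cutΓ K hΓ).apex_off i) ?_
    · rintro x ⟨hxK, hx⟩
      fin_cases i
      · exact hx
      · rcases G.frontier_sub_one_subset hx with h | h
        · exact absurd ⟨x, hxK, h⟩ hB
        · exact h
    · rw [hηK, InterfaceCut.η]
      exact le_ciSup (f := fun i : Fin 2 => distH ((M.elem K).carrier ∩ G.Γ)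
        ((M.cutΓ K hΓ).tris.plane (M.cutΓ K hΓ).tris.sel) /
        Metric.infDist ((M.cutΓ K hΓ).part i).apex
          ((M.cutΓ K hΓ).tris.plane (M.cutΓ K hΓ).tris.sel)) (Set.finite_range _).bddAbove i
  have hdΓ : Disjoint (M.elem K).carrier (frontier G.Ω₁) :=
    Set.disjoint_iff_inter_eq_empty.2 (Set.not_nonempty_iff_eq_empty.1 hΓ)
  by_cases hB : M.MeetsBd K
  · have hηK : M.η K = (M.cutBd K hB).η := by rw [η, dif_neg hΓ, dif_pos hB]
    have hi : i = 1 := by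
      fin_cases i
      · exfalso
        have := Convex.subset_of_disjoint_frontier (M.elem K).convex_carrier G.isOpen_Ω₁ hne hdΓ
        obtain ⟨x, hxK, hx⟩ := hB
        exact Set.disjoint_left.1 G.bd_disjoint hx (G.sub_subset 0 (this hxK))
      · rfl
    subst hi
    refine hasCore_of_cut h hδ p (Or.inr hB) (S := G.bd) ?_ (h.large_bd K hB)
      (M.cutBd K hB).tris (M.cutBd K hB).part.apex_mem (M.cutBd K hB).apex_off ?_
    · rintro x ⟨hxK, hx⟩
      rcases G.frontier_sub_one_subset hx with h | h
      · exact h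
      · exact absurd ⟨x, hxK, h⟩ hΓ
    · rw [hηK]; exact le_rfl
  · have hsub : (M.elem K).carrier ⊆ G.sub i := by
      refine Convex.subset_of_disjoint_frontier (M.elem K).convex_carrier (G.isOpen_sub i) hne
        (Set.disjoint_left.2 fun x hxK hx => ?_)
      fin_cases i
      · exact hΓ ⟨x, hxK, hx⟩
      · rcases G.frontier_sub_one_subset hx with h | h
        · exact hB ⟨x, hxK, h⟩
        · exact hΓ ⟨x, hxK, h⟩
    have hm : 0 < coreRatio δ₀ σ * (M.elem K).h := mul_pos (coreRatio_pos hδ) (M.elem K).h_pos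
    have hmK : ∀ j, coreRatio δ₀ σ * (M.elem K).h ≤ (M.elem K).hi j - (M.elem K).lo j := by
      intro j
      have hl := sub_pos.2 ((M.elem K).lt j)
      refine (length_ge h (half_pos hδ) K j).trans ?_
      nlinarith
    have hcore := (M.elem K).isCore_closure hm hmK
    have hcl : closure (M.elem K).carrier ⊆ closure G.Ω :=
      closure_mono (hsub.trans (G.sub_subset i))
    refine ⟨_, _, hcore, fun x hx => subset_closure hx.1, ?_, fun F hF => ?_⟩
    · obtain ⟨t, ht, hmem⟩ := hcore.edge 0
      exact le_diam_of_mem ht (hcl hcore.mem) (hcl hmem)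
    · have h1 := (M.elem K).setLIntegral_closure_inter_le Set.univ
        (fun x => ENNReal.ofReal (F x ^ 2))
      rw [Set.inter_univ, Set.inter_univ] at h1
      rw [Set.inter_eq_left.2 hsub]
      refine h1.trans (le_mul_of_one_le_left zero_le ?_)
      rw [ENNReal.one_le_ofReal]
      linarith [h.one_le_ΘK p K]

end Mesh

/-! ### Polynomial vector fields -/

/-- The complex coordinates of a point. -/
def coords (x : E3) (j : Fin 3) : ℂ := ((x j : ℝ) : ℂ)

/-- The vector field with the components `q`. -/
def polyField (q : Fin 3 → MvPolynomial (Fin 3) ℂ) (x : E3) : C3 :=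
  fun l => MvPolynomial.eval (coords x) (q l)

lemma contDiff_eval (q : MvPolynomial (Fin 3) ℂ) :
    ContDiff ℝ 1 fun x : E3 => MvPolynomial.eval (coords x) q := by
  simp only [MvPolynomial.eval_eq', coords]
  refine ContDiff.sum fun d _ => contDiff_const.mul (contDiff_prod fun i _ => ContDiff.pow ?_ _)
  exact Complex.ofRealCLM.contDiff.comp (EuclideanSpace.proj (𝕜 := ℝ) i).contDiff

lemma contDiff_polyField (q : Fin 3 → MvPolynomial (Fin 3) ℂ) : ContDiff ℝ 1 (polyField q) :=
  contDiff_pi.2 fun l => contDiff_eval (q l)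

lemma continuous_polyField (q : Fin 3 → MvPolynomial (Fin 3) ℂ) : Continuous (polyField q) :=
  (contDiff_polyField q).continuous

lemma exists_eval_line {q : MvPolynomial (Fin 3) ℂ} {p : ℕ} (hq : ∀ j, q.degreeOf j ≤ p)
    (A w : E3) : ∃ P : Polynomial ℂ, P.natDegree ≤ 3 * p ∧
      ∀ r : ℝ, MvPolynomial.eval (coords (A + r • w)) q = P.eval (r : ℂ) := by
  classical
  refine ⟨∑ d ∈ q.support, Polynomial.C (q.coeff d) *
    ∏ i, (Polynomial.C (coords A i) + Polynomial.X * Polynomial.C (coords w i)) ^ d i, ?_, ?_⟩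
  · refine Polynomial.natDegree_sum_le_of_forall_le _ _ fun d hd => ?_
    refine (Polynomial.natDegree_C_mul_le _ _).trans ((Polynomial.natDegree_prod_le _ _).trans ?_)
    have h1 : ∀ i ∈ (Finset.univ : Finset (Fin 3)),
        ((Polynomial.C (coords A i) + Polynomial.X * Polynomial.C (coords w i)) ^ d i).natDegree ≤
          p := by
      intro i _
      refine Polynomial.natDegree_pow_le.trans ?_
      have h2 : (Polynomial.C (coords A i) +
          Polynomial.X * Polynomial.C (coords w i)).natDegree ≤ 1 := by
        compute_degree
      have h3 : d i ≤ p := (MvPolynomial.monomial_le_degreeOf i hd).trans (hq i)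
      calc d i * _ ≤ d i * 1 := Nat.mul_le_mul_left _ h2
        _ ≤ p := by omega
    refine (Finset.sum_le_card_nsmul _ _ _ h1).trans ?_
    simp
  · intro r
    rw [MvPolynomial.eval_eq', Polynomial.eval_finsetSum]
    refine Finset.sum_congr rfl fun d _ => ?_
    rw [Polynomial.eval_mul, Polynomial.eval_C, Polynomial.eval_prod]
    congr 1
    refine Finset.prod_congr rfl fun i _ => ?_
    have e : coords (A + r • w) i = coords A i + r * coords w i := by simp [coords]
    rw [e, Polynomial.eval_pow, Polynomial.eval_add, Polynomial.eval_mul, Polynomial.eval_X,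
      Polynomial.eval_C, Polynomial.eval_C]

lemma exists_real_polynomial (φ : ℂ →ₗ[ℝ] ℝ) {P : Polynomial ℂ} {n : ℕ} (hP : P.natDegree ≤ n) :
    ∃ R : Polynomial ℝ, R.natDegree ≤ n ∧ ∀ r : ℝ, R.eval r = φ (P.eval (r : ℂ)) := by
  refine ⟨∑ k ∈ Finset.range (n + 1), Polynomial.C (φ (P.coeff k)) * Polynomial.X ^ k, ?_, ?_⟩
  · refine Polynomial.natDegree_sum_le_of_forall_le _ _ fun k hk => ?_
    exact (Polynomial.natDegree_C_mul_X_pow_le _ _).trans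
      (Nat.lt_succ_iff.1 (Finset.mem_range.1 hk))
  · intro r
    rw [Polynomial.eval_finsetSum, Polynomial.eval_eq_sum_range' (Nat.lt_succ_iff.2 hP), map_sum]
    refine Finset.sum_congr rfl fun k _ => ?_
    have e : P.coeff k * (r : ℂ) ^ k = (r ^ k : ℝ) • P.coeff k := by
      rw [Complex.real_smul]; push_cast; ring
    rw [e, map_smul, smul_eq_mul, Polynomial.eval_C_mul, Polynomial.eval_pow, Polynomial.eval_X,
      mul_comm]

lemma polyOnLines_eval {q : MvPolynomial (Fin 3) ℂ} {p : ℕ} (hq : ∀ j, q.degreeOf j ≤ p)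
    (φ : ℂ →L[ℝ] ℝ) : PolyOnLines (3 * p) fun x => φ (MvPolynomial.eval (coords x) q) where
  contDiff := φ.contDiff.comp (contDiff_eval q)
  line A w := by
    obtain ⟨P, hP, hPe⟩ := exists_eval_line hq A w
    obtain ⟨R, hR, hRe⟩ := exists_real_polynomial φ.toLinearMap hP
    refine ⟨R, hR, fun r => ?_⟩
    rw [hRe, hPe]
    rfl

lemma sqNorm_nonneg (z : C3) : 0 ≤ sqNorm z := Finset.sum_nonneg fun _ _ => by positivity

lemma continuous_sqNorm : Continuous sqNorm := by unfold sqNorm; fun_prop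

lemma ofReal_sqNorm (z : C3) : ENNReal.ofReal (sqNorm z) =
    ∑ l, (ENNReal.ofReal (Complex.reCLM (z l) ^ 2) + ENNReal.ofReal (Complex.imCLM (z l) ^ 2)) := by
  rw [sqNorm, ENNReal.ofReal_sum_of_nonneg fun _ _ => by positivity]
  refine Finset.sum_congr rfl fun l _ => ?_
  rw [← ENNReal.ofReal_add (by positivity) (by positivity)]
  congr 1
  rw [← Complex.normSq_eq_norm_sq, Complex.normSq_apply]
  simp only [Complex.reCLM_apply, Complex.imCLM_apply]
  ring

/-- Integral inequalities for squares of polynomials carry over to polynomial fields. -/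
lemma lintegral_sqNorm_le {μ ν : Measure E3} {c : ℝ≥0∞} {p : ℕ}
    (h : ∀ F : E3 → ℝ, PolyOnLines (3 * p) F →
      ∫⁻ x, ENNReal.ofReal (F x ^ 2) ∂μ ≤ c * ∫⁻ x, ENNReal.ofReal (F x ^ 2) ∂ν)
    {q : Fin 3 → MvPolynomial (Fin 3) ℂ} (hq : ∀ l j, (q l).degreeOf j ≤ p) :
    ∫⁻ x, ENNReal.ofReal (sqNorm (polyField q x)) ∂μ ≤
      c * ∫⁻ x, ENNReal.ofReal (sqNorm (polyField q x)) ∂ν := by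
  have hm : ∀ (φ : ℂ →L[ℝ] ℝ) (l : Fin 3),
      Measurable fun x => ENNReal.ofReal (φ (polyField q x l) ^ 2) := by
    intro φ l
    have : Continuous fun x => φ (polyField q x l) :=
      φ.continuous.comp ((continuous_apply l).comp (continuous_polyField q))
    exact (this.pow 2).measurable.ennreal_ofReal
  have hm2 : ∀ l ∈ (Finset.univ : Finset (Fin 3)), Measurable fun x =>
      ENNReal.ofReal (Complex.reCLM (polyField q x l) ^ 2) +
        ENNReal.ofReal (Complex.imCLM (polyField q x l) ^ 2) := fun l _ => (hm _ l).add (hm _ l)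
  simp only [ofReal_sqNorm]
  rw [lintegral_finsetSum _ hm2, lintegral_finsetSum _ hm2, Finset.mul_sum]
  refine Finset.sum_le_sum fun l _ => ?_
  rw [lintegral_add_left (hm _ l), lintegral_add_left (hm _ l), mul_add]
  exact add_le_add (h _ (polyOnLines_eval (hq l) _)) (h _ (polyOnLines_eval (hq l) _))

/-! ### Bounded measurable functions -/

/-- Almost everywhere bounded and strongly measurable functions. -/
def Tame {V : Type*} [NormedAddCommGroup V] (μ : Measure E3) (u : E3 → V) : Prop :=
  AEStronglyMeasurable u μ ∧ ∃ C, ∀ᵐ x ∂μ, ‖u x‖ ≤ C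

namespace Tame

variable {V W U : Type*} [NormedAddCommGroup V] [NormedAddCommGroup W] [NormedAddCommGroup U]
  {μ : Measure E3}

lemma comp₂ [ProperSpace V] [ProperSpace W] {u : E3 → V} {w : E3 → W} (hu : Tame μ u)
    (hw : Tame μ w) {Φ : V × W → U} (hΦ : Continuous Φ) : Tame μ fun x => Φ (u x, w x) := by
  obtain ⟨hum, A, hA⟩ := hu
  obtain ⟨hwm, B, hB⟩ := hw
  refine ⟨hΦ.comp_aestronglyMeasurable (hum.prodMk hwm), ?_⟩
  obtain ⟨C, hC⟩ := ((isCompact_closedBall (0 : V) A).prod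
    (isCompact_closedBall (0 : W) B)).exists_bound_of_continuousOn hΦ.continuousOn
  refine ⟨C, ?_⟩
  filter_upwards [hA, hB] with x h1 h2
  exact hC _ ⟨by simpa using h1, by simpa using h2⟩

lemma comp [ProperSpace V] {u : E3 → V} (hu : Tame μ u) {Φ : V → U} (hΦ : Continuous Φ) :
    Tame μ fun x => Φ (u x) :=
  comp₂ (Φ := fun p : V × V => Φ p.1) hu hu (hΦ.comp continuous_fst)

lemma congr {u w : E3 → V} (hu : Tame μ u) (h : u =ᵐ[μ] w) : Tame μ w := by
  obtain ⟨hum, A, hA⟩ := hu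
  refine ⟨hum.congr h, A, ?_⟩
  filter_upwards [hA, h] with x h1 h2
  rwa [← h2]

lemma integrable [IsFiniteMeasure μ] {u : E3 → V} (hu : Tame μ u) : Integrable u μ :=
  Integrable.of_bound hu.1 hu.2.choose hu.2.choose_spec

lemma sum {ι : Type*} {s : Finset ι} {u : ι → E3 → V}
    (hu : ∀ i ∈ s, Tame μ (u i)) : Tame μ fun x => ∑ i ∈ s, u i x := by
  refine ⟨Finset.aestronglyMeasurable_fun_sum s fun i hi => (hu i hi).1, ?_⟩
  choose! C hC using fun i hi => (hu i hi).2
  refine ⟨∑ i ∈ s, C i, ?_⟩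
  have : ∀ᵐ x ∂μ, ∀ i ∈ s, ‖u i x‖ ≤ C i := (ae_ball_iff s.countable_toSet).2 hC
  filter_upwards [this] with x hx
  exact (norm_sum_le _ _).trans (Finset.sum_le_sum hx)

lemma indicator_of_continuous {B : Set E3} (hB : MeasurableSet B) {k : Set E3} (hk : IsCompact k)
    (hBk : B ⊆ k) {g : E3 → V} (hg : Continuous g) : Tame μ (B.indicator g) := by
  refine ⟨(hg.stronglyMeasurable.indicator hB).aestronglyMeasurable, ?_⟩
  obtain ⟨C, hC⟩ := hk.exists_bound_of_continuousOn hg.continuousOn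
  refine ⟨max C 0, ae_of_all _ fun x => ?_⟩
  by_cases hx : x ∈ B
  · rw [Set.indicator_of_mem hx]
    exact (hC x (hBk hx)).trans (le_max_left _ _)
  · rw [Set.indicator_of_notMem hx, norm_zero]
    exact le_max_right _ _

end Tame

/-! ### One-sided traces -/

/-- The points from which the ray in the direction `d` starts in `U`. -/
def raySet (d : E3 → E3) (U : Set E3) : Set E3 :=
  {x | ∀ᶠ t in 𝓝[>] (0 : ℝ), x + t • d x ∈ U}

lemma measurableSet_raySet {d : E3 → E3} (hd : Measurable d) {U : Set E3} (hU : IsOpen U) :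
    MeasurableSet (raySet d U) :=
  (measurable_id.prodMk hd) (measurableSet_eventually_ray hU)

lemma raySet_subset_closure (d : E3 → E3) (U : Set E3) : raySet d U ⊆ closure U :=
  fun x hx => mem_closure_of_tendsto (tendsto_line x (d x)) hx

lemma raySet_disjoint {d : E3 → E3} {U U' : Set E3} (h : Disjoint U U') :
    Disjoint (raySet d U) (raySet d U') :=
  Set.disjoint_left.2 fun _ hx hx' => by
    obtain ⟨t, h1, h2⟩ := (Filter.Eventually.and (show ∀ᶠ t in 𝓝[>] (0 : ℝ), _ from hx) hx').exists
    exact Set.disjoint_left.1 h h1 h2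

lemma tendsto_ray {V : Type*} [TopologicalSpace V] {v g : E3 → V} {U : Set E3} (hg : Continuous g)
    (hv : Set.EqOn v g U) {d : E3 → E3} {x : E3} (hx : x ∈ raySet d U) :
    Tendsto (fun t : ℝ => v (x + t • d x)) (𝓝[>] 0) (𝓝 (g x)) := by
  refine ((hg.tendsto x).comp (tendsto_line x (d x))).congr' ?_
  have hx : ∀ᶠ t in 𝓝[>] (0 : ℝ), x + t • d x ∈ U := hx
  filter_upwards [hx] with t ht using (hv ht).symm

lemma traceFrom_eq {V : Type*} [TopologicalSpace V] [T2Space V] [Nonempty V] {v g : E3 → V}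
    {U : Set E3} (hg : Continuous g) (hv : Set.EqOn v g U) {d : E3 → E3} {x : E3}
    (hx : x ∈ raySet d U) : traceFrom v x (d x) = g x :=
  (tendsto_ray hg hv hx).limUnder_eq

open Classical in
/-- The one-sided trace in the direction `d`, set to zero where `d` vanishes. -/
def sideTrace {V : Type*} [TopologicalSpace V] [Zero V] (d : E3 → E3) (v : E3 → V) (x : E3) : V :=
  if d x = 0 then 0 else traceFrom v x (d x)

lemma sideTrace_eq {V : Type*} [TopologicalSpace V] [T2Space V] [Zero V] {v g : E3 → V}
    {U : Set E3} (hg : Continuous g) (hv : Set.EqOn v g U) {d : E3 → E3} {x : E3} (hd : d x ≠ 0)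
    (hx : x ∈ raySet d U) : sideTrace d v x = g x := by
  rw [sideTrace, if_neg hd, traceFrom_eq hg hv hx]

/-- The interface is a null set. -/
lemma Geometry.volume_Γ (G : Geometry) : volume G.Γ = 0 :=
  volume_eq_zero_of_area_lt_top (G.c2_Ω₁.isLocallyGraph.area_frontier_lt_top
    (G.bounded_Ω.subset (subset_closure.trans G.closure_Ω₁)))

namespace Mesh

variable {G : Geometry} {M : Mesh G}

/-- The part of an element in a subdomain. -/
def piece (M : Mesh G) (K : Fin M.n) (i : Fin 2) : Set E3 := (M.elem K).carrier ∩ G.sub i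

lemma isOpen_piece (K : Fin M.n) (i : Fin 2) : IsOpen (M.piece K i) :=
  (M.elem K).isOpen_carrier.inter (G.isOpen_sub i)

lemma closure_piece_subset (K : Fin M.n) (i : Fin 2) :
    closure (M.piece K i) ⊆ closure (M.elem K).carrier := closure_mono Set.inter_subset_left

lemma piece_disjoint {K K' : Fin M.n} {i i' : Fin 2} (h : (K, i) ≠ (K', i')) :
    Disjoint (M.piece K i) (M.piece K' i') := by
  by_cases hK : K = K'
  · have hi : i ≠ i' := fun hi => h (by rw [hK, hi])
    exact (G.disjoint_sub hi).mono Set.inter_subset_right Set.inter_subset_right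
  · exact (M.disj hK).mono Set.inter_subset_left Set.inter_subset_left

/-- Functions that agree on each part of an element in a subdomain with a continuous function. -/
def PiecewiseCont (M : Mesh G) {V : Type*} [TopologicalSpace V] (v : E3 → V) : Prop :=
  ∀ K i, ∃ g : E3 → V, Continuous g ∧ Set.EqOn v g (M.piece K i)

namespace PiecewiseCont

variable {V W U : Type*}

lemma comp₂ [TopologicalSpace V] [TopologicalSpace W] [TopologicalSpace U] {v : E3 → V}
    {w : E3 → W} (hv : M.PiecewiseCont v) (hw : M.PiecewiseCont w) {Φ : V × W → U}
    (hΦ : Continuous Φ) : M.PiecewiseCont fun x => Φ (v x, w x) := by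
  intro K i
  obtain ⟨g, hg, hvg⟩ := hv K i
  obtain ⟨g', hg', hwg⟩ := hw K i
  refine ⟨fun x => Φ (g x, g' x), hΦ.comp (hg.prodMk hg'), fun x hx => ?_⟩
  simp only [hvg hx, hwg hx]

lemma _root_.UnfittedMaxwell.Geometry.coef_eq (G : Geometry) (c : Fin 2 → ℝ) {i : Fin 2} {x : E3}
    (hx : x ∈ G.sub i) : G.coef c x = c i := by
  rw [Geometry.coef, Finset.sum_eq_single i]
  · rw [if_pos hx]
  · intro j _ hj
    rw [if_neg fun h => Set.disjoint_left.1 (G.disjoint_sub hj) h hx]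
  · simp

variable [NormedAddCommGroup V]

lemma tame_volume {v : E3 → V} (hv : M.PiecewiseCont v) (K : Fin M.n) :
    Tame (volume.restrict ((M.elem K).carrier ∩ G.Ω)) v := by
  choose g hg hvg using hv K
  have h : Tame (volume.restrict ((M.elem K).carrier ∩ G.Ω))
      fun x => ∑ i, (M.piece K i).indicator (g i) x :=
    Tame.sum fun i _ => Tame.indicator_of_continuous (isOpen_piece K i).measurableSet
      (M.elem K).isCompact_closure_carrier (fun x hx => subset_closure hx.1) (hg i)
  refine h.congr ?_
  have hΓ : ∀ᵐ x ∂(volume.restrict ((M.elem K).carrier ∩ G.Ω)), x ∉ G.Γ :=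
    ae_restrict_of_ae (by simpa [ae_iff] using G.volume_Γ)
  filter_upwards [hΓ, ae_restrict_mem ((M.elem K).isOpen_carrier.inter G.isOpen_Ω).measurableSet]
    with x hx hxK
  obtain ⟨i, hi⟩ := (G.mem_Ω_cases hxK.2).resolve_right hx
  have hxi : x ∈ M.piece K i := ⟨hxK.1, hi⟩
  rw [Finset.sum_eq_single i, Set.indicator_of_mem hxi, hvg i hxi]
  · intro j _ hj
    exact Set.indicator_of_notMem
      (fun h => Set.disjoint_left.1 (G.disjoint_sub hj) h.2 hi) _
  · simp

lemma tame_sideTrace {v : E3 → V} (hv : M.PiecewiseCont v) {d : E3 → E3} (hd : Measurable d)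
    {μ : Measure E3} {K : Fin M.n}
    (h : ∀ᵐ x ∂μ, d x ≠ 0 → ∃ i, x ∈ raySet d (M.piece K i)) : Tame μ (sideTrace d v) := by
  choose g hg hvg using hv K
  have hd0 : MeasurableSet {x | d x ≠ 0} := (hd (measurableSet_singleton 0)).compl
  have hray : ∀ i, MeasurableSet (raySet d (M.piece K i)) := fun i =>
    measurableSet_raySet hd (isOpen_piece K i)
  have hT : Tame μ fun x => ∑ i, ({x | d x ≠ 0} ∩ raySet d (M.piece K i)).indicator (g i) x :=
    Tame.sum fun i _ => Tame.indicator_of_continuous (hd0.inter (hray i))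
      (M.elem K).isCompact_closure_carrier
      (Set.inter_subset_right.trans ((raySet_subset_closure _ _).trans (closure_piece_subset K i)))
      (hg i)
  refine hT.congr ?_
  filter_upwards [h] with x hx
  by_cases h0 : d x = 0
  · rw [sideTrace, if_pos h0]
    exact Finset.sum_eq_zero fun i _ => Set.indicator_of_notMem (fun h => h.1 h0) _
  · obtain ⟨i, hi⟩ := hx h0
    rw [Finset.sum_eq_single i,
      Set.indicator_of_mem (show x ∈ {x | d x ≠ 0} ∩ raySet d (M.piece K i) from ⟨h0, hi⟩),
      sideTrace_eq (hg i) (hvg i) h0 hi]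
    · intro j _ hj
      refine Set.indicator_of_notMem (fun h => ?_) _
      exact Set.disjoint_left.1 (raySet_disjoint (piece_disjoint (K := K) (K' := K)
        (by simpa using hj))) h.2 hi
    · simp

end PiecewiseCont

lemma exists_polyField {p : ℕ} {v : E3 → C3} (hv : v ∈ M.Xp p) (K : Fin M.n) (i : Fin 2) :
    ∃ q : Fin 3 → MvPolynomial (Fin 3) ℂ, (∀ l j, (q l).degreeOf j ≤ p) ∧
      Set.EqOn v (polyField q) (M.piece K i) := by
  obtain ⟨q, hq, hvq⟩ := hv.1 K i
  exact ⟨q, hq, fun x hx => funext fun l => hvq x hx l⟩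

lemma piecewiseCont_of_mem {p : ℕ} {v : E3 → C3} (hv : v ∈ M.Xp p) : M.PiecewiseCont v := by
  intro K i
  obtain ⟨q, -, hq⟩ := exists_polyField hv K i
  exact ⟨_, continuous_polyField q, hq⟩

/-- On each part of an element in a subdomain, the curl is that of a smooth field. -/
lemma piecewiseCont_curl {p : ℕ} {v : E3 → C3} (hv : v ∈ M.Xp p) :
    M.PiecewiseCont (curl v) := by
  intro K i
  obtain ⟨q, -, hq⟩ := exists_polyField hv K i
  refine ⟨curl (polyField q), ?_, fun x hx => ?_⟩
  · have h : ∀ j l, Continuous (pd (polyField q) j l) := fun j l =>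
      (continuous_apply l).comp
        (((contDiff_polyField q).continuous_fderiv one_ne_zero).clm_apply continuous_const)
    refine continuous_pi fun l => ?_
    fin_cases l
    · exact (h 1 2).sub (h 2 1)
    · exact (h 2 0).sub (h 0 2)
    · exact (h 0 1).sub (h 1 0)
  · have hev : v =ᶠ[𝓝 x] polyField q := by
      filter_upwards [(isOpen_piece K i).mem_nhds hx] with y hy using hq hy
    have hpd : ∀ j l, pd v j l x = pd (polyField q) j l x := fun j l => by
      rw [pd, pd, hev.fderiv_eq]
    simp only [curl, hpd]

end Mesh

/-! ### Common faces of boxes -/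

/-- The outer unit normal of the face `(j, b)` of a box. -/
def axisDir (j : Fin 3) (b : Bool) : E3 :=
  (if b then (1 : ℝ) else -1) • EuclideanSpace.single j (1 : ℝ)

lemma axisDir_not (j : Fin 3) (b : Bool) : axisDir j (!b) = -axisDir j b := by
  cases b <;> simp [axisDir]

lemma axisDir_ne_zero (j : Fin 3) (b : Bool) : axisDir j b ≠ 0 := by
  intro h
  have := congrArg (fun y : E3 => y j) h
  cases b <;> simp [axisDir] at this

namespace Box

variable {K K' K'' : Box}

/-- The points in the relative interior of the face `(j, b)` of `K` that are in the relative
interior of the opposite face of `K'`. -/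
def commonFace (K K' : Box) (j : Fin 3) (b : Bool) : Set E3 :=
  {x | x j = K.side j b ∧ x j = K'.side j (!b) ∧
    ∀ k, k ≠ j → (K.lo k < x k ∧ x k < K.hi k) ∧ K'.lo k < x k ∧ x k < K'.hi k}

lemma measurableSet_commonFace (K K' : Box) (j : Fin 3) (b : Bool) :
    MeasurableSet (commonFace K K' j b) := by
  have hx : ∀ k : Fin 3, Measurable fun x : E3 => x k := fun k =>
    (by fun_prop : Continuous fun x : E3 => x k).measurable
  refine (measurableSet_eq_fun (hx j) measurable_const).inter
    ((measurableSet_eq_fun (hx j) measurable_const).inter ?_)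
  have : {x : E3 | ∀ k, k ≠ j → (K.lo k < x k ∧ x k < K.hi k) ∧ K'.lo k < x k ∧ x k < K'.hi k} =
      ⋂ k, ⋂ (_ : k ≠ j),
        {x : E3 | (K.lo k < x k ∧ x k < K.hi k) ∧ K'.lo k < x k ∧ x k < K'.hi k} := by
    ext x; simp
  change MeasurableSet {x : E3 | ∀ k, k ≠ j →
    (K.lo k < x k ∧ x k < K.hi k) ∧ K'.lo k < x k ∧ x k < K'.hi k}
  rw [this]
  refine MeasurableSet.iInter fun k => MeasurableSet.iInter fun _ => ?_
  exact ((measurableSet_lt measurable_const (hx k)).inter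
    (measurableSet_lt (hx k) measurable_const)).inter
    ((measurableSet_lt measurable_const (hx k)).inter (measurableSet_lt (hx k) measurable_const))

lemma commonFace_subset_face (K K' : Box) (j : Fin 3) (b : Bool) :
    commonFace K K' j b ⊆ K.face j b := by
  rintro x ⟨h1, -, h⟩
  refine ⟨?_, h1⟩
  rw [closure_carrier]
  intro k
  by_cases hk : k = j
  · subst hk
    have := (K.lt k).le
    rw [h1]
    cases b <;> simp [side, this]
  · exact ⟨(h k hk).1.1.le, (h k hk).1.2.le⟩

lemma eventually_mem_of_face {x : E3} {j : Fin 3} {b : Bool} (hx : x j = K.side j b)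
    (h : ∀ k, k ≠ j → K.lo k < x k ∧ x k < K.hi k) :
    ∀ᶠ t in 𝓝[>] (0 : ℝ), x + t • axisDir j (!b) ∈ K.carrier := by
  have hl := sub_pos.2 (K.lt j)
  filter_upwards [Ioo_mem_nhdsGT hl] with t ht k
  have ht0 := ht.1
  have ht1 := ht.2
  by_cases hk : k = j
  · subst hk
    cases b <;> simp [axisDir, side] at hx ⊢ <;> constructor <;> linarith
  · have := h k hk
    cases b <;> simpa [axisDir, hk] using this

lemma commonFace_left {x : E3} {j : Fin 3} {b : Bool} (hx : x ∈ commonFace K K' j b) :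
    ∀ᶠ t in 𝓝[>] (0 : ℝ), x + t • axisDir j (!b) ∈ K.carrier :=
  eventually_mem_of_face hx.1 fun k hk => (hx.2.2 k hk).1

lemma commonFace_right {x : E3} {j : Fin 3} {b : Bool} (hx : x ∈ commonFace K K' j b) :
    ∀ᶠ t in 𝓝[>] (0 : ℝ), x + t • axisDir j b ∈ K'.carrier := by
  have := eventually_mem_of_face hx.2.1 fun k hk => (hx.2.2 k hk).2
  rwa [Bool.not_not] at this

lemma commonFace_disjoint (h : Disjoint K'.carrier K''.carrier) (j : Fin 3) (b : Bool) :
    Disjoint (commonFace K K' j b) (commonFace K K'' j b) :=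
  Set.disjoint_left.2 fun _ hx hx' => by
    obtain ⟨t, h1, h2⟩ := ((commonFace_right hx).and (commonFace_right hx')).exists
    exact Set.disjoint_left.1 h h1 h2

/-- Disjoint boxes are separated in one of the coordinates. -/
lemma exists_separated (h : Disjoint K.carrier K'.carrier) :
    ∃ j, K.hi j ≤ K'.lo j ∨ K'.hi j ≤ K.lo j := by
  by_contra hcon
  push Not at hcon
  have hlt : ∀ j, max (K.lo j) (K'.lo j) < min (K.hi j) (K'.hi j) := fun j =>
    max_lt (lt_min (K.lt j) (hcon j).2) (lt_min (hcon j).1 (K'.lt j))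
  set z : E3 := WithLp.toLp 2 fun j => (max (K.lo j) (K'.lo j) + min (K.hi j) (K'.hi j)) / 2
  have hz : ∀ j, z j = (max (K.lo j) (K'.lo j) + min (K.hi j) (K'.hi j)) / 2 := fun _ => rfl
  refine h.notMem_of_mem_left (a := z) (fun j => ?_) (fun j => ?_)
  · have := hlt j
    have h1 := le_max_left (K.lo j) (K'.lo j)
    have h2 := min_le_left (K.hi j) (K'.hi j)
    rw [hz]
    constructor <;> linarith
  · have := hlt j
    have h1 := le_max_right (K.lo j) (K'.lo j)
    have h2 := min_le_right (K.hi j) (K'.hi j)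
    rw [hz]
    constructor <;> linarith

/-- The edges of the boxes have area zero. -/
lemma ae_mem_commonFace (h : Disjoint K.carrier K'.carrier) :
    ∀ᵐ x ∂area, x ∈ closure K.carrier → x ∈ closure K'.carrier →
      ∃ j b, x ∈ commonFace K K' j b := by
  have h0 : ∀ (j k : Fin 3) (c d : ℝ), ∀ᵐ x ∂area, k ≠ j → ¬ (x j = c ∧ x k = d) := by
    intro j k c d
    by_cases hk : k = j
    · exact ae_of_all _ fun x h => absurd hk h
    · have := area_coord_line hk c d
      rw [ae_iff]
      refine measure_mono_null (fun x hx => ?_) this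
      simpa [hk] using hx
  have h1 : ∀ᵐ x ∂area, ∀ (j k : Fin 3) (b b' : Bool), k ≠ j →
      ¬ (x j = K.side j b ∧ x k = K.side k b') :=
    ae_all_iff.2 fun j => ae_all_iff.2 fun k => ae_all_iff.2 fun b => ae_all_iff.2 fun b' =>
      h0 j k _ _
  have h2 : ∀ᵐ x ∂area, ∀ (j k : Fin 3) (b b' : Bool), k ≠ j →
      ¬ (x j = K.side j b ∧ x k = K'.side k b') :=
    ae_all_iff.2 fun j => ae_all_iff.2 fun k => ae_all_iff.2 fun b => ae_all_iff.2 fun b' =>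
      h0 j k _ _
  filter_upwards [h1, h2] with x hx1 hx2 hK hK'
  rw [closure_carrier] at hK hK'
  have key : ∀ j b, x j = K.side j b → x j = K'.side j (!b) → x ∈ commonFace K K' j b := by
    intro j b hj hj'
    refine ⟨hj, hj', fun k hk => ⟨⟨?_, ?_⟩, ?_, ?_⟩⟩
    · exact lt_of_le_of_ne (hK k).1 fun e => hx1 j k b false hk ⟨hj, by simp [side, e]⟩
    · exact lt_of_le_of_ne (hK k).2 fun e => hx1 j k b true hk ⟨hj, by simp [side, e]⟩
    · exact lt_of_le_of_ne (hK' k).1 fun e => hx2 j k b false hk ⟨hj, by simp [side, e]⟩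
    · exact lt_of_le_of_ne (hK' k).2 fun e => hx2 j k b true hk ⟨hj, by simp [side, e]⟩
  obtain ⟨j, hj | hj⟩ := exists_separated h
  · refine ⟨j, true, key j true ?_ ?_⟩ <;> simp [side] <;> linarith [(hK j).2, (hK' j).1]
  · refine ⟨j, false, key j false ?_ ?_⟩ <;> simp [side] <;> linarith [(hK j).1, (hK' j).2]

lemma area_face_lt_top (K : Box) (j : Fin 3) (b : Bool) : area (K.face j b) < ⊤ := by
  set L := axisFrame j
  obtain ⟨R, hR⟩ := K.isCompact_closure_carrier.isBounded.subset_closedBall 0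
  have hsub : K.face j b ⊆ (fun z => chart L z (K.side j b)) '' Metric.closedBall 0 R := by
    rintro y ⟨hy, hyj⟩
    refine ⟨proj L y, ?_, ?_⟩
    · have h1 := hR hy
      rw [mem_closedBall_zero_iff] at h1 ⊢
      exact (norm_proj_le L y).trans h1
    · have := chart_proj L y
      rwa [axisFrame_two, hyj] at this
  refine (measure_mono hsub).trans_lt
    ((area_image_le (lipschitzWith_chart_const L _) _).trans_lt ?_)
  rw [EuclideanSpace.euclideanHausdorffMeasure_eq_volume]
  exact ENNReal.mul_lt_top (by simp) measure_closedBall_lt_top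

end Box

/-! ### The two sides of a face -/

namespace Geometry

variable (G : Geometry)

lemma eventually_sub_of_mem {i : Fin 2} {x : E3} (hx : x ∈ G.sub i) (d : E3) :
    ∀ᶠ t in 𝓝[>] (0 : ℝ), x + t • d ∈ G.sub i :=
  (tendsto_line x d).eventually ((G.isOpen_sub i).mem_nhds hx)

lemma eventually_sub_zero {x d : E3} (hx : x ∈ G.Γ) (hd : inner ℝ d (outerNormal G.Ω₁ x) < 0) :
    ∀ᶠ t in 𝓝[>] (0 : ℝ), x + t • d ∈ G.sub 0 :=
  (isOuterNormal_outerNormal (G.c2_Ω₁.outerNormal_ne_zero hx)).eventually_mem hd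

lemma eventually_sub_one {x d : E3} (hx : x ∈ G.Γ) (hd : 0 < inner ℝ d (outerNormal G.Ω₁ x)) :
    ∀ᶠ t in 𝓝[>] (0 : ℝ), x + t • d ∈ G.sub 1 := by
  filter_upwards [(isOuterNormal_outerNormal
      (G.c2_Ω₁.outerNormal_ne_zero hx)).eventually_notMem hd,
    (tendsto_line x d).eventually (G.isOpen_Ω.mem_nhds (G.Γ_subset hx))] with t h1 h2
  exact ⟨h2, h1⟩

/-- In an axis direction, almost every ray from a point of a plane orthogonal to the axis starts
in one of the subdomains. -/
lemma ae_eventually_sub (j : Fin 3) (c : ℝ) :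
    ∀ᵐ x ∂area, x ∈ G.Ω → x j = c → ∀ b, ∃ i,
      ∀ᶠ t in 𝓝[>] (0 : ℝ), x + t • axisDir j b ∈ G.sub i := by
  have h : ∀ᵐ x ∂area, ∀ k, k ≠ j → ¬ (x ∈ G.Γ ∧ x j = c ∧ outerNormal G.Ω₁ x k ≠ 0) := by
    rw [ae_all_iff]
    intro k
    by_cases hk : k = j
    · exact ae_of_all _ fun x h => absurd hk h
    · have := area_tangential G.isOpen_Ω₁ hk c
      rw [ae_iff]
      refine measure_mono_null (fun x hx => ?_) this
      have hx : ¬ (k ≠ j → ¬ (x ∈ G.Γ ∧ x j = c ∧ outerNormal G.Ω₁ x k ≠ 0)) := hx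
      push Not at hx
      exact hx.2
  filter_upwards [h] with x hx hΩ hj b
  rcases G.mem_Ω_cases hΩ with ⟨i, hi⟩ | hΓ
  · exact ⟨i, G.eventually_sub_of_mem hi _⟩
  · set m := outerNormal G.Ω₁ x with hm
    have hm0 : m ≠ 0 := G.c2_Ω₁.outerNormal_ne_zero hΓ
    have hk : ∀ k, k ≠ j → m k = 0 := fun k hk => by
      by_contra hne
      exact hx k hk ⟨hΓ, hj, hne⟩
    have hmj : m j ≠ 0 := by
      intro h0
      refine hm0 (PiLp.ext fun k => ?_)
      by_cases hkj : k = j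
      · rw [hkj, h0]; rfl
      · rw [hk k hkj]; rfl
    have hin : inner ℝ (axisDir j b) m = (if b then (1 : ℝ) else -1) * m j := by
      rw [axisDir, real_inner_smul_left, EuclideanSpace.inner_single_left]; simp
    have hin0 : inner ℝ (axisDir j b) m ≠ 0 := by
      rw [hin]
      refine mul_ne_zero ?_ hmj
      cases b <;> simp
    rcases lt_or_gt_of_ne hin0 with h | h
    · exact ⟨0, G.eventually_sub_zero hΓ h⟩
    · exact ⟨1, G.eventually_sub_one hΓ h⟩

end Geometry

namespace Mesh

variable {G : Geometry} {M : Mesh G}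

/-- The element at the side `-n` of a face. -/
def minusElem : Face M.n → Fin M.n
  | .inl (.inl (K, _)) => K
  | .inl (.inr K) => K
  | .inr K => K

/-- The element at the side `n` of a face. -/
def plusElem : InnerFace M.n → Fin M.n
  | .inl (_, K') => K'
  | .inr K => K

lemma measurable_normal (f : Face M.n) : Measurable (M.normal f) := by
  rcases f with (⟨K, K'⟩ | K) | K
  · exact measurable_const
  · exact measurable_outerNormal _
  · exact measurable_outerNormal _

lemma measurable_neg_normal (f : Face M.n) : Measurable fun x => -(M.normal f x) :=
  (measurable_normal f).neg

lemma norm_normal_le (f : Face M.n) : ∃ C, ∀ x, ‖M.normal f x‖ ≤ C := by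
  rcases f with (⟨K, K'⟩ | K) | K
  · exact ⟨‖M.normal (.inl (.inl (K, K'))) 0‖, fun _ => le_rfl⟩
  · exact ⟨1, norm_outerNormal_le _⟩
  · exact ⟨1, norm_outerNormal_le _⟩

lemma faceSet_inner_of_ori {K K' : Fin M.n} (h : M.ori K K') :
    M.faceSet (.inl (.inl (K, K'))) =
      closure (M.elem K).carrier ∩ closure (M.elem K').carrier := if_pos h

lemma mem_faceDom_inner {K K' : Fin M.n} {x : E3} (hx : x ∈ M.faceDom (.inl (.inl (K, K')))) :
    M.ori K K' ∧ x ∈ closure (M.elem K).carrier ∧ x ∈ closure (M.elem K').carrier ∧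
      x ∈ G.Ω := by
  have h1 : x ∈ M.faceSet (.inl (.inl (K, K'))) := hx.1
  by_cases h : M.ori K K'
  · rw [faceSet_inner_of_ori h] at h1
    exact ⟨h, h1.1, h1.2, hx.2⟩
  · rw [faceSet, if_neg h] at h1
    exact absurd h1 (Set.notMem_empty x)

lemma measurableSet_faceDom (f : Face M.n) : MeasurableSet (M.faceDom f) := by
  rcases f with (⟨K, K'⟩ | K) | K
  · refine MeasurableSet.inter ?_ G.isOpen_Ω.measurableSet
    by_cases h : M.ori K K'
    · rw [faceSet_inner_of_ori h]
      exact (isClosed_closure.inter isClosed_closure).measurableSet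
    · rw [faceSet, if_neg h]; exact MeasurableSet.empty
  · exact (M.elem K).isOpen_carrier.measurableSet.inter isClosed_frontier.measurableSet
  · have e : M.faceDom (.inr K) =
        G.bd ∩ raySet (fun x => -(outerNormal G.Ω x)) (M.elem K).carrier := by
      ext x
      simp only [faceDom, faceSet, bdPiece, raySet, Set.mem_inter_iff, Set.mem_ofPred_eq,
        smul_neg, ← sub_eq_add_neg]
    rw [e]
    exact isClosed_frontier.measurableSet.inter
      (measurableSet_raySet (measurable_outerNormal _).neg (M.elem K).isOpen_carrier)

lemma ori_ne {K K' : Fin M.n} (h : M.ori K K') : K ≠ K' := fun e =>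
  M.ori_irrefl K' (e ▸ h)

lemma normal_of_mem_commonFace {K K' : Fin M.n} {j : Fin 3} {b : Bool} {x : E3}
    (hx : x ∈ (M.elem K).commonFace (M.elem K') j b) (y : E3) :
    M.normal (.inl (.inl (K, K'))) y = axisDir j b := by
  obtain ⟨h1, h2, h3⟩ := hx
  ext k
  simp only [normal, axisDir]
  by_cases hk : k = j
  · subst hk
    have e1 := (M.elem K).lt k
    have e2 := (M.elem K').lt k
    rw [h1] at h2
    cases b
    · simp only [Box.side, Bool.false_eq_true, if_false, Bool.not_false, if_true] at h2
      rw [if_neg (by intro h; linarith), if_pos h2]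
      simp
    · simp only [Box.side, Bool.false_eq_true, if_false, Bool.not_true, if_true] at h2
      rw [if_pos h2]
      simp
  · obtain ⟨⟨a1, a2⟩, a3, a4⟩ := h3 k hk
    rw [if_neg (by intro h; linarith), if_neg (by intro h; linarith)]
    cases b <;> simp [hk]

/-- Almost every point of an interior face lies in the relative interior of parallel faces of the
two elements, and the two rays orthogonal to the face start in a part of the elements in one of
the subdomains. -/
lemma ae_inner (K K' : Fin M.n) : ∀ᵐ x ∂(area.restrict (M.faceDom (.inl (.inl (K, K'))))),
    (∃ j b, x ∈ (M.elem K).commonFace (M.elem K') j b) ∧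
    (∃ i, x ∈ raySet (fun x => -(M.normal (.inl (.inl (K, K'))) x)) (M.piece K i)) ∧
    (∃ i, x ∈ raySet (M.normal (.inl (.inl (K, K')))) (M.piece K' i)) := by
  by_cases hori : M.ori K K'
  swap
  · filter_upwards [ae_restrict_mem (measurableSet_faceDom _)] with x hx
    exact absurd (mem_faceDom_inner hx).1 hori
  have hsub : ∀ᵐ x ∂area, ∀ j b, x ∈ G.Ω → x j = (M.elem K).side j b → ∀ b', ∃ i,
      ∀ᶠ t in 𝓝[>] (0 : ℝ), x + t • axisDir j b' ∈ G.sub i := by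
    simp only [ae_all_iff]
    exact fun j b => by
      filter_upwards [G.ae_eventually_sub j ((M.elem K).side j b)] with x hx using hx
  filter_upwards [ae_restrict_mem (measurableSet_faceDom _),
    ae_restrict_of_ae (Box.ae_mem_commonFace (M.disj (ori_ne hori))),
    ae_restrict_of_ae hsub] with x hx hx1 hx2
  obtain ⟨-, hK, hK', hΩ⟩ := mem_faceDom_inner hx
  obtain ⟨j, b, hjb⟩ := hx1 hK hK'
  have hn : M.normal (.inl (.inl (K, K'))) x = axisDir j b := normal_of_mem_commonFace hjb x
  refine ⟨⟨j, b, hjb⟩, ?_, ?_⟩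
  · obtain ⟨i, hi⟩ := hx2 j b hΩ hjb.1 (!b)
    refine ⟨i, ?_⟩
    simp only [raySet, Set.mem_ofPred_eq, hn, ← axisDir_not]
    exact (Box.commonFace_left hjb).and hi
  · obtain ⟨i, hi⟩ := hx2 j b hΩ hjb.1 b
    refine ⟨i, ?_⟩
    simp only [raySet, Set.mem_ofPred_eq, hn]
    exact (Box.commonFace_right hjb).and hi

lemma interface_minus {K : Fin M.n} {x : E3} (hx : x ∈ M.faceDom (.inl (.inr K))) :
    x ∈ raySet (fun x => -(M.normal (.inl (.inr K)) x)) (M.piece K 0) := by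
  obtain ⟨hK, hΓ⟩ : x ∈ (M.elem K).carrier ∩ G.Γ := hx
  refine Filter.Eventually.and
    ((tendsto_line x _).eventually ((M.elem K).isOpen_carrier.mem_nhds hK))
    (G.eventually_sub_zero hΓ ?_)
  have h0 : outerNormal G.Ω₁ x ≠ 0 := G.c2_Ω₁.outerNormal_ne_zero hΓ
  simp only [normal, inner_neg_left, real_inner_self_eq_norm_sq]
  have := norm_pos_iff.2 h0
  have : 0 < ‖outerNormal G.Ω₁ x‖ ^ 2 := by positivity
  linarith

lemma interface_plus {K : Fin M.n} {x : E3} (hx : x ∈ M.faceDom (.inl (.inr K))) :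
    x ∈ raySet (M.normal (.inl (.inr K))) (M.piece K 1) := by
  obtain ⟨hK, hΓ⟩ : x ∈ (M.elem K).carrier ∩ G.Γ := hx
  refine Filter.Eventually.and
    ((tendsto_line x _).eventually ((M.elem K).isOpen_carrier.mem_nhds hK))
    (G.eventually_sub_one hΓ ?_)
  have h0 : outerNormal G.Ω₁ x ≠ 0 := G.c2_Ω₁.outerNormal_ne_zero hΓ
  simp only [normal, real_inner_self_eq_norm_sq]
  have := norm_pos_iff.2 h0
  positivity

lemma boundary_minus {K : Fin M.n} {x : E3} (hx : x ∈ M.faceDom (.inr K))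
    (hn : M.normal (.inr K) x ≠ 0) :
    x ∈ raySet (fun x => -(M.normal (.inr K) x)) (M.piece K 1) := by
  obtain ⟨hbd, hK⟩ : x ∈ G.bd ∧ ∀ᶠ t in 𝓝[>] (0 : ℝ),
    x - t • outerNormal G.Ω x ∈ (M.elem K).carrier := hx
  have hn : outerNormal G.Ω x ≠ 0 := hn
  have hin : inner ℝ (-(outerNormal G.Ω x)) (outerNormal G.Ω x) < 0 := by
    have := norm_pos_iff.2 hn
    rw [inner_neg_left, real_inner_self_eq_norm_sq]
    have : 0 < ‖outerNormal G.Ω x‖ ^ 2 := by positivity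
    linarith
  have h1 := (isOuterNormal_outerNormal hn).eventually_mem hin
  have hx1 : x ∈ (closure G.Ω₁)ᶜ := fun h =>
    Set.disjoint_left.1 G.bd_disjoint hbd (G.closure_Ω₁ h)
  have h2 := (tendsto_line x (-(outerNormal G.Ω x))).eventually
    (isClosed_closure.isOpen_compl.mem_nhds hx1)
  change ∀ᶠ t in 𝓝[>] (0 : ℝ), x + t • -(outerNormal G.Ω x) ∈ M.piece K 1
  filter_upwards [hK, h1, h2] with t ht1 ht2 ht3
  refine ⟨?_, ht2, ht3⟩
  rwa [smul_neg, ← sub_eq_add_neg]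

lemma ae_minus (f : Face M.n) : ∀ᵐ x ∂(area.restrict (M.faceDom f)), -(M.normal f x) ≠ 0 →
    ∃ i, x ∈ raySet (fun x => -(M.normal f x)) (M.piece (minusElem f) i) := by
  rcases f with (⟨K, K'⟩ | K) | K
  · filter_upwards [ae_inner K K'] with x hx _ using hx.2.1
  · filter_upwards [ae_restrict_mem (measurableSet_faceDom _)] with x hx _
    exact ⟨0, interface_minus hx⟩
  · filter_upwards [ae_restrict_mem (measurableSet_faceDom _)] with x hx hn
    exact ⟨1, boundary_minus hx (neg_ne_zero.1 hn)⟩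

lemma ae_plus (f : InnerFace M.n) : ∀ᵐ x ∂(area.restrict (M.faceDom (.inl f))),
    M.normal (.inl f) x ≠ 0 →
    ∃ i, x ∈ raySet (M.normal (.inl f)) (M.piece (plusElem f) i) := by
  rcases f with ⟨K, K'⟩ | K
  · filter_upwards [ae_inner K K'] with x hx _ using hx.2.2
  · filter_upwards [ae_restrict_mem (measurableSet_faceDom _)] with x hx _
    exact ⟨1, interface_plus hx⟩

lemma area_faceDom_lt_top (f : Face M.n) : area (M.faceDom f) < ⊤ := by
  rcases f with (⟨K, K'⟩ | K) | K
  · have h : (M.faceDom (.inl (.inl (K, K'))) : Set E3) ≤ᵐ[area]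
        (⋃ j, ⋃ b, (M.elem K).face j b : Set E3) := by
      have := (ae_restrict_iff' (measurableSet_faceDom _)).1 (ae_inner K K')
      filter_upwards [this] with x hx hxf
      obtain ⟨⟨j, b, hjb⟩, -⟩ := hx hxf
      exact Set.mem_iUnion.2 ⟨j, Set.mem_iUnion.2 ⟨b, Box.commonFace_subset_face _ _ j b hjb⟩⟩
    refine (measure_mono_ae h).trans_lt ((measure_iUnion_le _).trans_lt ?_)
    rw [tsum_fintype]
    refine ENNReal.sum_lt_top.2 fun j _ => (measure_iUnion_le _).trans_lt ?_
    rw [tsum_fintype]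
    exact ENNReal.sum_lt_top.2 fun b _ => (M.elem K).area_face_lt_top j b
  · exact (measure_mono Set.inter_subset_right).trans_lt
      (G.c2_Ω₁.isLocallyGraph.area_frontier_lt_top
        (G.bounded_Ω.subset (subset_closure.trans G.closure_Ω₁)))
  · exact (measure_mono fun x hx => hx.1).trans_lt
      (G.lipschitz_Ω.isLocallyGraph.area_frontier_lt_top G.bounded_Ω)

instance isFiniteMeasure_faceDom (f : Face M.n) : IsFiniteMeasure (area.restrict (M.faceDom f)) :=
  ⟨by rw [Measure.restrict_apply_univ]; exact area_faceDom_lt_top f⟩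

/-! ### Traces and jumps of piecewise continuous fields -/

/-- The trace `v₋`, set to zero where there is no normal. -/
def traceM {V : Type*} [TopologicalSpace V] [Zero V] (f : Face M.n) : (E3 → V) → E3 → V :=
  sideTrace fun x => -(M.normal f x)

/-- The trace `v₊`, set to zero where there is no normal. -/
def traceP {V : Type*} [TopologicalSpace V] [Zero V] (f : Face M.n) : (E3 → V) → E3 → V :=
  sideTrace (M.normal f)

lemma traceM_eq {f : Face M.n} (v : E3 → C3) {x : E3} (h : M.normal f x ≠ 0) :
    traceM f v x = M.traceMinus f v x := by
  rw [traceM, sideTrace, if_neg (neg_ne_zero.2 h)]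
  rfl

lemma traceP_eq {f : Face M.n} (v : E3 → C3) {x : E3} (h : M.normal f x ≠ 0) :
    traceP f v x = M.tracePlus f v x := by
  rw [traceP, sideTrace, if_neg h]
  rfl

lemma tame_traceM {v : E3 → C3} (hv : M.PiecewiseCont v) (f : Face M.n) :
    Tame (area.restrict (M.faceDom f)) (traceM f v) :=
  hv.tame_sideTrace (measurable_neg_normal f) (ae_minus f)

lemma tame_traceP {v : E3 → C3} (hv : M.PiecewiseCont v) (f : InnerFace M.n) :
    Tame (area.restrict (M.faceDom (.inl f))) (traceP (.inl f) v) :=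
  hv.tame_sideTrace (measurable_normal _) (ae_plus f)

lemma continuous_toC3 : Continuous toC3 := by unfold toC3; fun_prop

lemma toC3_zero : toC3 0 = 0 := by ext i; simp [toC3]

lemma tame_toC3_normal (f : Face M.n) :
    Tame (area.restrict (M.faceDom f)) fun x => toC3 (M.normal f x) := by
  have h : Tame (area.restrict (M.faceDom f)) (M.normal f) := by
    refine ⟨(measurable_normal f).aestronglyMeasurable, ?_⟩
    obtain ⟨C, hC⟩ := M.norm_normal_le f
    exact ⟨C, ae_of_all _ hC⟩
  exact h.comp continuous_toC3

lemma continuous_cross : Continuous fun p : C3 × C3 => p.1 ⨯₃ p.2 := by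
  simp only [cross_apply]
  refine continuous_pi fun l => ?_
  fin_cases l <;> simp <;> fun_prop

lemma jumpT_of_normal_eq_zero {f : Face M.n} {x : E3} (h : M.normal f x = 0) (v : E3 → C3) :
    M.jumpT f v x = 0 := by
  rw [jumpT, h, toC3_zero, map_zero, LinearMap.zero_apply]

lemma tame_jumpT {v : E3 → C3} (hv : M.PiecewiseCont v) (f : Face M.n) :
    Tame (area.restrict (M.faceDom f)) (M.jumpT f v) := by
  have hn := tame_toC3_normal f
  rcases f with f | K
  · have h1 := hn.comp₂ ((tame_traceM hv (.inl f)).comp₂ (tame_traceP hv f) continuous_sub)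
      continuous_cross
    refine h1.congr (ae_of_all _ fun x => ?_)
    by_cases h : M.normal (.inl f) x = 0
    · simp only [jumpT_of_normal_eq_zero h, h, toC3_zero, map_zero, LinearMap.zero_apply]
    · simp only [jumpT, jump, traceM_eq v h, traceP_eq v h]
  · have h1 := hn.comp₂ (tame_traceM hv (.inr K)) continuous_cross
    refine h1.congr (ae_of_all _ fun x => ?_)
    by_cases h : M.normal (.inr K) x = 0
    · simp only [jumpT_of_normal_eq_zero h, h, toC3_zero, map_zero, LinearMap.zero_apply]
    · simp only [jumpT, jump, traceM_eq v h]

/-- Where there is no normal the tangential jump vanishes. -/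
lemma jumpT_dotProduct_traceMinus (f : Face M.n) (v t : E3 → C3) (x : E3) :
    M.jumpT f v x ⬝ᵥ star (M.traceMinus f t x) = M.jumpT f v x ⬝ᵥ star (traceM f t x) := by
  by_cases h : M.normal f x = 0
  · rw [jumpT_of_normal_eq_zero h, zero_dotProduct, zero_dotProduct]
  · rw [traceM_eq t h]

end Mesh

/-! ### The inverse trace inequality -/

namespace Mesh

variable {G : Geometry} {M : Mesh G} {δ₀ σ ρ : ℝ}

/-- The trace inequalities on one element: on the flat faces, on the interface and on the
boundary the traces of polynomial fields are controlled by the fields on the part of the element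
in a subdomain, uniformly in the element and how it is cut. -/
theorem exists_piece_trace (G : Geometry) (hδ : 0 < δ₀) (hδ1 : δ₀ < 1 / 2) (σ ρ : ℝ) :
    ∃ C : ℝ, 0 < C ∧ ∀ M : Mesh G, M.Admissible δ₀ σ ρ → ∀ p : ℕ, 1 ≤ p → ∀ K i,
      ∃ Q : Set E3, IsClosed Q ∧ M.piece K i ⊆ Q ∧
        ∀ q : Fin 3 → MvPolynomial (Fin 3) ℂ, (∀ l j, (q l).degreeOf j ≤ p) → ∀ S : Set E3,
          ((∃ j b, S = (M.elem K).face j b ∩ Q) ∨ (i = 0 ∧ S = (M.elem K).carrier ∩ G.Γ) ∨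
            (i = 1 ∧ S = (M.elem K).carrier ∩ G.bd)) →
          ∫⁻ x in S, ENNReal.ofReal (sqNorm (polyField q x)) ∂area ≤
            ENNReal.ofReal (C * (p : ℝ) ^ 2 / (M.elem K).h * M.ΘK p K) *
              ∫⁻ x in M.piece K i, ENNReal.ofReal (sqNorm (polyField q x)) := by
  obtain ⟨c₁, hc₁, h₁⟩ := G.c2_Ω₁.isLocallyGraph.exists_trace_const
    (G.bounded_Ω.subset (subset_closure.trans G.closure_Ω₁))
  obtain ⟨c₂, hc₂, h₂⟩ := G.lipschitz_Ω.isLocallyGraph.exists_trace_const G.bounded_Ω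
  set κ := coreRatio δ₀ σ with hκ
  have hκ0 : 0 < κ := coreRatio_pos hδ
  set d := Metric.diam G.Ω with hd
  have hd0 : 0 ≤ d := Metric.diam_nonneg
  set c := 50 + (c₁ + c₂) * (d + 25) with hc
  have hc0 : 0 < c := by positivity
  refine ⟨501 / κ * c, by positivity, fun M hM p hp K i => ?_⟩
  by_cases hne : (M.piece K i).Nonempty
  · obtain ⟨Q, A, hQ⟩ := hM.exists_hasCore hδ hδ1 p K i hne
    refine ⟨Q, hQ.core.compact.isClosed, hQ.subset, fun q hq S hS => ?_⟩
    refine lintegral_sqNorm_le (fun F hF => ?_) hq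
    set h := (M.elem K).h with hh
    have hh0 : 0 < h := (M.elem K).h_pos
    set Θ := M.ΘK p K with hΘ
    have hΘ1 : 1 ≤ Θ := hM.one_le_ΘK p K
    have hp1 : (1 : ℝ) ≤ p := by exact_mod_cast hp
    set a := (p : ℝ) ^ 2 / (κ * h) with ha
    have ha0 : 0 ≤ a := by positivity
    have h25 : (((3 * p : ℕ) : ℝ) + 2) ^ 2 / (κ * h) ≤ 25 * a := by
      rw [ha, ← mul_div_assoc]
      gcongr
      push_cast
      nlinarith
    -- the size of the core is at most the diameter of `Ω`, so that `p ^ 2 / h_K` is bounded below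
    have hda : 1 ≤ d * a := by
      rw [ha, ← mul_div_assoc, le_div_iff₀ (by positivity), one_mul]
      have h1 : κ * h ≤ d := hQ.le_diam
      have h2 : (1 : ℝ) ≤ (p : ℝ) ^ 2 := one_le_pow₀ hp1
      nlinarith
    -- it suffices to bound the integral over the core
    suffices hsuff : ∫⁻ x in S, ENNReal.ofReal (F x ^ 2) ∂area ≤
        ENNReal.ofReal (c * a) * ∫⁻ x in Q, ENNReal.ofReal (F x ^ 2) by
      refine hsuff.trans ((mul_le_mul_right (hQ.lintegral_le F hF) _).trans (le_of_eq ?_))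
      rw [← mul_assoc, ← ENNReal.ofReal_mul (by positivity)]
      congr 2
      rw [ha, hΘ]; field_simp
    have hsurf : ∀ c' : ℝ, 0 < c' → c' ≤ c₁ + c₂ →
        c' * (1 + (((3 * p : ℕ) : ℝ) + 2) ^ 2 / (κ * h)) ≤ c * a := by
      intro c' hc' hle
      have h1 : c' * (1 + (((3 * p : ℕ) : ℝ) + 2) ^ 2 / (κ * h)) ≤ (c₁ + c₂) * (d * a + 25 * a) := by
        gcongr
      have h2 : c * a = 50 * a + (c₁ + c₂) * (d * a + 25 * a) := by rw [hc]; ring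
      rw [h2]
      linarith
    rcases hS with ⟨j, b, rfl⟩ | ⟨rfl, rfl⟩ | ⟨rfl, rfl⟩
    · refine (hQ.core.face_trace hF j b).trans ?_
      refine mul_le_mul_left (ENNReal.ofReal_le_ofReal ?_) _
      have h1 : 2 * (((3 * p : ℕ) : ℝ) + 2) ^ 2 / (κ * h) ≤ 50 * a := by
        rw [mul_div_assoc]; linarith
      refine h1.trans (mul_le_mul_of_nonneg_right ?_ ha0)
      rw [hc]
      have : 0 ≤ (c₁ + c₂) * (d + 25) := by positivity
      linarith
    · refine (h₁ _ _ _ _ _ _ hQ.core hF hQ.subset).trans ?_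
      exact mul_le_mul_left (ENNReal.ofReal_le_ofReal (hsurf c₁ hc₁ (by linarith))) _
    · by_cases hB : M.MeetsBd K
      · have hsub : (M.elem K).carrier ∩ G.Ω ⊆ Q := by
          rintro x ⟨hxK, hx⟩
          have hΓ : ¬ M.MeetsΓ K := fun hΓ => hM.not_both K ⟨hΓ, hB⟩
          rcases G.mem_Ω_cases hx with ⟨i, hi⟩ | hxΓ
          · fin_cases i
            · exfalso
              have := Convex.subset_of_disjoint_frontier (M.elem K).convex_carrier G.isOpen_Ω₁
                ⟨x, hxK, hi⟩
                (Set.disjoint_iff_inter_eq_empty.2 (Set.not_nonempty_iff_eq_empty.1 hΓ))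
              obtain ⟨y, hyK, hy⟩ := hB
              exact Set.disjoint_left.1 G.bd_disjoint hy (G.sub_subset 0 (this hyK))
            · exact hQ.subset ⟨hxK, hi⟩
          · exact absurd ⟨x, hxK, hxΓ⟩ hΓ
        refine (h₂ _ _ _ _ _ _ hQ.core hF hsub).trans ?_
        exact mul_le_mul_left (ENNReal.ofReal_le_ofReal (hsurf c₂ hc₂ (by linarith))) _
      · rw [Set.not_nonempty_iff_eq_empty.1 hB, Measure.restrict_empty, lintegral_zero_measure]
        exact zero_le
  -- for an empty part all three kinds of sets are empty
  · have h0 : M.piece K i = ∅ := Set.not_nonempty_iff_eq_empty.1 hne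
    refine ⟨∅, isClosed_empty, h0.subset, fun q hq S hS => ?_⟩
    have hSe : S = ∅ := by
      rcases hS with ⟨j, b, rfl⟩ | ⟨rfl, rfl⟩ | ⟨rfl, rfl⟩
      · exact Set.inter_empty _
      · by_contra hcon
        obtain ⟨x, hxK, hx⟩ := Set.nonempty_iff_ne_empty.2 hcon
        obtain ⟨y, hyK, hy⟩ := mem_closure_iff.1 hx.1 _ (M.elem K).isOpen_carrier hxK
        exact hne ⟨y, hyK, hy⟩
      · by_contra hcon
        have hB : M.MeetsBd K := Set.nonempty_iff_ne_empty.2 hcon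
        have hΓ : ¬ M.MeetsΓ K := fun hΓ => hM.not_both K ⟨hΓ, hB⟩
        obtain ⟨x, hxK, hx⟩ := M.meets K
        rcases G.mem_Ω_cases hx with ⟨i, hi⟩ | hxΓ
        · fin_cases i
          · have := Convex.subset_of_disjoint_frontier (M.elem K).convex_carrier G.isOpen_Ω₁
              ⟨x, hxK, hi⟩
              (Set.disjoint_iff_inter_eq_empty.2 (Set.not_nonempty_iff_eq_empty.1 hΓ))
            obtain ⟨y, hyK, hy⟩ := hB
            exact Set.disjoint_left.1 G.bd_disjoint hy (G.sub_subset 0 (this hyK))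
          · exact hne ⟨x, hxK, hi⟩
        · exact hΓ ⟨x, hxK, hxΓ⟩
    rw [hSe, Measure.restrict_empty, lintegral_zero_measure]
    exact zero_le

lemma faceDom_subset (f : Face M.n) :
    M.faceDom f ⊆ M.faceSet f ∩ closure (M.elem (minusElem f)).carrier := by
  rcases f with (⟨K, K'⟩ | K) | K
  · intro x hx
    exact ⟨hx.1, (mem_faceDom_inner hx).2.1⟩
  · exact fun x hx => ⟨hx, subset_closure hx.1⟩
  · intro x hx
    refine ⟨hx, ?_⟩
    have h := hx.2
    have h' : x ∈ raySet (fun x => -(outerNormal G.Ω x)) (M.elem K).carrier := by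
      simp only [raySet, Set.mem_ofPred_eq, smul_neg, ← sub_eq_add_neg]
      exact h
    exact raySet_subset_closure _ _ h'

lemma faceH_pos (f : Face M.n) : 0 < M.faceH f := by
  rcases f with (⟨K, K'⟩ | K) | K
  · have h1 := (M.elem K).h_pos
    have h2 := (M.elem K').h_pos
    simp only [faceH]
    linarith
  · exact (M.elem K).h_pos
  · exact (M.elem K).h_pos

/-- The sizes of neighbours are comparable only across faces of positive area; the other faces do
not contribute. -/
lemma faceH_le (h : M.Admissible δ₀ σ ρ) {f : Face M.n} (hf : area (M.faceDom f) ≠ 0) :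
    M.faceH f ≤ (1 + |ρ|) * (M.elem (minusElem f)).h := by
  have key : ∀ K : Fin M.n, (M.elem K).h ≤ (1 + |ρ|) * (M.elem K).h := fun K => by
    have := (M.elem K).h_pos
    nlinarith [abs_nonneg ρ]
  rcases f with (⟨K, K'⟩ | K) | K
  · obtain ⟨x, hx⟩ := nonempty_of_measure_ne_zero hf
    have hori := (mem_faceDom_inner hx).1
    have hle : area (M.faceDom (.inl (.inl (K, K')))) ≤
        area (closure (M.elem K').carrier ∩ closure (M.elem K).carrier) := by
      refine measure_mono fun y hy => ?_
      have := mem_faceDom_inner hy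
      exact ⟨this.2.2.1, this.2.1⟩
    have h1 := h.comparable K' K (ori_ne hori).symm ((pos_iff_ne_zero.2 hf).trans_le hle)
    have h2 := (M.elem K).h_pos
    simp only [faceH, minusElem]
    nlinarith [le_abs_self ρ, abs_nonneg ρ]
  · exact key K
  · exact key K

lemma ΘK_le_ΘF (p : ℕ) {f : Face M.n} {K : Fin M.n}
    (hne : (M.faceSet f ∩ closure (M.elem K).carrier).Nonempty) : M.ΘK p K ≤ M.ΘF p f :=
  le_ciSup (f := fun K : {K : Fin M.n // (M.faceSet f ∩ closure (M.elem K).carrier).Nonempty} =>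
    M.ΘK p K.1) (Set.finite_range _).bddAbove ⟨K, hne⟩

lemma weight_pos (h : M.Admissible δ₀ σ ρ) {α₀ : ℝ} (hα : 0 < α₀) {p : ℕ} (hp : 1 ≤ p)
    {f : Face M.n} (hf : (M.faceDom f).Nonempty) : 0 < M.weight α₀ p f := by
  obtain ⟨x, hx⟩ := hf
  have h1 := h.one_le_ΘK p (minusElem f)
  have h2 := ΘK_le_ΘF p ⟨x, faceDom_subset f hx⟩
  have h3 := faceH_pos f
  have hp0 : (0 : ℝ) < p := by exact_mod_cast hp
  have h4 : 0 < M.ΘF p f := by linarith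
  rw [weight]
  positivity

lemma weight_inv_le (h : M.Admissible δ₀ σ ρ) {α₀ : ℝ} (hα : 0 < α₀) {p : ℕ} (hp : 1 ≤ p)
    {f : Face M.n} (hf : area (M.faceDom f) ≠ 0) :
    (M.weight α₀ p f)⁻¹ ≤ (1 + |ρ|) * (M.elem (minusElem f)).h /
      (α₀ * M.ΘK p (minusElem f) * (p : ℝ) ^ 2) := by
  obtain ⟨x, hx⟩ := nonempty_of_measure_ne_zero hf
  have h1 := h.one_le_ΘK p (minusElem f)
  have h2 := ΘK_le_ΘF p ⟨x, faceDom_subset f hx⟩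
  have h3 := faceH_pos f
  have hp0 : (0 : ℝ) < p := by exact_mod_cast hp
  have e : (M.weight α₀ p f)⁻¹ = M.faceH f / (α₀ * M.ΘF p f * (p : ℝ) ^ 2) := by
    rw [weight]
    have : 0 < M.ΘF p f := by linarith
    field_simp
  rw [e]
  have h4 : 0 < M.ΘK p (minusElem f) := by linarith
  exact div_le_div₀ (by have := (M.elem (minusElem f)).h_pos; positivity) (faceH_le h hf)
    (by positivity) (by gcongr)

lemma measurable_polyField_sq (q : Fin 3 → MvPolynomial (Fin 3) ℂ) :
    Measurable fun x => ENNReal.ofReal (sqNorm (polyField q x)) :=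
  (continuous_sqNorm.comp (continuous_polyField q)).measurable.ennreal_ofReal

section PieceSums

variable {t : E3 → C3} {q : Fin M.n → Fin 2 → Fin 3 → MvPolynomial (Fin 3) ℂ}
  {Q : Fin M.n → Fin 2 → Set E3}

lemma traceM_eq_polyField (hq : ∀ K i, Set.EqOn t (polyField (q K i)) (M.piece K i))
    {f : Face M.n} {i : Fin 2} {x : E3} (hn : M.normal f x ≠ 0)
    (hx : x ∈ raySet (fun x => -(M.normal f x)) (M.piece (minusElem f) i)) :
    traceM f t x = polyField (q (minusElem f) i) x :=
  sideTrace_eq (continuous_polyField _) (hq _ i) (neg_ne_zero.2 hn) hx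

lemma mem_core_of_ray (hQ : ∀ K i, IsClosed (Q K i)) (hQs : ∀ K i, M.piece K i ⊆ Q K i)
    {d : E3 → E3} {K : Fin M.n} {i : Fin 2} {x : E3} (hx : x ∈ raySet d (M.piece K i)) :
    x ∈ Q K i :=
  closure_minimal (hQs K i) (hQ K i) (raySet_subset_closure _ _ hx)

lemma lintegral_traceM_zero (f : Face M.n) {x : E3} (hn : M.normal f x = 0) :
    ENNReal.ofReal (sqNorm (traceM f t x)) = 0 := by
  rw [traceM, sideTrace, if_pos (neg_eq_zero.2 hn)]
  simp [sqNorm]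

/-- The neighbours of an element at one of its faces do not overlap, so that the traces on all the
interior faces together are bounded by those on the six closed faces. -/
lemma lintegral_inner_le (hq : ∀ K i, Set.EqOn t (polyField (q K i)) (M.piece K i))
    (hQ : ∀ K i, IsClosed (Q K i)) (hQs : ∀ K i, M.piece K i ⊆ Q K i) (K : Fin M.n) :
    ∑ K', ∫⁻ x in M.faceDom (.inl (.inl (K, K'))),
      ENNReal.ofReal (sqNorm (traceM (.inl (.inl (K, K'))) t x)) ∂area ≤
    ∑ i, ∑ j, ∑ b, ∫⁻ x in (M.elem K).face j b ∩ Q K i,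
      ENNReal.ofReal (sqNorm (polyField (q K i) x)) ∂area := by
  have hm : ∀ i j b K', MeasurableSet ((M.elem K).commonFace (M.elem K') j b ∩ Q K i) :=
    fun i j b K' => (Box.measurableSet_commonFace _ _ j b).inter (hQ K i).measurableSet
  have h1 : ∀ K', ∫⁻ x in M.faceDom (.inl (.inl (K, K'))),
      ENNReal.ofReal (sqNorm (traceM (.inl (.inl (K, K'))) t x)) ∂area ≤
      ∑ i, ∑ j, ∑ b, ∫⁻ x in (M.elem K).commonFace (M.elem K') j b ∩ Q K i,
        ENNReal.ofReal (sqNorm (polyField (q K i) x)) ∂area := by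
    intro K'
    have hmi : ∀ i j b, Measurable (((M.elem K).commonFace (M.elem K') j b ∩ Q K i).indicator
        fun x => ENNReal.ofReal (sqNorm (polyField (q K i) x))) := fun i j b =>
      (measurable_polyField_sq _).indicator (hm i j b K')
    have e : ∑ i, ∑ j, ∑ b, ∫⁻ x in (M.elem K).commonFace (M.elem K') j b ∩ Q K i,
        ENNReal.ofReal (sqNorm (polyField (q K i) x)) ∂area =
        ∫⁻ x, ∑ i, ∑ j, ∑ b, ((M.elem K).commonFace (M.elem K') j b ∩ Q K i).indicator
          (fun x => ENNReal.ofReal (sqNorm (polyField (q K i) x))) x ∂area := by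
      rw [lintegral_finsetSum _ fun i _ => Finset.measurable_fun_sum _ fun j _ =>
        Finset.measurable_fun_sum _ fun b _ => hmi i j b]
      refine Finset.sum_congr rfl fun i _ => ?_
      rw [lintegral_finsetSum _ fun j _ => Finset.measurable_fun_sum _ fun b _ => hmi i j b]
      refine Finset.sum_congr rfl fun j _ => ?_
      rw [lintegral_finsetSum _ fun b _ => hmi i j b]
      exact Finset.sum_congr rfl fun b _ => (lintegral_indicator (hm i j b K') _).symm
    rw [e]
    refine (lintegral_mono_ae ?_).trans (setLIntegral_le_lintegral _ _)
    filter_upwards [ae_inner K K'] with x hx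
    obtain ⟨⟨j, b, hjb⟩, ⟨i, hi⟩, -⟩ := hx
    have hn : M.normal (.inl (.inl (K, K'))) x ≠ 0 := by
      rw [normal_of_mem_commonFace hjb]; exact axisDir_ne_zero j b
    have hmem : x ∈ (M.elem K).commonFace (M.elem K') j b ∩ Q K i :=
      ⟨hjb, mem_core_of_ray hQ hQs hi⟩
    have e1 := traceM_eq_polyField hq hn hi
    rw [e1]
    have e2 : ENNReal.ofReal (sqNorm (polyField (q K i) x)) =
        ((M.elem K).commonFace (M.elem K') j b ∩ Q K i).indicator
          (fun x => ENNReal.ofReal (sqNorm (polyField (q K i) x))) x :=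
      (Set.indicator_of_mem hmem fun x => ENNReal.ofReal (sqNorm (polyField (q K i) x))).symm
    simp only [minusElem]
    rw [e2]
    refine le_trans ?_ (Finset.single_le_sum (fun _ _ => zero_le) (Finset.mem_univ i))
    refine le_trans ?_ (Finset.single_le_sum (fun _ _ => zero_le) (Finset.mem_univ j))
    exact Finset.single_le_sum (f := fun b => ((M.elem K).commonFace (M.elem K') j b ∩
      Q K i).indicator (fun x => ENNReal.ofReal (sqNorm (polyField (q K i) x))) x)
      (fun _ _ => zero_le) (Finset.mem_univ b)
  refine (Finset.sum_le_sum fun K' _ => h1 K').trans ?_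
  rw [Finset.sum_comm]
  refine Finset.sum_le_sum fun i _ => ?_
  rw [Finset.sum_comm]
  refine Finset.sum_le_sum fun j _ => ?_
  rw [Finset.sum_comm]
  refine Finset.sum_le_sum fun b _ => ?_
  -- the neighbours at one face of the element do not overlap
  have hd : Pairwise (Function.onFun Disjoint
      fun K' => (M.elem K).commonFace (M.elem K') j b ∩ Q K i) := fun K' K'' hne =>
    (Box.commonFace_disjoint (M.disj hne) j b).mono Set.inter_subset_left Set.inter_subset_left
  have h2 := lintegral_iUnion (μ := area) (fun K' => hm i j b K') hd
    fun x => ENNReal.ofReal (sqNorm (polyField (q K i) x))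
  rw [tsum_fintype] at h2
  rw [← h2]
  refine lintegral_mono_set (Set.iUnion_subset fun K' => ?_)
  exact Set.inter_subset_inter_left _ (Box.commonFace_subset_face _ _ j b)

lemma lintegral_interface_le (hq : ∀ K i, Set.EqOn t (polyField (q K i)) (M.piece K i))
    (K : Fin M.n) : ∫⁻ x in M.faceDom (.inl (.inr K)),
      ENNReal.ofReal (sqNorm (traceM (.inl (.inr K)) t x)) ∂area ≤
    ∫⁻ x in (M.elem K).carrier ∩ G.Γ, ENNReal.ofReal (sqNorm (polyField (q K 0) x)) ∂area := by
  refine setLIntegral_mono' (measurableSet_faceDom (M := M) (.inl (.inr K))) fun x hx => ?_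
  by_cases hn : M.normal (.inl (.inr K)) x = 0
  · rw [lintegral_traceM_zero _ hn]; exact zero_le
  · rw [traceM_eq_polyField hq hn (interface_minus hx)]
    exact le_rfl

/-- The boundary adjacent to an element consists of the part inside it and of parts of its faces. -/
lemma lintegral_boundary_le (hq : ∀ K i, Set.EqOn t (polyField (q K i)) (M.piece K i))
    (hQ : ∀ K i, IsClosed (Q K i)) (hQs : ∀ K i, M.piece K i ⊆ Q K i) (K : Fin M.n) :
    ∫⁻ x in M.faceDom (.inr K), ENNReal.ofReal (sqNorm (traceM (.inr K) t x)) ∂area ≤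
    (∫⁻ x in (M.elem K).carrier ∩ G.bd, ENNReal.ofReal (sqNorm (polyField (q K 1) x)) ∂area) +
      ∑ j, ∑ b, ∫⁻ x in (M.elem K).face j b ∩ Q K 1,
        ENNReal.ofReal (sqNorm (polyField (q K 1) x)) ∂area := by
  set s : E3 → ℝ≥0∞ := fun x => ENNReal.ofReal (sqNorm (polyField (q K 1) x)) with hs
  have hsm : Measurable s := measurable_polyField_sq _
  have hSm : MeasurableSet ((M.elem K).carrier ∩ G.bd) :=
    (M.elem K).isOpen_carrier.measurableSet.inter isClosed_frontier.measurableSet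
  have hfm : ∀ j b, MeasurableSet ((M.elem K).face j b ∩ Q K 1) := fun j b =>
    ((M.elem K).isClosed_face j b).measurableSet.inter (hQ K 1).measurableSet
  have e : (∫⁻ x in (M.elem K).carrier ∩ G.bd, s x ∂area) +
      ∑ j, ∑ b, ∫⁻ x in (M.elem K).face j b ∩ Q K 1, s x ∂area =
      ∫⁻ x, (((M.elem K).carrier ∩ G.bd).indicator s x +
        ∑ j, ∑ b, ((M.elem K).face j b ∩ Q K 1).indicator s x) ∂area := by
    rw [lintegral_add_left (hsm.indicator hSm), lintegral_indicator hSm,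
      lintegral_finsetSum _ fun j _ => Finset.measurable_fun_sum _ fun b _ =>
        hsm.indicator (hfm j b)]
    congr 1
    refine Finset.sum_congr rfl fun j _ => ?_
    rw [lintegral_finsetSum _ fun b _ => hsm.indicator (hfm j b)]
    exact Finset.sum_congr rfl fun b _ => (lintegral_indicator (hfm j b) _).symm
  rw [e]
  refine le_trans (setLIntegral_mono' (measurableSet_faceDom _) fun x hx => ?_)
    (setLIntegral_le_lintegral _ _)
  by_cases hn : M.normal (.inr K) x = 0
  · rw [lintegral_traceM_zero _ hn]; exact zero_le
  have hray := boundary_minus hx hn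
  rw [traceM_eq_polyField hq hn hray]
  by_cases hxK : x ∈ (M.elem K).carrier
  · have hmem : x ∈ (M.elem K).carrier ∩ G.bd := ⟨hxK, hx.1⟩
    rw [Set.indicator_of_mem hmem]
    exact le_self_add
  · obtain ⟨j, b, hjb⟩ := (M.elem K).exists_mem_face (faceDom_subset _ hx).2 hxK
    have hmem : x ∈ (M.elem K).face j b ∩ Q K 1 := ⟨hjb, mem_core_of_ray hQ hQs hray⟩
    refine le_trans ?_ le_add_self
    refine le_trans ?_ (Finset.single_le_sum (fun _ _ => zero_le) (Finset.mem_univ j))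
    refine le_trans ?_ (Finset.single_le_sum (f := fun b =>
      ((M.elem K).face j b ∩ Q K 1).indicator s x) (fun _ _ => zero_le) (Finset.mem_univ b))
    rw [Set.indicator_of_mem hmem]
    exact le_rfl

end PieceSums

/-- The square of the `L²` norm on `Ω`. -/
def normSq (M : Mesh G) (u : E3 → C3) : ℝ := ∑ K, ∫ x in (M.elem K).carrier ∩ G.Ω, sqNorm (u x)

lemma normSq_nonneg (u : E3 → C3) : 0 ≤ M.normSq u :=
  Finset.sum_nonneg fun _ _ => integral_nonneg fun _ => sqNorm_nonneg _

lemma dotProduct_star_self (z : C3) : z ⬝ᵥ star z = ((sqNorm z : ℝ) : ℂ) := by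
  simp only [dotProduct, sqNorm, Complex.ofReal_sum]
  refine Finset.sum_congr rfl fun l _ => ?_
  rw [Pi.star_apply, RCLike.star_def, Complex.mul_conj, Complex.normSq_eq_norm_sq]

lemma ip_self (u : E3 → C3) : M.ip u u = ((M.normSq u : ℝ) : ℂ) := by
  simp only [ip, normSq, dotProduct_star_self, Complex.ofReal_sum]
  exact Finset.sum_congr rfl fun K _ => integral_ofReal

instance isFiniteMeasure_elem (K : Fin M.n) :
    IsFiniteMeasure ((volume : Measure E3).restrict ((M.elem K).carrier ∩ G.Ω)) :=
  ⟨by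
    rw [Measure.restrict_apply_univ]
    exact (measure_mono (Set.inter_subset_left.trans subset_closure)).trans_lt
      (M.elem K).isCompact_closure_carrier.measure_lt_top⟩

lemma sum_lintegral_piece_le {u : E3 → C3} (hu : M.PiecewiseCont u) :
    ∑ K, ∑ i, ∫⁻ x in M.piece K i, ENNReal.ofReal (sqNorm (u x)) ≤
      ENNReal.ofReal (M.normSq u) := by
  rw [normSq, ENNReal.ofReal_sum_of_nonneg fun _ _ => integral_nonneg fun _ => sqNorm_nonneg _]
  refine Finset.sum_le_sum fun K _ => ?_
  rw [ofReal_integral_eq_lintegral_ofReal ((hu.tame_volume K).comp continuous_sqNorm).integrable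
    (ae_of_all _ fun _ => sqNorm_nonneg _)]
  have hd : Pairwise (Function.onFun Disjoint (M.piece K)) := fun i i' hne =>
    piece_disjoint (by simpa using hne)
  have h2 := lintegral_iUnion (μ := volume) (fun i => (isOpen_piece K i).measurableSet) hd
    fun x => ENNReal.ofReal (sqNorm (u x))
  rw [tsum_fintype] at h2
  rw [← h2]
  refine lintegral_mono_set (Set.iUnion_subset fun i => ?_)
  exact Set.inter_subset_inter_right _ (G.sub_subset i)

/-- The inverse trace inequality: the weighted traces `v₋` on all faces are controlled by the field,
uniformly in the mesh and the polynomial degree. -/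
theorem exists_inverse_trace (G : Geometry) {δ₀ : ℝ} (hδ : 0 < δ₀) (hδ1 : δ₀ < 1 / 2) (σ ρ : ℝ)
    {α₀ : ℝ} (hα : 0 < α₀) :
    ∃ C : ℝ, 0 < C ∧ ∀ M : Mesh G, M.Admissible δ₀ σ ρ → ∀ p : ℕ, 1 ≤ p → ∀ t ∈ M.Xp p,
      ∑ f : Face M.n, (M.weight α₀ p f)⁻¹ *
        ∫ x in M.faceDom f, sqNorm (traceM f t x) ∂area ≤ C * M.normSq t := by
  obtain ⟨C, hC, hmain⟩ := exists_piece_trace G hδ hδ1 σ ρ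
  set C₂ := C * (1 + |ρ|) / α₀ with hC₂
  have hC₂0 : 0 < C₂ := by positivity
  -- At most 13 sets carry traces from one part of an element: six faces with interior faces, the
  -- surface, and again six faces with parts of the boundary.
  refine ⟨13 * C₂, by positivity, fun M hM p hp t ht => ?_⟩
  have hpc := piecewiseCont_of_mem ht
  choose q hqd hq using exists_polyField ht
  choose Q hQ hQs hint using hmain M hM p hp
  have hp0 : (0 : ℝ) < p := by exact_mod_cast hp
  set B : Fin M.n → Fin 2 → ℝ≥0∞ := fun K i =>
    ∫⁻ x in M.piece K i, ENNReal.ofReal (sqNorm (polyField (q K i) x)) with hB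
  set E : Fin M.n → Fin 2 → ℝ≥0∞ := fun K i =>
    ENNReal.ofReal (C * (p : ℝ) ^ 2 / (M.elem K).h * M.ΘK p K) * B K i with hE
  set Z : Fin M.n → ℝ≥0∞ := fun K =>
    ENNReal.ofReal ((1 + |ρ|) * (M.elem K).h / (α₀ * M.ΘK p K * (p : ℝ) ^ 2)) with hZ
  set I : Face M.n → ℝ≥0∞ := fun f =>
    ∫⁻ x in M.faceDom f, ENNReal.ofReal (sqNorm (traceM f t x)) ∂area with hI
  -- `h_K`, `p` and `Θ_K` cancel between the weight and the trace inequality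
  have hZE : ∀ K i, Z K * E K i = ENNReal.ofReal C₂ * B K i := by
    intro K i
    have h1 := (M.elem K).h_pos
    have h2 : 0 < M.ΘK p K := by linarith [hM.one_le_ΘK p K]
    rw [hZ, hE]
    simp only
    rw [← mul_assoc, ← ENNReal.ofReal_mul (by positivity)]
    congr 2
    rw [hC₂]; field_simp
  have hface : ∀ K i j b, ∫⁻ x in (M.elem K).face j b ∩ Q K i,
      ENNReal.ofReal (sqNorm (polyField (q K i) x)) ∂area ≤ E K i := fun K i j b =>
    hint K i _ (hqd K i) _ (Or.inl ⟨j, b, rfl⟩)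
  have hfaces : ∀ K i, ∑ j, ∑ b, ∫⁻ x in (M.elem K).face j b ∩ Q K i,
      ENNReal.ofReal (sqNorm (polyField (q K i) x)) ∂area ≤ 6 * E K i := by
    intro K i
    refine (Finset.sum_le_sum fun j _ => Finset.sum_le_sum fun b _ => hface K i j b).trans
      (le_of_eq ?_)
    simp only [Finset.sum_const, Finset.card_univ, Fintype.card_bool, Fintype.card_fin,
      nsmul_eq_mul]
    rw [← mul_assoc]
    norm_num
  have hinner : ∀ K, ∑ K', I (.inl (.inl (K, K'))) ≤ 6 * E K 0 + 6 * E K 1 := by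
    intro K
    refine (lintegral_inner_le hq hQ hQs K).trans ?_
    rw [Fin.sum_univ_two]
    exact add_le_add (hfaces K 0) (hfaces K 1)
  have hΓ : ∀ K, I (.inl (.inr K)) ≤ E K 0 := fun K =>
    (lintegral_interface_le hq K).trans (hint K 0 _ (hqd K 0) _ (Or.inr (Or.inl ⟨rfl, rfl⟩)))
  have hbd : ∀ K, I (.inr K) ≤ E K 1 + 6 * E K 1 := fun K =>
    (lintegral_boundary_le hq hQ hQs K).trans (add_le_add
      (hint K 1 _ (hqd K 1) _ (Or.inr (Or.inr ⟨rfl, rfl⟩))) (hfaces K 1))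
  have hw : ∀ f, ENNReal.ofReal (M.weight α₀ p f)⁻¹ * I f ≤ Z (minusElem f) * I f := by
    intro f
    by_cases hf : area (M.faceDom f) = 0
    · have : I f = 0 := setLIntegral_measure_zero _ _ hf
      rw [this, mul_zero, mul_zero]
    · exact mul_le_mul_left (ENNReal.ofReal_le_ofReal (weight_inv_le hM hα hp hf)) _
  have htotal : ∑ f : Face M.n, ENNReal.ofReal (M.weight α₀ p f)⁻¹ * I f ≤
      ENNReal.ofReal (13 * C₂) * ∑ K, ∑ i, B K i := by
    refine (Finset.sum_le_sum fun f _ => hw f).trans ?_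
    rw [Fintype.sum_sum_type, Fintype.sum_sum_type, Fintype.sum_prod_type,
      ← Finset.sum_add_distrib, ← Finset.sum_add_distrib, Finset.mul_sum]
    refine Finset.sum_le_sum fun K _ => ?_
    simp only [minusElem]
    rw [← Finset.mul_sum, ← mul_add, ← mul_add]
    calc Z K * (∑ K', I (.inl (.inl (K, K'))) + I (.inl (.inr K)) + I (.inr K))
        ≤ Z K * ((6 * E K 0 + 6 * E K 1) + E K 0 + (E K 1 + 6 * E K 1)) := by
          gcongr
          · exact hinner K
          · exact hΓ K
          · exact hbd K
      _ ≤ Z K * (13 * E K 0 + 13 * E K 1) := by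
          refine mul_le_mul_right ?_ _
          have e : 6 * E K 0 + 6 * E K 1 + E K 0 + (E K 1 + 6 * E K 1) =
            7 * E K 0 + 13 * E K 1 := by ring
          rw [e]
          gcongr
          norm_num
      _ = 13 * (Z K * E K 0 + Z K * E K 1) := by ring
      _ = _ := by
          rw [hZE, hZE, Fin.sum_univ_two, ENNReal.ofReal_mul (by norm_num),
            ENNReal.ofReal_ofNat, ← mul_add]
          ring
  have hBt : ∑ K, ∑ i, B K i ≤ ENNReal.ofReal (M.normSq t) := by
    refine le_trans (le_of_eq ?_) (sum_lintegral_piece_le hpc)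
    refine Finset.sum_congr rfl fun K _ => Finset.sum_congr rfl fun i _ => ?_
    refine setLIntegral_congr_fun (isOpen_piece K i).measurableSet fun x hx => ?_
    simp only [hq K i hx]
  have hIr : ∀ f, I f = ENNReal.ofReal (∫ x in M.faceDom f, sqNorm (traceM f t x) ∂area) :=
    fun f => (ofReal_integral_eq_lintegral_ofReal
      ((tame_traceM hpc f).comp continuous_sqNorm).integrable
      (ae_of_all _ fun _ => sqNorm_nonneg _)).symm
  have hI0 : ∀ f, 0 ≤ ∫ x in M.faceDom f, sqNorm (traceM f t x) ∂area := fun f =>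
    integral_nonneg fun _ => sqNorm_nonneg _
  have hwnn : ∀ f, 0 ≤ (M.weight α₀ p f)⁻¹ * ∫ x in M.faceDom f, sqNorm (traceM f t x) ∂area := by
    intro f
    by_cases hf : (M.faceDom f).Nonempty
    · exact mul_nonneg (inv_nonneg.2 (weight_pos hM hα hp hf).le) (hI0 f)
    · rw [Set.not_nonempty_iff_eq_empty.1 hf, Measure.restrict_empty, integral_zero_measure,
        mul_zero]
  have hle : ∑ f : Face M.n, ENNReal.ofReal ((M.weight α₀ p f)⁻¹ *
      ∫ x in M.faceDom f, sqNorm (traceM f t x) ∂area) ≤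
        ENNReal.ofReal (13 * C₂) * ENNReal.ofReal (M.normSq t) := by
    refine le_trans (le_of_eq ?_) (htotal.trans (mul_le_mul_right hBt _))
    refine Finset.sum_congr rfl fun f _ => ?_
    rw [hIr f, ENNReal.ofReal_mul' (hI0 f)]
  rw [← ENNReal.ofReal_sum_of_nonneg fun f _ => hwnn f, ← ENNReal.ofReal_mul (by positivity)] at hle
  exact (ENNReal.ofReal_le_ofReal_iff (mul_nonneg (by positivity) (normSq_nonneg t))).1 hle

end Mesh

/-! ### The lifting operator -/

/-- Riesz representation for a positive definite Hermitian form on a finite-dimensional space. -/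
lemma exists_riesz {V : Type*} [AddCommGroup V] [Module ℂ V] [FiniteDimensional ℂ V]
    (B : V → V → ℂ) (hsymm : ∀ x y, star (B x y) = B y x)
    (hadd : ∀ x y z, B (x + y) z = B x z + B y z) (hsmul : ∀ (c : ℂ) x z, B (c • x) z = c * B x z)
    (hnonneg : ∀ x, 0 ≤ (B x x).re) (hdef : ∀ x, B x x = 0 → x = 0) (ℓ : V →ₗ[ℂ] ℂ) :
    ∃ w, ∀ t, B t w = ℓ t := by
  have hadd' : ∀ x y z, B x (y + z) = B x y + B x z := fun x y z => by
    rw [← hsymm, hadd, star_add, hsymm, hsymm]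
  have hsmul' : ∀ (c : ℂ) x z, B x (c • z) = star c * B x z := fun c x z => by
    rw [← hsymm, hsmul, star_mul', hsymm]
  let core : InnerProductSpace.Core ℂ V :=
    { inner := fun x y => B y x
      conj_inner_symm := fun x y => hsymm x y
      re_inner_nonneg := hnonneg
      add_left := fun x y z => hadd' z x y
      smul_left := fun x y c => hsmul' c y x
      definite := hdef }
  let _ : NormedAddCommGroup V := core.toNormedAddCommGroup
  let _ : InnerProductSpace ℂ V := InnerProductSpace.ofCore core.toCore
  have : CompleteSpace V := FiniteDimensional.complete ℂ V
  refine ⟨(InnerProductSpace.toDual ℂ V).symm (LinearMap.toContinuousLinearMap ℓ), fun t => ?_⟩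
  exact InnerProductSpace.toDual_symm_apply (x := t) (y := LinearMap.toContinuousLinearMap ℓ)

namespace Mesh

variable {G : Geometry} {M : Mesh G}

/-- The finite element space as a space of functions. -/
def XpSubmodule (M : Mesh G) (p : ℕ) : Submodule ℂ (E3 → C3) where
  carrier := M.Xp p
  zero_mem' := ⟨fun _ _ => ⟨0, fun l j => by simp, fun x _ l => by simp⟩, fun _ _ => rfl⟩
  add_mem' := by
    intro u v hu hv
    refine ⟨fun K i => ?_, fun x hx => ?_⟩
    · obtain ⟨q, hq, hqu⟩ := hu.1 K i
      obtain ⟨r, hr, hrv⟩ := hv.1 K i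
      refine ⟨q + r, fun l j => (MvPolynomial.degreeOf_add_le _ _ _).trans (max_le (hq l j) (hr l j)),
        fun x hx l => ?_⟩
      rw [Pi.add_apply, Pi.add_apply, hqu x hx l, hrv x hx l, Pi.add_apply, map_add]
    · rw [Pi.add_apply, hu.2 x hx, hv.2 x hx, add_zero]
  smul_mem' := by
    intro c u hu
    refine ⟨fun K i => ?_, fun x hx => ?_⟩
    · obtain ⟨q, hq, hqu⟩ := hu.1 K i
      refine ⟨fun l => MvPolynomial.C c * q l, fun l j =>
        (MvPolynomial.degreeOf_C_mul_le _ _ _).trans (hq l j), fun x hx l => ?_⟩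
      rw [Pi.smul_apply, Pi.smul_apply, hqu x hx l, map_mul, MvPolynomial.eval_C, smul_eq_mul]
    · rw [Pi.smul_apply, hu.2 x hx, smul_zero]

lemma mem_XpSubmodule {p : ℕ} {v : E3 → C3} : v ∈ M.XpSubmodule p ↔ v ∈ M.Xp p := Iff.rfl

open Classical in
/-- The piecewise polynomial field with given polynomials on the parts of the elements. -/
def assemble (M : Mesh G) (p : ℕ) :
    (Fin M.n → Fin 2 → Fin 3 → MvPolynomial.restrictDegree (Fin 3) ℂ p) →ₗ[ℂ] (E3 → C3) where
  toFun q x := fun l => ∑ K, ∑ i, if x ∈ M.piece K i then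
    MvPolynomial.eval (coords x) (q K i l : MvPolynomial (Fin 3) ℂ) else 0
  map_add' q r := by
    ext x l
    simp only [Pi.add_apply, Submodule.coe_add, map_add, ← Finset.sum_add_distrib]
    refine Finset.sum_congr rfl fun K _ => Finset.sum_congr rfl fun i _ => ?_
    split_ifs <;> simp
  map_smul' c q := by
    ext x l
    simp only [Pi.smul_apply, Submodule.coe_smul, MvPolynomial.smul_eval, smul_eq_mul,
      RingHom.id_apply, Finset.mul_sum, mul_ite, mul_zero]

lemma assemble_apply {p : ℕ}
    (q : Fin M.n → Fin 2 → Fin 3 → MvPolynomial.restrictDegree (Fin 3) ℂ p)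
    {K : Fin M.n} {i : Fin 2} {x : E3} (hx : x ∈ M.piece K i) (l : Fin 3) :
    M.assemble p q x l = MvPolynomial.eval (coords x) (q K i l : MvPolynomial (Fin 3) ℂ) := by
  have h : ∀ K' i', (K', i') ≠ (K, i) → x ∉ M.piece K' i' := fun K' i' hne hx' =>
    Set.disjoint_left.1 (piece_disjoint hne) hx' hx
  simp only [assemble, LinearMap.coe_mk, AddHom.coe_mk]
  rw [Finset.sum_eq_single K, Finset.sum_eq_single i, if_pos hx]
  · exact fun i' _ hne => if_neg (h K i' fun e => hne (congrArg Prod.snd e))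
  · exact fun h => absurd (Finset.mem_univ _) h
  · exact fun K' _ hne => Finset.sum_eq_zero fun i' _ =>
      if_neg (h K' i' fun e => hne (congrArg Prod.fst e))
  · exact fun h => absurd (Finset.mem_univ _) h

lemma XpSubmodule_le_range (p : ℕ) : M.XpSubmodule p ≤ LinearMap.range (M.assemble p) := by
  intro v hv
  choose q hqd hq using hv.1
  have hmem : ∀ K i l, q K i l ∈ MvPolynomial.restrictDegree (Fin 3) ℂ p := fun K i l =>
    (MvPolynomial.mem_restrictDegree _ _ _).2 fun s hs j =>
      MvPolynomial.degreeOf_le_iff.1 (hqd K i l j) s hs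
  refine ⟨fun K i l => ⟨q K i l, hmem K i l⟩, ?_⟩
  ext x l
  by_cases hx : ∃ K i, x ∈ M.piece K i
  · obtain ⟨K, i, hx⟩ := hx
    rw [assemble_apply _ hx]
    exact (hq K i x hx l).symm
  · push Not at hx
    rw [hv.2 x hx]
    simp only [assemble, LinearMap.coe_mk, AddHom.coe_mk, Pi.zero_apply]
    exact Finset.sum_eq_zero fun K _ => Finset.sum_eq_zero fun i _ => if_neg (hx K i)

instance finiteDimensional_XpSubmodule (p : ℕ) : FiniteDimensional ℂ (M.XpSubmodule p) :=
  Submodule.finiteDimensional_of_le (XpSubmodule_le_range p)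

lemma continuous_dotProduct_star : Continuous fun z : C3 × C3 => z.1 ⬝ᵥ star z.2 :=
  Continuous.dotProduct continuous_fst continuous_snd.star

lemma PiecewiseCont.integrable_ip {u v : E3 → C3} (hu : M.PiecewiseCont u)
    (hv : M.PiecewiseCont v) (K : Fin M.n) :
    Integrable (fun x => u x ⬝ᵥ star (v x)) (volume.restrict ((M.elem K).carrier ∩ G.Ω)) :=
  ((hu.comp₂ hv continuous_dotProduct_star).tame_volume K).integrable

lemma ip_add {u v w : E3 → C3} (hu : M.PiecewiseCont u) (hv : M.PiecewiseCont v)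
    (hw : M.PiecewiseCont w) : M.ip (u + v) w = M.ip u w + M.ip v w := by
  simp only [ip, ← Finset.sum_add_distrib]
  refine Finset.sum_congr rfl fun K _ => ?_
  rw [← integral_add (hu.integrable_ip hw K) (hv.integrable_ip hw K)]
  exact integral_congr_ae (ae_of_all _ fun x => add_dotProduct _ _ _)

lemma ip_smul (c : ℂ) (u w : E3 → C3) : M.ip (c • u) w = c * M.ip u w := by
  simp only [ip, Finset.mul_sum]
  refine Finset.sum_congr rfl fun K _ => ?_
  rw [← integral_const_mul]
  exact integral_congr_ae (ae_of_all _ fun x => smul_dotProduct c (u x) (star (w x)))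

lemma star_dotProduct_star (z w : C3) : star (z ⬝ᵥ star w) = w ⬝ᵥ star z := by
  simp only [dotProduct, star_sum, star_mul', Pi.star_apply, star_star, mul_comm]

lemma star_ip (u v : E3 → C3) : star (M.ip u v) = M.ip v u := by
  simp only [ip, star_sum]
  refine Finset.sum_congr rfl fun K _ => ?_
  rw [RCLike.star_def, ← integral_conj]
  exact integral_congr_ae (ae_of_all _ fun x => star_dotProduct_star _ _)

/-- The `L²` inner product is definite on the finite element space. -/
lemma eq_zero_of_normSq_eq_zero {p : ℕ} {v : E3 → C3} (hv : v ∈ M.Xp p) (h : M.normSq v = 0) :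
    v = 0 := by
  have h1 := sum_lintegral_piece_le (piecewiseCont_of_mem hv)
  rw [h, ENNReal.ofReal_zero, nonpos_iff_eq_zero] at h1
  funext x
  by_cases hx : ∃ K i, x ∈ M.piece K i
  · obtain ⟨K, i, hx⟩ := hx
    obtain ⟨q, -, hq⟩ := exists_polyField hv K i
    have h2 := Finset.sum_eq_zero_iff.1 (Finset.sum_eq_zero_iff.1 h1 K (Finset.mem_univ _)) i
      (Finset.mem_univ _)
    have h3 : ∫⁻ x in M.piece K i, ENNReal.ofReal (sqNorm (polyField q x)) = 0 := by
      rw [← h2]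
      refine setLIntegral_congr_fun (isOpen_piece K i).measurableSet fun x hx => ?_
      simp only [hq hx]
    rw [lintegral_eq_zero_iff (measurable_polyField_sq q)] at h3
    have h4 : polyField q =ᵐ[volume.restrict (M.piece K i)] 0 := by
      filter_upwards [h3] with y hy
      have hy : sqNorm (polyField q y) ≤ 0 := ENNReal.ofReal_eq_zero.1 hy
      have hy0 := le_antisymm hy (sqNorm_nonneg _)
      rw [sqNorm, Finset.sum_eq_zero_iff_of_nonneg fun _ _ => by positivity] at hy0
      funext l
      simpa using hy0 l (Finset.mem_univ l)
    have h5 := Measure.eqOn_open_of_ae_eq h4 (isOpen_piece K i)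
      (continuous_polyField q).continuousOn continuousOn_const
    rw [hq hx, h5 hx]
  · push Not at hx
    exact hv.2 x hx

lemma traceM_add_ae {u v : E3 → C3} (hu : M.PiecewiseCont u) (hv : M.PiecewiseCont v)
    (f : Face M.n) : ∀ᵐ x ∂(area.restrict (M.faceDom f)),
      traceM f (u + v) x = traceM f u x + traceM f v x := by
  choose g hg hug using hu
  choose k hk hvk using hv
  filter_upwards [ae_minus f] with x hx
  by_cases hn : -(M.normal f x) = 0
  · simp only [traceM, sideTrace, hn, if_true, add_zero]
  · obtain ⟨i, hi⟩ := hx hn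
    simp only [traceM]
    rw [sideTrace_eq (d := fun x => -(M.normal f x)) (hg _ i) (hug _ i) hn hi,
      sideTrace_eq (d := fun x => -(M.normal f x)) (hk _ i) (hvk _ i) hn hi,
      sideTrace_eq (d := fun x => -(M.normal f x)) (g := fun x => g _ i x + k _ i x)
        ((hg _ i).add (hk _ i)) (fun y hy => by rw [Pi.add_apply, hug _ i hy, hvk _ i hy]) hn hi]

lemma traceM_smul_ae {u : E3 → C3} (c : ℂ) (hu : M.PiecewiseCont u) (f : Face M.n) :
    ∀ᵐ x ∂(area.restrict (M.faceDom f)), traceM f (c • u) x = c • traceM f u x := by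
  choose g hg hug using hu
  filter_upwards [ae_minus f] with x hx
  by_cases hn : -(M.normal f x) = 0
  · simp only [traceM, sideTrace, hn, if_true, smul_zero]
  · obtain ⟨i, hi⟩ := hx hn
    simp only [traceM]
    rw [sideTrace_eq (d := fun x => -(M.normal f x)) (hg _ i) (hug _ i) hn hi,
      sideTrace_eq (d := fun x => -(M.normal f x)) (g := fun x => c • g _ i x)
        ((hg _ i).const_smul c) (fun y hy => by rw [Pi.smul_apply, hug _ i hy]) hn hi]

lemma integrable_trace_jumpT {v t : E3 → C3} (hv : M.PiecewiseCont v) (ht : M.PiecewiseCont t)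
    (f : Face M.n) : Integrable (fun x => traceM f t x ⬝ᵥ star (M.jumpT f v x))
      (area.restrict (M.faceDom f)) :=
  ((tame_traceM ht f).comp₂ (tame_jumpT hv f) continuous_dotProduct_star).integrable

/-- The functional that the lifting of `v` represents. -/
def liftingFunctional {p : ℕ} {v : E3 → C3} (hv : v ∈ M.Xp p) : M.XpSubmodule p →ₗ[ℂ] ℂ where
  toFun t := ∑ f : Face M.n, ∫ x in M.faceDom f,
    traceM f (t : E3 → C3) x ⬝ᵥ star (M.jumpT f v x) ∂area
  map_add' s t := by
    have hs := piecewiseCont_of_mem (mem_XpSubmodule.1 s.2)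
    have ht := piecewiseCont_of_mem (mem_XpSubmodule.1 t.2)
    rw [← Finset.sum_add_distrib]
    refine Finset.sum_congr rfl fun f _ => ?_
    rw [← integral_add (integrable_trace_jumpT (piecewiseCont_of_mem hv) hs f)
      (integrable_trace_jumpT (piecewiseCont_of_mem hv) ht f)]
    refine integral_congr_ae ?_
    filter_upwards [traceM_add_ae hs ht f] with x hx
    rw [Submodule.coe_add, hx, add_dotProduct]
  map_smul' c t := by
    have ht := piecewiseCont_of_mem (mem_XpSubmodule.1 t.2)
    rw [RingHom.id_apply, smul_eq_mul, Finset.mul_sum]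
    refine Finset.sum_congr rfl fun f _ => ?_
    rw [← integral_const_mul]
    refine integral_congr_ae ?_
    filter_upwards [traceM_smul_ae c ht f] with x hx
    rw [Submodule.coe_smul, hx, smul_dotProduct, smul_eq_mul]

theorem existsUnique_isLifting {p : ℕ} {v : E3 → C3} (hv : v ∈ M.Xp p) :
    ∃! w, M.IsLifting p v w := by
  have hpc : ∀ t : M.XpSubmodule p, M.PiecewiseCont (t : E3 → C3) := fun t =>
    piecewiseCont_of_mem (mem_XpSubmodule.1 t.2)
  obtain ⟨w, hw⟩ := exists_riesz
    (B := fun s t : M.XpSubmodule p => M.ip (s : E3 → C3) (t : E3 → C3))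
    (fun s t => star_ip _ _) (fun s t r => ip_add (hpc s) (hpc t) (hpc r))
    (fun c s r => ip_smul c _ _)
    (fun s => by rw [ip_self, Complex.ofReal_re]; exact normSq_nonneg _)
    (fun s hs => Subtype.ext (eq_zero_of_normSq_eq_zero (mem_XpSubmodule.1 s.2) (by
      rw [ip_self] at hs; exact_mod_cast hs)))
    (liftingFunctional hv)
  have hlift : M.IsLifting p v w := by
    refine ⟨w.2, fun t ht => ?_⟩
    have h1 := congrArg star (hw ⟨t, ht⟩)
    simp only [star_ip] at h1
    rw [h1, liftingFunctional, LinearMap.coe_mk, AddHom.coe_mk, star_sum]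
    refine Finset.sum_congr rfl fun f _ => ?_
    rw [RCLike.star_def, ← integral_conj]
    refine integral_congr_ae (ae_of_all _ fun x => ?_)
    simp only [jumpT_dotProduct_traceMinus]
    exact star_dotProduct_star _ _
  refine ⟨w, hlift, fun w' hw' => ?_⟩
  have hd : w' - (w : E3 → C3) ∈ M.XpSubmodule p := (M.XpSubmodule p).sub_mem hw'.1 w.2
  have hdpc : M.PiecewiseCont (w' - (w : E3 → C3)) :=
    piecewiseCont_of_mem (mem_XpSubmodule.1 hd)
  have h1 : M.ip w' (w' - (w : E3 → C3)) = M.ip w (w' - (w : E3 → C3)) :=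
    (hw'.2 _ hd).trans (hlift.2 _ hd).symm
  have h2 := ip_add hdpc (hpc w) hdpc
  rw [sub_add_cancel, h1, right_eq_add, ip_self] at h2
  exact sub_eq_zero.1 (eq_zero_of_normSq_eq_zero hd (by exact_mod_cast h2))

end Mesh

/-! ### Coercivity -/

lemma sqNorm_le_two_mul_sub (z w : C3) : sqNorm z ≤ 2 * sqNorm (z - w) + 2 * sqNorm w := by
  simp only [sqNorm, Finset.mul_sum, ← Finset.sum_add_distrib, Pi.sub_apply]
  refine Finset.sum_le_sum fun l _ => ?_
  have h1 : ‖z l‖ ≤ ‖z l - w l‖ + ‖w l‖ := by simpa using norm_add_le (z l - w l) (w l)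
  have h2 : ‖z l‖ ^ 2 ≤ (‖z l - w l‖ + ‖w l‖) ^ 2 := by gcongr
  nlinarith [sq_nonneg (‖z l - w l‖ - ‖w l‖)]

/-- Young's inequality in `ℂ³`. -/
lemma re_dotProduct_star_le (z w : C3) {a : ℝ} (ha : 0 < a) :
    (z ⬝ᵥ star w).re ≤ a / 2 * sqNorm z + a⁻¹ / 2 * sqNorm w := by
  simp only [dotProduct, sqNorm, Complex.re_sum, Finset.mul_sum, ← Finset.sum_add_distrib]
  refine Finset.sum_le_sum fun l _ => ?_
  have h1 : (z l * star w l).re ≤ ‖z l‖ * ‖w l‖ := by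
    refine (Complex.re_le_norm _).trans (le_of_eq ?_)
    rw [norm_mul, Pi.star_apply, norm_star]
  have h2 : a / 2 * ‖z l‖ ^ 2 + a⁻¹ / 2 * ‖w l‖ ^ 2 - ‖z l‖ * ‖w l‖ =
      a⁻¹ / 2 * (a * ‖z l‖ - ‖w l‖) ^ 2 := by
    field_simp
    ring
  have h3 : 0 ≤ a⁻¹ / 2 * (a * ‖z l‖ - ‖w l‖) ^ 2 := by positivity
  linarith

namespace Mesh

variable {G : Geometry} {M : Mesh G}

lemma PiecewiseCont.sub {u v : E3 → C3} (hu : M.PiecewiseCont u) (hv : M.PiecewiseCont v) :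
    M.PiecewiseCont fun x => u x - v x := hu.comp₂ hv continuous_sub

lemma PiecewiseCont.integrable_sqNorm {u : E3 → C3} (hu : M.PiecewiseCont u) (K : Fin M.n) :
    Integrable (fun x => sqNorm (u x)) (volume.restrict ((M.elem K).carrier ∩ G.Ω)) :=
  ((hu.tame_volume K).comp continuous_sqNorm).integrable

lemma isLifting_lifting {p : ℕ} {v : E3 → C3} (hv : v ∈ M.Xp p) :
    M.IsLifting p v (M.lifting p v) := by
  have h : ∃ w, M.IsLifting p v w := (existsUnique_isLifting hv).exists
  rw [lifting, dif_pos h]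
  exact h.choose_spec

lemma normSq_le_two_mul_sub {u w : E3 → C3} (hu : M.PiecewiseCont u) (hw : M.PiecewiseCont w) :
    M.normSq u ≤ 2 * M.normSq (fun x => u x - w x) + 2 * M.normSq w := by
  simp only [normSq, Finset.mul_sum, ← Finset.sum_add_distrib]
  refine Finset.sum_le_sum fun K _ => ?_
  have h1 := (hu.sub hw).integrable_sqNorm K
  have h2 := hw.integrable_sqNorm K
  rw [← integral_const_mul, ← integral_const_mul, ← integral_add (h1.const_mul 2) (h2.const_mul 2)]
  exact integral_mono (hu.integrable_sqNorm K) ((h1.const_mul 2).add (h2.const_mul 2))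
    fun x => sqNorm_le_two_mul_sub _ _

/-- Almost every point of an element inside `Ω` lies in one of the subdomains. -/
lemma ae_mem_sub (K : Fin M.n) :
    ∀ᵐ x ∂(volume.restrict ((M.elem K).carrier ∩ G.Ω)), ∃ i, x ∈ G.sub i := by
  have hΓ : ∀ᵐ x ∂(volume.restrict ((M.elem K).carrier ∩ G.Ω)), x ∉ G.Γ :=
    ae_restrict_of_ae (by simpa [ae_iff] using G.volume_Γ)
  filter_upwards [hΓ, ae_restrict_mem ((M.elem K).isOpen_carrier.inter G.isOpen_Ω).measurableSet]
    with x hx hxK using (G.mem_Ω_cases hxK.2).resolve_right hx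

/-- The `L²` norm with weight `μ⁻¹`, where `μ₁, μ₂ > 0`, dominates the norm without weight. -/
lemma normSq_le_weighted {μ : Fin 2 → ℝ} (hμ : ∀ i, 0 < μ i) {u : E3 → C3}
    (hu : M.PiecewiseCont u) :
    M.normSq u ≤ (μ 0 + μ 1) *
      ∑ K, ∫ x in (M.elem K).carrier ∩ G.Ω, (G.coef μ x)⁻¹ * sqNorm (u x) := by
  rw [normSq, Finset.mul_sum]
  refine Finset.sum_le_sum fun K _ => ?_
  have hc : M.PiecewiseCont fun x => (G.coef μ x)⁻¹ := fun _ i =>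
    ⟨fun _ => (μ i)⁻¹, continuous_const, fun x hx => by simp only [G.coef_eq μ hx.2]⟩
  have hi : Integrable (fun x => (G.coef μ x)⁻¹ * sqNorm (u x))
      (volume.restrict ((M.elem K).carrier ∩ G.Ω)) :=
    ((hc.comp₂ hu (Φ := fun q : ℝ × C3 => q.1 * sqNorm q.2)
      (continuous_fst.mul (continuous_sqNorm.comp continuous_snd))).tame_volume K).integrable
  rw [← integral_const_mul]
  refine integral_mono_ae (hu.integrable_sqNorm K) (hi.const_mul _) ?_
  filter_upwards [ae_mem_sub K] with x hx
  obtain ⟨i, hi⟩ := hx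
  rw [G.coef_eq μ hi, ← mul_assoc]
  refine le_mul_of_one_le_left (sqNorm_nonneg _) ?_
  rw [← div_eq_mul_inv, one_le_div (hμ i)]
  have h0 := hμ 0
  have h1 := hμ 1
  fin_cases i <;> simp <;> linarith

lemma weight_mul_integral_nonneg {δ₀ σ ρ α₀ : ℝ} (h : M.Admissible δ₀ σ ρ) (hα : 0 < α₀) {p : ℕ}
    (hp : 1 ≤ p) (f : Face M.n) {g : E3 → ℝ} (hg : ∀ x, 0 ≤ g x) :
    0 ≤ M.weight α₀ p f * ∫ x in M.faceDom f, g x ∂area := by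
  rcases (M.faceDom f).eq_empty_or_nonempty with hf | hf
  · rw [hf, Measure.restrict_empty, integral_zero_measure, mul_zero]
  · exact mul_nonneg (weight_pos h hα hp hf).le (integral_nonneg hg)

/-- The lifting is bounded by the tangential jumps: test its definition with the lifting itself,
and absorb the traces by the inverse trace inequality. -/
lemma normSq_lifting_le {δ₀ σ ρ α₀ : ℝ} (h : M.Admissible δ₀ σ ρ) (hα : 0 < α₀) {p : ℕ}
    (hp : 1 ≤ p) {C : ℝ} (hC : 0 < C)
    (hinv : ∀ t ∈ M.Xp p, ∑ f, (M.weight α₀ p f)⁻¹ *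
      ∫ x in M.faceDom f, sqNorm (traceM f t x) ∂area ≤ C * M.normSq t)
    {v : E3 → C3} (hv : v ∈ M.Xp p) :
    M.normSq (M.lifting p v) ≤ C * ∑ f, M.weight α₀ p f *
      ∫ x in M.faceDom f, sqNorm (M.jumpT f v x) ∂area := by
  set L := M.lifting p v with hL
  have hlift : M.IsLifting p v L := isLifting_lifting hv
  have hLpc := piecewiseCont_of_mem hlift.1
  have hvpc := piecewiseCont_of_mem hv
  have h1 : M.normSq L = ∑ f : Face M.n,
      ∫ x in M.faceDom f, (M.jumpT f v x ⬝ᵥ star (traceM f L x)).re ∂area := by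
    have e := hlift.2 L hlift.1
    rw [ip_self] at e
    have e' := congrArg Complex.re e
    rw [Complex.ofReal_re, Complex.re_sum] at e'
    rw [e']
    refine Finset.sum_congr rfl fun f _ => ?_
    simp only [jumpT_dotProduct_traceMinus]
    exact (integral_re ((tame_jumpT hvpc f).comp₂ (tame_traceM hLpc f)
      continuous_dotProduct_star).integrable).symm
  have h2 : ∀ f : Face M.n,
      ∫ x in M.faceDom f, (M.jumpT f v x ⬝ᵥ star (traceM f L x)).re ∂area ≤
      C / 2 * (M.weight α₀ p f * ∫ x in M.faceDom f, sqNorm (M.jumpT f v x) ∂area) +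
      C⁻¹ / 2 * ((M.weight α₀ p f)⁻¹ * ∫ x in M.faceDom f, sqNorm (traceM f L x) ∂area) := by
    intro f
    -- For an empty domain of integration the weight may be a junk value.
    rcases (M.faceDom f).eq_empty_or_nonempty with hf | hf
    · simp only [hf, Measure.restrict_empty, integral_zero_measure, mul_zero, add_zero, le_refl]
    have hw := weight_pos h hα hp hf
    have i1 := ((tame_jumpT hvpc f).comp continuous_sqNorm).integrable
    have i2 := ((tame_traceM hLpc f).comp continuous_sqNorm).integrable
    have i3 := ((tame_jumpT hvpc f).comp₂ (tame_traceM hLpc f)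
      continuous_dotProduct_star).integrable
    have hY : ∀ x, (M.jumpT f v x ⬝ᵥ star (traceM f L x)).re ≤
        C * M.weight α₀ p f / 2 * sqNorm (M.jumpT f v x) +
        (C * M.weight α₀ p f)⁻¹ / 2 * sqNorm (traceM f L x) := fun x =>
      re_dotProduct_star_le _ _ (by positivity)
    refine (integral_mono i3.re ((i1.const_mul _).add (i2.const_mul _)) hY).trans (le_of_eq ?_)
    rw [integral_add' (i1.const_mul _) (i2.const_mul _), integral_const_mul, integral_const_mul,
      mul_inv]
    ring
  have h3 := Finset.sum_le_sum fun f (_ : f ∈ (Finset.univ : Finset (Face M.n))) => h2 f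
  rw [← h1, Finset.sum_add_distrib, ← Finset.mul_sum, ← Finset.mul_sum] at h3
  have h4 := mul_le_mul_of_nonneg_left (hinv L hlift.1) (by positivity : 0 ≤ C⁻¹ / 2)
  have h5 : C⁻¹ / 2 * (C * M.normSq L) = M.normSq L / 2 := by field_simp
  rw [h5] at h4
  linarith

/-- The form on the diagonal is a sum of squares. -/
lemma a_self (μ ε : Fin 2 → ℝ) (α₀ : ℝ) (p : ℕ) (v : E3 → C3) :
    M.a μ ε α₀ p v v = (((∑ K, ∫ x in (M.elem K).carrier ∩ G.Ω,
        (G.coef μ x)⁻¹ * sqNorm (curl v x - M.lifting p v x))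
      + (∑ f : Face M.n, M.weight α₀ p f * ∫ x in M.faceDom f, sqNorm (M.jumpT f v x) ∂area)
      + (∑ f : InnerFace M.n, M.weight α₀ p (.inl f) *
        ∫ x in M.faceDom (.inl f), ‖M.jumpN ε f v x‖ ^ 2 ∂area) : ℝ) : ℂ) := by
  have h1 : ∀ z : ℂ, z * star z = ((‖z‖ ^ 2 : ℝ) : ℂ) := fun z => by
    rw [RCLike.star_def, Complex.mul_conj, Complex.normSq_eq_norm_sq]
  simp only [a, ip, smul_dotProduct, dotProduct_star_self, smul_eq_mul, ← Complex.ofReal_mul, h1,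
    integral_complex_ofReal, ← Complex.ofReal_sum, ← Complex.ofReal_add]

end Mesh

end UnfittedMaxwell

end

open UnfittedMaxwell UnfittedMaxwell.Mesh in
theorem lemma4p2 (G : UnfittedMaxwell.Geometry) (μ ε : Fin 2 → ℝ)
    (hμ : ∀ i, 0 < μ i) (hε : ∀ i, 0 < ε i) (α₀ : ℝ) (hα₀ : 0 < α₀)
    (δ₀ : ℝ) (hδ₀ : δ₀ ∈ Set.Ioo (0 : ℝ) (1 / 2)) (σ ρ : ℝ) :
    ∃ c > 0, ∀ M : UnfittedMaxwell.Mesh G, M.Admissible δ₀ σ ρ → ∀ p : ℕ, 1 ≤ p →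
      ∀ v ∈ M.Xp p, (∃! w, M.IsLifting p v w) ∧
        c * M.seminormSq ε α₀ p v ≤ ‖M.a μ ε α₀ p v v‖ := by
  obtain ⟨C, hC, hinv⟩ := exists_inverse_trace G hδ₀.1 hδ₀.2 σ ρ hα₀
  have hμ0 := hμ 0
  have hμ1 := hμ 1
  refine ⟨(2 * (μ 0 + μ 1) + 2 * C + 1)⁻¹, by positivity, fun M hM p hp v hv =>
    ⟨existsUnique_isLifting hv, ?_⟩⟩
  have hL := (isLifting_lifting hv).1
  have hcurl := piecewiseCont_curl hv
  have hLpc := piecewiseCont_of_mem hL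
  have h1 := normSq_le_two_mul_sub hcurl hLpc
  have h2 := normSq_le_weighted hμ (hcurl.sub hLpc)
  have h3 := normSq_lifting_le hM hα₀ hp hC (fun t ht => hinv M hM p hp t ht) hv
  have hT : 0 ≤ ∑ f : Face M.n, M.weight α₀ p f *
      ∫ x in M.faceDom f, sqNorm (M.jumpT f v x) ∂area :=
    Finset.sum_nonneg fun f _ =>
      weight_mul_integral_nonneg hM hα₀ hp f fun x => sqNorm_nonneg _
  have hN : 0 ≤ ∑ f : InnerFace M.n, M.weight α₀ p (.inl f) *
      ∫ x in M.faceDom (.inl f), ‖M.jumpN ε f v x‖ ^ 2 ∂area :=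
    Finset.sum_nonneg fun f _ =>
      weight_mul_integral_nonneg hM hα₀ hp (.inl f) fun x => by positivity
  have hA := nonneg_of_mul_nonneg_right ((normSq_nonneg _).trans h2) (by positivity)
  rw [a_self, Complex.norm_real, inv_mul_le_iff₀ (by positivity)]
  refine le_trans ?_ (mul_le_mul_of_nonneg_left (Real.le_norm_self _) (by positivity))
  change M.normSq (curl v) + _ + _ ≤ _
  set A := ∑ K, ∫ x in (M.elem K).carrier ∩ G.Ω,
    (G.coef μ x)⁻¹ * sqNorm (curl v x - M.lifting p v x)
  set S := ∑ f : Face M.n, M.weight α₀ p f *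
    ∫ x in M.faceDom f, sqNorm (M.jumpT f v x) ∂area
  set N := ∑ f : InnerFace M.n, M.weight α₀ p (.inl f) *
    ∫ x in M.faceDom (.inl f), ‖M.jumpN ε f v x‖ ^ 2 ∂area
  have hm : 0 ≤ μ 0 + μ 1 := by positivity
  nlinarith [mul_nonneg hm hA, mul_nonneg hm hT, mul_nonneg hm hN, mul_nonneg hC.le hA,
    mul_nonneg hC.le hT, mul_nonneg hC.le hN]
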